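/- Polyhedra here are abstract polyhedra (abstract polytopes of rank 3): ranked posets with a unique face of rank $-1$ and a unique face of rank $3$, whose faces of ranks $0,1,2$ are called vertices, edges and facets, in which every flag (maximal chain) has exactly one face of each rank $-1,\dots,3$, which are strongly flag-connected and which satisfy the diamond property. A polyhedron is regular if its group $\Gamma(\mathcal P)$ of rank-preserving poset automorphisms is transitive on the flags. It has type $\{p,q\}$ if every facet has $p$ vertices and every vertex lies on $q$ edges; it is flat if every facet is incident to every vertex, and it is vertex-faithful if only the identity of $\Gamma(\mathcal P)$ fixes every vertex. Let $\{4,4\}_{(b,0)}$ be the toroidal map obtained from the tessellation of the plane by unit squares with vertex set $\mathbb Z^2$ by factoring out the translations in $b\mathbb Z^2$. Its Petrial has the same vertices and edges, and has as facets the Petrie polygons (the zigzag edge paths in which exactly two successive edges at a time belong to a common facet). Let $(\{4,4\}_{(b,0)})^{\pi\delta}$ be the dual (the poset with reversed order) of this Petrial. Proposition. Let $b \ge 7$ be a prime and let $\mathcal P$ be a non-flat, vertex-faithful regular polyhedron of type $\{p,q\}$ with exactly $2b$ vertices. Suppose that the action of $\Gamma(\mathcal P)$ on the vertices has a block system consisting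 of two blocks of size $b$. Then $q = 2b$, and $\mathcal P$ is isomorphic to $(\{4,4\}_{(b,0)})^{\pi\delta}$. -/

import Mathlib

namespace AbsPoly

/-- A partially ordered set with a strictly increasing integer-valued rank function. Its elements
are called faces. -/
class RankedPoset (F : Type*) extends PartialOrder F where
  rank : F → ℤ
  rank_strictMono : StrictMono rank

open RankedPoset

section Basic

variable (F : Type*) [RankedPoset F]

/-- The faces of rank 0. -/
abbrev Vertex : Type _ := {x : F // rank x = 0}

/-- The faces of rank 1. -/
abbrev Edge : Type _ := {x : F // rank x = 1}

/-- The faces of rank 2. -/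
abbrev Facet : Type _ := {x : F // rank x = 2}

variable {F}

/-- Two flags (maximal chains) are `i`-adjacent if they differ exactly in their faces of
rank `i`. -/
def AdjacentAt (i : ℤ) (Φ Ψ : Flag F) : Prop :=
  Φ ≠ Ψ ∧ ∀ x : F, rank x ≠ i → (x ∈ Φ ↔ x ∈ Ψ)

variable (F)

/-- Abstract polyhedra, that is, abstract polytopes of rank 3, with the improper faces of
rank -1 and 3 included. -/
structure IsPolyhedron : Prop where
  rank_mem : ∀ x : F, rank x ∈ Set.Icc (-1 : ℤ) 3
  existsUnique_least : ∃! x : F, rank x = -1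
  existsUnique_greatest : ∃! x : F, rank x = 3
  /-- Every flag has exactly five faces, one of each rank. -/
  existsUnique_mem_flag : ∀ Φ : Flag F, ∀ i ∈ Set.Icc (-1 : ℤ) 3, ∃! x : F, x ∈ Φ ∧ rank x = i
  /-- Strong flag-connectedness: any two flags are joined by a sequence of successively adjacent
  flags that all contain the faces which the two flags have in common. -/
  strongly_connected : ∀ Φ Ψ : Flag F,
    Relation.ReflTransGen
      (fun A B : Flag F => (∃ i, AdjacentAt i A B) ∧ ∀ x : F, x ∈ Φ → x ∈ Ψ → x ∈ B) Φ Ψ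
  /-- The diamond property. -/
  diamond : ∀ x y : F, x < y → rank x = rank y - 2 → {z : F | x < z ∧ z < y}.ncard = 2

/-- The automorphism group: all rank-preserving order automorphisms. -/
def Aut : Subgroup (F ≃o F) where
  carrier := {g | ∀ x, rank (g x) = rank x}
  one_mem' := fun _ => rfl
  mul_mem' := fun {a b} ha hb x => (ha (b x)).trans (hb x)
  inv_mem' := fun {a} ha x => by
    have h := ha (a⁻¹ x)
    rw [RelIso.apply_inv_self] at h
    exact h.symm

/-- The action of the automorphism group on the vertices. -/
instance : MulAction (Aut F) (Vertex F) where
  smul g v := ⟨g.1 v.1, (g.2 v.1).trans v.2⟩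
  one_smul _ := rfl
  mul_smul _ _ _ := rfl

/-- Regularity: the automorphism group is transitive on the flags. -/
def IsRegular : Prop := MulAction.IsPretransitive (Aut F) (Flag F)

/-- The only automorphism that fixes every vertex is the identity. -/
def IsVertexFaithful : Prop := ∀ g : Aut F, (∀ v : Vertex F, g • v = v) → g = 1

/-- Every facet is incident to every vertex. -/
def IsFlat : Prop := ∀ (f : Facet F) (v : Vertex F), v.1 ≤ f.1

/-- Every facet has `p` vertices and every vertex lies on `q` edges. -/
def HasSchlafliType (p q : ℕ∞) : Prop :=
  (∀ f : Facet F, {v : Vertex F | v.1 ≤ f.1}.encard = p) ∧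
    ∀ v : Vertex F, {e : Edge F | v.1 ≤ e.1}.encard = q

/-- Isomorphism of ranked posets: a bijection that preserves the order (hence incidence) in both
directions and the rank. -/
def Isomorphic (F G : Type*) [RankedPoset F] [RankedPoset G] : Prop :=
  ∃ φ : F ≃o G, ∀ x, rank (φ x) = rank x

/-- The dual of a polyhedron: the order is reversed, and rank `i` becomes rank `2 - i`. -/
instance : RankedPoset Fᵒᵈ where
  rank x := 2 - rank (OrderDual.ofDual x)
  rank_strictMono := fun _ _ h => by
    have := rank_strictMono (OrderDual.ofDual_lt_ofDual.2 h)
    simp only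
    omega

end Basic

/-- A poset of vertices, edges and facets (of dimensions 0, 1, 2), without improper faces. -/
class CellPoset (X : Type*) extends PartialOrder X where
  dim : X → ℤ
  dim_mem : ∀ x, dim x ∈ Set.Icc (0 : ℤ) 2
  dim_strictMono : StrictMono dim

/-- Adjoining a least face of rank -1 and a greatest face of rank 3 to a poset of vertices, edges
and facets. -/
abbrev WithImproper (X : Type*) : Type _ := WithBot (WithTop X)

instance (X : Type*) [CellPoset X] : RankedPoset (WithImproper X) where
  rank := WithBot.recBotCoe (-1) (WithTop.recTopCoe 3 CellPoset.dim)
  rank_strictMono := by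
    intro x y h
    induction x using WithBot.recBotCoe with
    | bot =>
      induction y using WithBot.recBotCoe with
      | bot => simp at h
      | coe y =>
        induction y using WithTop.recTopCoe with
        | top => exact (by norm_num : (-1 : ℤ) < 3)
        | coe y =>
          have := (CellPoset.dim_mem y).1
          change (-1 : ℤ) < CellPoset.dim y
          omega
    | coe x =>
      induction y using WithBot.recBotCoe with
      | bot => simp at h
      | coe y =>
        have h := WithBot.coe_lt_coe.1 h
        induction x using WithTop.recTopCoe with
        | top => simp at h
        | coe x =>
          induction y using WithTop.recTopCoe with
          | top =>
            have := (CellPoset.dim_mem x).2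
            change CellPoset.dim x < 3
            omega
          | coe y => simpa using CellPoset.dim_strictMono (WithTop.coe_lt_coe.1 h)

/-! The toroidal map {4,4}_(s,0): the tessellation of the plane by unit squares with vertex set
ℤ², modulo the translations in sℤ². It is the product cell decomposition of two copies of the
circle ℝ/sℤ, each one divided into `s` unit intervals. -/

/-- The cells of the circle ℝ/sℤ: the nodes `i` and the sides `[i, i+1]`, for `i` modulo `s`. -/
inductive CircleCell (s : ℕ) : Type
  | node (i : ZMod s) : CircleCell s
  | side (i : ZMod s) : CircleCell s

namespace CircleCell

/-- Inclusion of cells: the side `i` contains the nodes `i` and `i + 1`. -/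
def Le {s : ℕ} : CircleCell s → CircleCell s → Prop
  | node i, node j => i = j
  | node j, side i => j = i ∨ j = i + 1
  | side _, node _ => False
  | side i, side j => i = j

instance (s : ℕ) : PartialOrder (CircleCell s) where
  le := Le
  le_refl x := by cases x <;> simp [Le]
  le_trans x y z := by
    cases x <;> cases y <;> cases z <;> simp only [Le] <;> intro h k <;>
      first | contradiction | (subst h; exact k) | (subst k; exact h)
  le_antisymm x y := by
    cases x <;> cases y <;> simp only [Le] <;> intro h k <;>
      first | contradiction | rw [h]

/-- Nodes have dimension 0 and sides have dimension 1. -/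
def dim {s : ℕ} : CircleCell s → ℤ
  | node _ => 0
  | side _ => 1

theorem dim_strictMono {s : ℕ} : StrictMono (dim (s := s)) := by
  intro x y h
  obtain ⟨h1, h2⟩ := lt_iff_le_not_ge.1 h
  change Le x y at h1
  change ¬ Le y x at h2
  cases x <;> cases y <;> simp_all [Le, dim]

end CircleCell

instance (s : ℕ) : CellPoset (CircleCell s × CircleCell s) where
  dim c := c.1.dim + c.2.dim
  dim_mem c := by
    obtain ⟨a, b⟩ := c
    cases a <;> cases b <;> simp [CircleCell.dim]
  dim_strictMono := by
    intro x y h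
    rcases Prod.lt_iff.1 h with ⟨h1, h2⟩ | ⟨h1, h2⟩
    · exact add_lt_add_of_lt_of_le (CircleCell.dim_strictMono h1)
        (CircleCell.dim_strictMono.monotone h2)
    · exact add_lt_add_of_le_of_lt (CircleCell.dim_strictMono.monotone h1)
        (CircleCell.dim_strictMono h2)

/-- The face poset of the toroidal map {4,4}_(s,0), with the componentwise order on its cells. -/
abbrev TorusMap (s : ℕ) : Type := WithImproper (CircleCell s × CircleCell s)

section Petrial

variable (F : Type*) [RankedPoset F]

/-- One step along a Petrie polygon, in terms of flags (vertex, edge, facet): either change the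
edge, or change the vertex and then the facet. -/
def PetrieStep (Φ Ψ : Flag F) : Prop :=
  AdjacentAt 1 Φ Ψ ∨ ∃ Θ : Flag F, AdjacentAt 0 Φ Θ ∧ AdjacentAt 2 Θ Ψ

/-- The Petrie polygons: the classes of flags under the equivalence relation generated by
`PetrieStep`. The edges of the flags in a class, taken in order, form a closed (or two-way infinite)
path of which exactly two successive edges at a time belong to a common facet. -/
def PetriePolygon : Type _ := Quot (PetrieStep F)

variable {F}

/-- The edge `e` belongs to the Petrie polygon `C`. -/
def PetriePolygon.HasEdge (C : PetriePolygon F) (e : Edge F) : Prop :=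
  ∃ Φ : Flag F, e.1 ∈ Φ ∧ Quot.mk _ Φ = C

variable (F)

/-- The proper faces of the Petrial: the vertices and edges of the polyhedron, and its Petrie
polygons as facets. -/
inductive PetrialCell : Type _
  | vertex (v : Vertex F) : PetrialCell
  | edge (e : Edge F) : PetrialCell
  | polygon (C : PetriePolygon F) : PetrialCell

namespace PetrialCell

variable {F}

/-- Vertices and edges are incident as before; a Petrie polygon is incident to its edges and to
their end points. -/
def Le : PetrialCell F → PetrialCell F → Prop
  | vertex v, vertex w => v = w
  | vertex v, edge e => v.1 ≤ e.1
  | vertex v, polygon C => ∃ e : Edge F, v.1 ≤ e.1 ∧ C.HasEdge e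
  | edge _, vertex _ => False
  | edge e, edge e' => e = e'
  | edge e, polygon C => C.HasEdge e
  | polygon _, vertex _ => False
  | polygon _, edge _ => False
  | polygon C, polygon D => C = D

instance : PartialOrder (PetrialCell F) where
  le := Le
  le_refl x := by cases x <;> simp [Le]
  le_trans x y z := by
    cases x <;> cases y <;> cases z <;> simp only [Le] <;> intro h k <;>
      first
        | contradiction
        | (subst h; exact k)
        | (subst k; exact h)
        | exact ⟨_, h, k⟩
  le_antisymm x y := by
    cases x <;> cases y <;> simp only [Le] <;> intro h k <;>
      first | contradiction | rw [h]

instance : CellPoset (PetrialCell F) where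
  dim
    | vertex _ => 0
    | edge _ => 1
    | polygon _ => 2
  dim_mem x := by cases x <;> simp
  dim_strictMono := by
    intro x y h
    obtain ⟨h1, h2⟩ := lt_iff_le_not_ge.1 h
    change Le x y at h1
    change ¬ Le y x at h2
    cases x <;> cases y <;> simp_all [Le]

end PetrialCell

/-- The Petrial (Petrie dual), with its improper faces. -/
abbrev Petrial : Type _ := WithImproper (PetrialCell F)

end Petrial

end AbsPoly

/-! Write Γ for the automorphism group and `r₀`, `r₁`, `r₂` for its generators at a base flag. Γ
acts faithfully and transitively on the 2b vertices, and the stabilizer of the base vertex u is the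
dihedral group ⟨r₁, r₂⟩. If B is the block of u, then r₁ and r₂ preserve B, so r₀ must interchange
the two blocks.

The group-theoretic core is `false_of_dihedral_stabilizer`: a faithful transitive group of odd prime
degree cannot have a point stabilizer generated by two distinct nontrivial involutions. Hence the
setwise stabilizer of B is not faithful on B. Primitivity in prime degree and Cauchy's theorem then
give an element c of order b that fixes B pointwise and permutes the other block in a b-cycle.
Having odd order and fixing u, c is a power of r₁r₂. Conjugation by r₀r₁r₀ sends c to c or to its
inverse (`conj_eq_or_eq_inv`). In the inverting case ⟨r₀, r₁⟩, which fixes the base facet, is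
already transitive on the vertices, so the polyhedron is flat. In the commuting case the vertices
are identified with `Bool × ZMod b` so that the generators act by explicit formulas
(`transitive_or_exists_toroidalCoordinates`).

These formulas determine the polyhedron. The elements c and r₀cr₀ generate translations by `ZMod b ×
ZMod b`. The facets form one orbit of translations and the edges form two, and since 2 is invertible
modulo b, the translation parameters k = i - j, l = i + j turn faces into nodes and edges of the b ×
b torus (`IsToroidalCoordinates.exists_isModel`). On the other side, a diagonal or antidiagonal
coordinate of a flag is a complete invariant of its Petrie polygon (`mk_flag_eq`), which gives the
same description of the dual of the Petrial (`isModel_torusFace`). Both posets are thus copies of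
`Shape b`, and the isomorphism and q = 2b are read off from there. -/

namespace AbsPoly

/-! ### Groups generated by two involutions. -/

section Dihedral

variable {G : Type*} [Group G] {r s : G}

theorem mul_zpow_mul_of_involutions (hr : r * r = 1) (hs : s * s = 1) (n : ℤ) :
    r * (r * s) ^ n * r = (r * s) ^ (-n) := by
  have hr' : r⁻¹ = r := inv_eq_of_mul_eq_one_right hr
  have hs' : s⁻¹ = s := inv_eq_of_mul_eq_one_right hs
  have h : r * (r * s) * r⁻¹ = (r * s)⁻¹ := by
    rw [mul_inv_rev, hr', hs', ← mul_assoc, hr, one_mul]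
  have h2 := conj_zpow (i := n) (a := r) (b := r * s)
  rw [h, hr', inv_zpow'] at h2
  exact h2.symm

theorem exists_zpow_of_mem_closure_involutions (hr : r * r = 1) (hs : s * s = 1) {g : G}
    (hg : g ∈ Subgroup.closure {r, s}) :
    ∃ n : ℤ, g = (r * s) ^ n ∨ g = (r * s) ^ n * r := by
  have hr' : r⁻¹ = r := inv_eq_of_mul_eq_one_right hr
  have key := mul_zpow_mul_of_involutions hr hs
  have key2 (n : ℤ) : r * (r * s) ^ n = (r * s) ^ (-n) * r := by
    rw [← key, mul_assoc, hr, mul_one]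
  induction hg using Subgroup.closure_induction with
  | mem x hx =>
    rcases hx with rfl | rfl
    · exact ⟨0, by simp⟩
    · refine ⟨-1, Or.inr ?_⟩
      rw [← key2, zpow_one, ← mul_assoc, hr, one_mul]
  | one => exact ⟨0, by simp⟩
  | mul x y _ _ hx hy =>
    obtain ⟨n, rfl | rfl⟩ := hx <;> obtain ⟨m, rfl | rfl⟩ := hy
    · exact ⟨n + m, Or.inl (zpow_add _ _ _).symm⟩
    · exact ⟨n + m, Or.inr (by rw [zpow_add, mul_assoc])⟩
    · exact ⟨n - m, Or.inr (by rw [sub_eq_add_neg, zpow_add, mul_assoc, key2, mul_assoc])⟩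
    · refine ⟨n - m, Or.inl ?_⟩
      rw [sub_eq_add_neg, zpow_add, ← key]
      simp only [mul_assoc]
  | inv x _ hx =>
    obtain ⟨n, rfl | rfl⟩ := hx
    · exact ⟨-n, Or.inl (by rw [zpow_neg])⟩
    · refine ⟨n, Or.inr ?_⟩
      rw [mul_inv_rev, hr', ← zpow_neg, key2, neg_neg]

theorem zpow_mul_sq_of_involutions (hr : r * r = 1) (hs : s * s = 1) (n : ℤ) :
    ((r * s) ^ n * r) ^ 2 = 1 := by
  rw [sq, mul_assoc, ← mul_assoc r, mul_zpow_mul_of_involutions hr hs, zpow_neg, mul_inv_cancel]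

end Dihedral

/-! ### Faithful transitive actions. -/

section Faithful

open MulAction Subgroup

variable {G X : Type*} [Group G] [MulAction G X] [FaithfulSMul G X] [IsPretransitive G X]

/-- A conjugate of h fixes x exactly when h fixes the corresponding translate of x, and these
translates exhaust X. -/
theorem eq_one_of_conj_smul_eq {x : X} {h : G} (H : ∀ g : G, (g⁻¹ * h * g) • x = x) : h = 1 := by
  refine FaithfulSMul.eq_of_smul_eq_smul (α := X) fun y => ?_
  obtain ⟨g, rfl⟩ := exists_smul_eq G x y
  have := H g
  rw [mul_smul, mul_smul, inv_smul_eq_iff] at this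
  rw [this, one_smul]

theorem eq_one_of_normal_stabilizer {x : X} (hN : (stabilizer G x).Normal) {h : G}
    (hx : h • x = x) : h = 1 :=
  eq_one_of_conj_smul_eq fun g => by
    have := hN.conj_mem h hx g⁻¹
    rwa [inv_inv] at this

/-- The subgroup of all elements that centralize or invert `h`. -/
def centralizeOrInvert (h : G) : Subgroup G where
  carrier := {g | g * h * g⁻¹ = h ∨ g * h * g⁻¹ = h⁻¹}
  one_mem' := by simp
  mul_mem' := by
    rintro a b ha hb
    have : a * b * h * (a * b)⁻¹ = a * (b * h * b⁻¹) * a⁻¹ := by group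
    have h2 : a * h⁻¹ * a⁻¹ = (a * h * a⁻¹)⁻¹ := by group
    simp only [Set.mem_ofPred_eq] at ha hb ⊢
    rw [this]
    rcases hb with hb | hb <;> rw [hb]
    · exact ha
    · rw [h2]
      rcases ha with ha | ha <;> rw [ha] <;> simp
  inv_mem' := by
    rintro a ha
    simp only [Set.mem_ofPred_eq] at ha ⊢
    rcases ha with ha | ha
    · left; nth_rw 1 [← ha]; group
    · right
      have h2 : a⁻¹ * h⁻¹ * a = h := by rw [← ha]; group
      calc a⁻¹ * h * a⁻¹⁻¹ = (a⁻¹ * h⁻¹ * a)⁻¹ := by group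
        _ = h⁻¹ := by rw [h2]

theorem mem_centralizeOrInvert {g h : G} :
    g ∈ centralizeOrInvert h ↔ g * h * g⁻¹ = h ∨ g * h * g⁻¹ = h⁻¹ := Iff.rfl

end Faithful

/-! ### Permutation groups of prime degree with dihedral point stabilizer. -/

section PrimeDegree

open MulAction Subgroup

variable {G X : Type*} [Group G] [MulAction G X] [FaithfulSMul G X] [IsPretransitive G X]
  {b : ℕ} {x : X} {r s : G}

theorem mem_centralizeOrInvert_of_dihedral (hr : r * r = 1) (hs : s * s = 1) {d h : G}
    (hd : ∃ n : ℤ, d = (r * s) ^ n ∨ d = (r * s) ^ n * r) (hh : ∃ m : ℤ, h = (r * s) ^ m) :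
    d ∈ centralizeOrInvert h := by
  have hr' : r⁻¹ = r := inv_eq_of_mul_eq_one_right hr
  obtain ⟨m, rfl⟩ := hh
  obtain ⟨n, rfl | rfl⟩ := hd
  · left
    rw [(Commute.zpow_zpow_self (r * s) n m).eq, mul_assoc, mul_inv_cancel, mul_one]
  · right
    have : (r * s) ^ n * r * (r * s) ^ m * ((r * s) ^ n * r)⁻¹
        = (r * s) ^ n * (r * (r * s) ^ m * r) * ((r * s) ^ n)⁻¹ := by
      rw [mul_inv_rev, hr']; simp only [mul_assoc]
    rw [this, mul_zpow_mul_of_involutions hr hs, zpow_neg, ← zpow_neg, 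
      (Commute.zpow_zpow_self (r * s) n (-m)).eq, mul_assoc, mul_inv_cancel, mul_one]

/-- In prime degree the action is primitive, so the stabilizer of x is a maximal subgroup. The group
N of elements centralizing or inverting h contains this stabilizer and also its conjugate by g. If N
is just the stabilizer, then g normalizes it without lying in it, so by maximality it is normal,
hence trivial. Otherwise N = G, so every conjugate of h is h or its inverse, and all of them fix x.
-/
theorem eq_one_of_mem_conj_rotation (hb : b.Prime) (hX : Nat.card X = b)
    (hr : r * r = 1) (hs : s * s = 1)
    (hD : ∀ g : G, g • x = x ↔ ∃ n : ℤ, g = (r * s) ^ n ∨ g = (r * s) ^ n * r)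
    {g h : G} (hg : g • x ≠ x) (h1 : ∃ m : ℤ, h = (r * s) ^ m)
    (h2 : ∃ m : ℤ, g⁻¹ * h * g = (r * s) ^ m) : h = 1 := by
  have : Finite X := Nat.finite_of_card_ne_zero (by rw [hX]; exact hb.ne_zero)
  have : Finite G := Finite.of_injective (toPermHom G X) toPerm_injective
  have : Nontrivial X := ⟨_, _, hg⟩
  have hprim : IsPreprimitive G X := IsPreprimitive.of_prime_card (by rwa [hX])
  have hco := IsPreprimitive.isCoatom_stabilizer_of_isPreprimitive G x
  have hle : stabilizer G x ≤ centralizeOrInvert h := fun d hd =>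
    mem_centralizeOrInvert_of_dihedral hr hs ((hD d).1 hd) h1
  have hle2 : ∀ d ∈ stabilizer G x, g * d * g⁻¹ ∈ centralizeOrInvert h := by
    intro d hd
    have := mem_centralizeOrInvert_of_dihedral hr hs ((hD d).1 hd) h2
    rw [mem_centralizeOrInvert] at this ⊢
    have e : g * d * g⁻¹ * h * (g * d * g⁻¹)⁻¹ = g * (d * (g⁻¹ * h * g) * d⁻¹) * g⁻¹ := by group
    rw [e]
    rcases this with h' | h' <;> rw [h']
    · left; group
    · right; group
  have hhx : h • x = x := (hD h).2 (h1.imp fun _ => Or.inl)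
  rcases hle.eq_or_lt with he | hlt
  · have hgn : g ∈ normalizer (stabilizer G x : Set G) :=
      mem_normalizer_fintype fun d hd => by
        have := hle2 d hd
        rwa [← he] at this
    have htop : normalizer (stabilizer G x : Set G) = ⊤ := by
      refine hco.2 _ (lt_of_le_of_ne le_normalizer fun e => hg ?_)
      rw [← e] at hgn
      exact hgn
    exact eq_one_of_normal_stabilizer (normalizer_eq_top_iff.1 htop) hhx
  · have htop := hco.2 _ hlt
    refine eq_one_of_conj_smul_eq (x := x) fun k => ?_
    have hk : k⁻¹ ∈ centralizeOrInvert h := by rw [htop]; trivial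
    rw [mem_centralizeOrInvert, inv_inv] at hk
    rcases hk with hk | hk <;> rw [hk]
    · exact hhx
    · rw [inv_smul_eq_iff, hhx]

/-- With w = g • x, the conjugate of c by g lies in the dihedral stabilizer of x, and there every
square is a rotation. So the square of c is a rotation with a rotation as conjugate, and
`eq_one_of_mem_conj_rotation` applies. -/
theorem sq_eq_one_of_rotation_fixes (hb : b.Prime) (hX : Nat.card X = b)
    (hr : r * r = 1) (hs : s * s = 1)
    (hD : ∀ g : G, g • x = x ↔ ∃ n : ℤ, g = (r * s) ^ n ∨ g = (r * s) ^ n * r)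
    {w : X} (hw : w ≠ x) {c : G} (hc : ∃ m : ℤ, c = (r * s) ^ m) (hcw : c • w = w) :
    c ^ 2 = 1 := by
  obtain ⟨g, rfl⟩ := exists_smul_eq G x w
  refine eq_one_of_mem_conj_rotation hb hX hr hs hD hw ?_ ?_
  · obtain ⟨m, rfl⟩ := hc
    exact ⟨m * (2 : ℕ), by rw [zpow_mul, zpow_natCast]⟩
  · have : (g⁻¹ * c * g) • x = x := by rw [mul_smul, mul_smul, hcw, inv_smul_smul]
    have e : g⁻¹ * c ^ 2 * g = (g⁻¹ * c * g) ^ 2 := by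
      rw [sq, sq]; group
    rw [e]
    obtain ⟨n, hn | hn⟩ := (hD _).1 this
    · exact ⟨n * (2 : ℕ), by rw [hn, zpow_mul, zpow_natCast]⟩
    · exact ⟨0, by rw [hn, zpow_mul_sq_of_involutions hr hs, zpow_zero]⟩

/-- Some point other than x has a free orbit under the rotations, and this orbit misses x. Otherwise
each point other than x is fixed by a rotation of order 2; a cyclic group has at most one such
element, which would then fix everything. -/
theorem orderOf_rotation_lt (hb : b.Prime) (hX : Nat.card X = b)
    (hr : r * r = 1) (hs : s * s = 1) (hrs : r ≠ s)
    (hD : ∀ g : G, g • x = x ↔ ∃ n : ℤ, g = (r * s) ^ n ∨ g = (r * s) ^ n * r) :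
    orderOf (r * s) < b := by
  have : Finite X := Nat.finite_of_card_ne_zero (by rw [hX]; exact hb.ne_zero)
  have : Finite G := Finite.of_injective (toPermHom G X) toPerm_injective
  have hrs1 : r * s ≠ 1 := fun h => hrs ((mul_eq_one_iff_eq_inv.1 h).trans
    (inv_eq_of_mul_eq_one_right hs))
  have hfix : ∀ m : ℤ, (r * s) ^ m • x = x := fun m => (hD _).2 ⟨m, Or.inl rfl⟩
  obtain ⟨w, hw, hreg⟩ : ∃ w : X, w ≠ x ∧ ∀ m : ℤ, (r * s) ^ m • w = w → (r * s) ^ m = 1 := by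
    by_contra! H
    have hsq : ∀ w : X, w ≠ x → ∃ m : ℤ, (r * s) ^ m • w = w ∧ orderOf ((r * s) ^ m) = 2 := by
      intro w hw
      obtain ⟨m, hm, hm1⟩ := H w hw
      refine ⟨m, hm, orderOf_eq_prime ?_ hm1⟩
      exact sq_eq_one_of_rotation_fixes hb hX hr hs hD hw ⟨m, rfl⟩ hm
    have huniq : ∀ m n : ℤ, orderOf ((r * s) ^ m) = 2 → orderOf ((r * s) ^ n) = 2 →
        (r * s) ^ m = (r * s) ^ n := by
      intro m n hm hn
      have := Fintype.ofFinite (zpowers (r * s))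
      have hcard : (Finset.univ.filter fun y : zpowers (r * s) => orderOf y = 2).card ≤ 1 := by
        by_cases hd : 2 ∣ Fintype.card (zpowers (r * s))
        · rw [IsCyclic.card_orderOf_eq_totient hd]; decide
        · rw [Finset.card_eq_zero.2]
          · simp
          · ext y
            simp only [Finset.mem_filter, Finset.mem_univ, true_and, Finset.notMem_empty, iff_false]
            exact fun hy => hd (hy ▸ orderOf_dvd_card)
      have := Finset.card_le_one.1 hcard ⟨(r * s) ^ m, m, rfl⟩
        (Finset.mem_filter.2 ⟨Finset.mem_univ _, (Subgroup.orderOf_mk _ _).trans hm⟩) ⟨(r * s) ^ n, n, rfl⟩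
        (Finset.mem_filter.2 ⟨Finset.mem_univ _, (Subgroup.orderOf_mk _ _).trans hn⟩)
      exact congrArg Subtype.val this
    have hne : ∃ w : X, w ≠ x := by
      have : Nontrivial X := Finite.one_lt_card_iff_nontrivial.1 (hX ▸ hb.one_lt)
      exact exists_ne x
    obtain ⟨w, hw⟩ := hne
    obtain ⟨m, hm, hm2⟩ := hsq w hw
    have : (r * s) ^ m = 1 := by
      refine FaithfulSMul.eq_of_smul_eq_smul (α := X) fun y => ?_
      rw [one_smul]
      by_cases hy : y = x
      · rw [hy, hfix]
      · obtain ⟨n, hn, hn2⟩ := hsq y hy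
        rw [huniq m n hm2 hn2, hn]
    rw [this, orderOf_one] at hm2
    omega
  have hinj : Function.Injective
      (fun c : zpowers (r * s) => (⟨c.1 • w, by
        obtain ⟨m, hm⟩ := c.2
        rw [← hm]
        intro h
        exact hw (smul_left_cancel _ (h.trans (hfix m).symm))⟩ : {y : X // y ≠ x})) := by
    rintro ⟨_, m, rfl⟩ ⟨_, n, rfl⟩ h
    have h1 : (r * s) ^ m • w = (r * s) ^ n • w := congrArg Subtype.val h
    have h2 : (r * s) ^ (-n + m) • w = w := by
      rw [zpow_add, mul_smul, h1, zpow_neg, inv_smul_smul]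
    have h3 := hreg _ h2
    rw [zpow_add, zpow_neg, inv_mul_eq_one] at h3
    exact Subtype.ext h3.symm
  have hle := Nat.card_le_card_of_injective _ hinj
  rw [Nat.card_zpowers] at hle
  refine hle.trans_lt ?_
  rw [← hX]
  exact Finite.card_subtype_lt (x := x) (by simp)

/-- A normal subgroup S = ⟨t⟩ of order b is transitive by primitivity, so an element that fixes x
and commutes with t is trivial. An involution fixing x sends t to a power with exponent n, where b
divides (n - 1)(n + 1), hence inverts t. The product of two such involutions then centralizes t, so
they coincide. -/
theorem false_of_normal_of_prime_order (hb : b.Prime) (hX : Nat.card X = b)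
    (hr : r * r = 1) (hs : s * s = 1) (hr1 : r ≠ 1) (hs1 : s ≠ 1) (hrs : r ≠ s)
    (hrx : r • x = x) (hsx : s • x = x) {S : Subgroup G} (hS : S.Normal) (hSb : Nat.card S = b) :
    False := by
  have : Finite X := Nat.finite_of_card_ne_zero (by rw [hX]; exact hb.ne_zero)
  have hprim : IsPreprimitive G X := IsPreprimitive.of_prime_card (by rwa [hX])
  have : Fact b.Prime := ⟨hb⟩
  have hcyc : IsCyclic S := isCyclic_of_prime_card hSb
  obtain ⟨⟨t, htS⟩, ht⟩ := hcyc.exists_generator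
  have ht' : ∀ y ∈ S, ∃ n : ℤ, t ^ n = y := fun y hy => by
    obtain ⟨n, hn⟩ := ht ⟨y, hy⟩
    exact ⟨n, congrArg Subtype.val hn⟩
  have hto : orderOf t = b := by
    have := orderOf_eq_card_of_forall_mem_zpowers ht
    rw [hSb] at this
    rw [← this, ← Subgroup.orderOf_coe]
  have ht1 : t ≠ 1 := fun h => hb.one_lt.ne' (by rw [← hto, h, orderOf_one])
  have htrans : IsPretransitive S X := by
    refine IsQuasiPreprimitive.isPretransitive_of_normal (G := G) fun h => ht1 ?_
    refine FaithfulSMul.eq_of_smul_eq_smul (α := X) fun y => ?_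
    have : y ∈ fixedPoints S X := h ▸ Set.mem_univ y
    rw [one_smul]
    exact this ⟨t, htS⟩
  have hcomm : ∀ g : G, g • x = x → g * t * g⁻¹ = t → g = 1 := by
    intro g hg hgt
    refine FaithfulSMul.eq_of_smul_eq_smul (α := X) fun y => ?_
    obtain ⟨⟨z, hz⟩, rfl⟩ := exists_smul_eq S x y
    obtain ⟨n, rfl⟩ := ht' z hz
    have h1 : g * t ^ n = t ^ n * g := by
      rw [← mul_inv_eq_iff_eq_mul, ← conj_zpow, hgt]
    change g • t ^ n • x = (1 : G) • t ^ n • x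
    rw [one_smul, ← mul_smul, h1, mul_smul, hg]
  have hinv : ∀ g : G, g * g = 1 → g ≠ 1 → g • x = x → g * t * g⁻¹ = t⁻¹ := by
    intro g hg hg1 hgx
    obtain ⟨n, hn⟩ := ht' _ (hS.conj_mem t htS g)
    have h2 : t ^ (n * n) = t := by
      rw [zpow_mul, hn, conj_zpow, hn]
      rw [← mul_assoc, ← mul_assoc, hg, one_mul, mul_assoc, ← mul_inv_rev, hg, inv_one, mul_one]
    have h3 : (b : ℤ) ∣ n * n - 1 := by
      rw [← hto, orderOf_dvd_iff_zpow_eq_one, zpow_sub, h2, zpow_one, mul_inv_cancel]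
    have h4 : n * n - 1 = (n - 1) * (n + 1) := by ring
    rw [h4] at h3
    rcases (Nat.prime_iff_prime_int.1 hb).dvd_or_dvd h3 with h | h
    · refine absurd (hcomm g hgx ?_) hg1
      rw [← hn]
      rw [← hto, orderOf_dvd_iff_zpow_eq_one, zpow_sub, zpow_one, mul_inv_eq_one] at h
      exact h
    · rw [← hn]
      rw [← hto, orderOf_dvd_iff_zpow_eq_one, zpow_add, zpow_one, mul_eq_one_iff_eq_inv] at h
      exact h
  refine hrs ?_
  have h := hcomm (r * s) (by rw [mul_smul, hsx, hrx]) (by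
    have : r * s * t * (r * s)⁻¹ = r * (s * t * s⁻¹) * r⁻¹ := by group
    rw [this, hinv s hs hs1 hsx]
    have : r * t⁻¹ * r⁻¹ = (r * t * r⁻¹)⁻¹ := by group
    rw [this, hinv r hr hr1 hrx, inv_inv])
  exact (mul_eq_one_iff_eq_inv.1 h).trans (inv_eq_of_mul_eq_one_right hs)

/-- The order of the stabilizer D is below 2b and prime to b, so Sylow b-subgroups have order b. A
normal one is excluded by `false_of_normal_of_prime_order`. If there are several, they are
self-normalizing, and Burnside's transfer theorem makes D a normal complement, which is impossible
in a faithful transitive action because r ≠ 1. -/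
theorem false_of_dihedral_stabilizer (hb : b.Prime) (hb2 : b ≠ 2) (hX : Nat.card X = b)
    (hr : r * r = 1) (hs : s * s = 1) (hr1 : r ≠ 1) (hs1 : s ≠ 1) (hrs : r ≠ s)
    (hD : ∀ g : G, g • x = x ↔ ∃ n : ℤ, g = (r * s) ^ n ∨ g = (r * s) ^ n * r) : False := by
  have : Finite X := Nat.finite_of_card_ne_zero (by rw [hX]; exact hb.ne_zero)
  have : Finite G := Finite.of_injective (toPermHom G X) toPerm_injective
  have : Fact b.Prime := ⟨hb⟩
  have hrx : r • x = x := (hD r).2 ⟨0, Or.inr (by simp)⟩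
  have hsx : s • x = x := (hD s).2 ⟨-1, Or.inr (by
    simp [inv_eq_of_mul_eq_one_right hr, inv_eq_of_mul_eq_one_right hs, mul_assoc, hr])⟩
  have hq := orderOf_rotation_lt hb hX hr hs hrs hD
  have hDcard : Nat.card (stabilizer G x) ≤ 2 * orderOf (r * s) := by
    have hsub : (stabilizer G x : Set G) ⊆
        (zpowers (r * s) : Set G) ∪ (fun g => g * r) '' (zpowers (r * s) : Set G) := by
      intro g hg
      obtain ⟨n, rfl | rfl⟩ := (hD g).1 hg
      · exact Or.inl ⟨n, rfl⟩
      · exact Or.inr ⟨_, ⟨n, rfl⟩, rfl⟩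
    have h1 := (Set.ncard_le_ncard hsub).trans (Set.ncard_union_le _ _)
    have h2 := Set.ncard_image_le (f := fun g => g * r) (s := (zpowers (r * s) : Set G))
    have h3 : (zpowers (r * s) : Set G).ncard = orderOf (r * s) := Nat.card_zpowers _
    have h4 : (stabilizer G x : Set G).ncard = Nat.card (stabilizer G x) := rfl
    omega
  have hGcard : Nat.card (stabilizer G x) * b = Nat.card G := by
    rw [← hX, ← index_stabilizer_of_transitive G x, card_mul_index]
  have hDpos : 0 < Nat.card (stabilizer G x) := Nat.card_pos
  -- As D has fewer than 2b elements, divisibility would force |D| = b, which is odd, although D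
  -- contains the involution r.
  have hDb : ¬ b ∣ Nat.card (stabilizer G x) := by
    rintro ⟨k, hk⟩
    have hk1 : k = 1 := by
      rcases k with _ | _ | k
      · omega
      · rfl
      · rw [hk] at hDcard; nlinarith
    have h2 : 2 ∣ Nat.card (stabilizer G x) := by
      have : orderOf (⟨r, hrx⟩ : stabilizer G x) = 2 := by
        rw [← Subgroup.orderOf_coe]
        exact orderOf_eq_prime (by rw [sq, hr]) hr1
      rw [← this]
      exact orderOf_dvd_natCard _
    rw [hk, hk1, mul_one, Nat.prime_dvd_prime_iff_eq Nat.prime_two hb] at h2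
    exact hb2 h2.symm
  obtain ⟨P⟩ : Nonempty (Sylow b G) := inferInstance
  have hP : Nat.card P = b := by
    rw [P.card_eq_multiplicity, ← hGcard, Nat.factorization_mul hDpos.ne' hb.ne_zero]
    rw [Finsupp.add_apply, Nat.factorization_eq_zero_of_not_dvd hDb, hb.factorization_self,
      zero_add, pow_one]
  have hPi : (P : Subgroup G).index = Nat.card (stabilizer G x) := by
    have := card_mul_index (P : Subgroup G)
    change Nat.card P * _ = _ at this
    rw [hP, ← hGcard, mul_comm] at this
    exact Nat.eq_of_mul_eq_mul_right hb.pos this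
  have hn1 := card_sylow_modEq_one b G
  have hn2 := P.card_dvd_index
  rw [hPi] at hn2
  by_cases hn : Nat.card (Sylow b G) = 1
  · rw [P.card_eq_index_normalizer, index_eq_one] at hn
    exact false_of_normal_of_prime_order hb hX hr hs hr1 hs1 hrs hrx hsx
      (normalizer_eq_top_iff.1 hn) hP
  -- The number of Sylow subgroups is at least b + 1 and divides |D| < 2b, so it equals |D|, the
  -- index of P; hence P is its own normalizer.
  · have hpos : 0 < Nat.card (Sylow b G) := Nat.card_pos
    obtain ⟨k, hk⟩ := (Nat.modEq_iff_dvd' hpos).1 hn1.symm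
    obtain ⟨m, hm⟩ := hn2
    have hk0 : 1 ≤ k := by
      rcases k with _ | k <;> omega
    have hbk : b ≤ b * k := Nat.le_mul_of_pos_right _ hk0
    have hm1 : m = 1 := by
      rcases m with _ | _ | m
      · omega
      · rfl
      · have : Nat.card (Sylow b G) * 2 ≤ Nat.card (Sylow b G) * (m + 1 + 1) :=
          Nat.mul_le_mul_left _ (by omega)
        omega
    rw [hm1, mul_one] at hm
    have hnP : normalizer (P : Set G) = P := by
      refine (eq_of_le_of_card_ge le_normalizer ?_).symm
      have h1 := card_mul_index (normalizer (P : Set G))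
      have h2 := card_mul_index (P : Subgroup G)
      rw [← P.card_eq_index_normalizer, ← hm, ← hPi, ← h2] at h1
      exact (Nat.eq_of_mul_eq_mul_right (by rw [hPi]; exact hDpos) h1).le
    have hcyc : IsCyclic P := isCyclic_of_prime_card hP
    have hPc : normalizer (P : Set G) ≤ centralizer (P : Set G) := by
      rw [hnP]
      intro g hg h hh
      obtain ⟨z, hz⟩ := hcyc.exists_generator
      obtain ⟨i, hi⟩ := hz ⟨g, hg⟩
      obtain ⟨j, hj⟩ := hz ⟨h, hh⟩
      have h1 : (⟨h, hh⟩ : P) * ⟨g, hg⟩ = ⟨g, hg⟩ * ⟨h, hh⟩ := by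
        rw [← hi, ← hj]; exact (Commute.zpow_zpow_self z j i).eq
      exact congrArg Subtype.val h1
    have hcompl := (MonoidHom.ker_transferSylow_isComplement' P hPc).card_mul_card
    change _ * Nat.card P = _ at hcompl
    rw [hP, ← hGcard] at hcompl
    have hK := Nat.eq_of_mul_eq_mul_right hb.pos hcompl
    -- The transfer takes values in P, of order b, while elements of D have order prime to b.
    have hle : stabilizer G x ≤ (MonoidHom.transferSylow P hPc).ker := by
      intro d hd
      rw [MonoidHom.mem_ker]
      have h1 : orderOf (MonoidHom.transferSylow P hPc d) ∣ Nat.card (stabilizer G x) := by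
        refine (orderOf_map_dvd _ d).trans ?_
        have := orderOf_dvd_natCard (⟨d, hd⟩ : stabilizer G x)
        rwa [← Subgroup.orderOf_coe] at this
      have h2 : orderOf (MonoidHom.transferSylow P hPc d) ∣ b := by
        exact (_root_.orderOf_dvd_natCard _).trans hP.dvd
      rw [← orderOf_eq_one_iff]
      exact Nat.eq_one_of_dvd_coprimes ((Nat.Prime.coprime_iff_not_dvd hb).2 hDb) h2 h1
    have heq := eq_of_le_of_card_ge hle hK.le
    exact hr1 (eq_one_of_normal_stabilizer (x := x) (heq ▸ MonoidHom.normal_ker _) hrx)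

end PrimeDegree

end AbsPoly

namespace AbsPoly

/-! ### Two blocks of prime size: elements fixing one block pointwise. -/

section Coordinates

open MulAction Subgroup
open scoped Pointwise

/-- A cyclic group, finite or not, has at most one subgroup of order b. By Bézout, c and y lie in
the cyclic group of z = a ^ gcd(n, m), whose order divides b; since c already has order b, it
generates that group. -/
theorem mem_zpowers_of_pow_eq_one {G : Type*} [Group G] {b : ℕ} {a c y : G} (hb : 0 < b)
    (hc : c ∈ zpowers a) (hy : y ∈ zpowers a) (hcb : orderOf c = b) (hyb : y ^ b = 1) :
    y ∈ zpowers c := by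
  obtain ⟨n, rfl⟩ := hc
  obtain ⟨m, rfl⟩ := hy
  dsimp only at *
  set z := a ^ (Int.gcd n m : ℤ) with hz
  have hzb : z ^ b = 1 := by
    rw [hz, Int.gcd_eq_gcd_ab, zpow_add, zpow_mul, zpow_mul]
    have hcomm : Commute ((a ^ n) ^ Int.gcdA n m) ((a ^ m) ^ Int.gcdB n m) := by
      rw [← zpow_mul, ← zpow_mul]; exact Commute.zpow_zpow_self a _ _
    rw [hcomm.mul_pow]
    have h1 : (a ^ n) ^ b = 1 := by rw [← hcb]; exact pow_orderOf_eq_one _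
    rw [← zpow_natCast, ← zpow_mul, mul_comm, zpow_mul, zpow_natCast, h1, one_zpow, one_mul,
      ← zpow_natCast, ← zpow_mul, mul_comm, zpow_mul, zpow_natCast, hyb, one_zpow]
  have hsub (k : ℤ) (hk : (Int.gcd n m : ℤ) ∣ k) : a ^ k ∈ zpowers z := by
    obtain ⟨i, hi⟩ := hk
    exact ⟨i, by rw [hi, zpow_mul]⟩
  have hfin : Finite (zpowers z) :=
    (finite_zpowers.2 (isOfFinOrder_iff_pow_eq_one.2 ⟨b, hb, hzb⟩)).to_subtype
  have hle : zpowers (a ^ n) ≤ zpowers z := by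
    rw [zpowers_le]; exact hsub n (Int.gcd_dvd_left ..)
  have := eq_of_le_of_card_ge hle (by
    rw [Nat.card_zpowers, Nat.card_zpowers, hcb]
    exact Nat.le_of_dvd hb (orderOf_dvd_of_pow_eq_one hzb))
  rw [this]
  exact hsub m (Int.gcd_dvd_right ..)

theorem exists_zmod_power {G : Type*} [Group G] {b : ℕ} {c : G} (hc : c ^ b = 1) :
    ∃ f : ZMod b → G, ∀ n : ℤ, f n = c ^ n := by
  refine ⟨fun x => c ^ (x.cast : ℤ), fun n => ?_⟩
  dsimp only
  rw [ZMod.coe_intCast]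
  have h : c ^ (n % b) = c ^ (n % b + b * (n / b)) := by
    rw [zpow_add, zpow_mul, zpow_natCast, hc, one_zpow, mul_one]
  rw [h, Int.emod_add_mul_ediv]

variable {Γ V : Type*} [Group Γ] [MulAction Γ V] {b : ℕ} {u : V} {r₀ r₁ r₂ : Γ}

theorem exists_block_of_blockSystem (u : V)
    (h : ∃ ℬ : Set (Set V), IsBlockSystem Γ ℬ ∧ ℬ.ncard = 2 ∧ ∀ B ∈ ℬ, B.ncard = b) :
    ∃ B : Set V, IsBlock Γ B ∧ u ∈ B ∧ B.ncard = b := by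
  obtain ⟨ℬ, ⟨hpart, hblock⟩, -, hcard⟩ := h
  obtain ⟨B, ⟨hB, hu⟩, -⟩ := hpart.2 u
  exact ⟨B, hblock hB, hu, hcard B hB⟩

theorem IsBlock.smul_mem_iff {B : Set V} (hB : IsBlock Γ B) {x : V} (hx : x ∈ B) {g : Γ}
    (hg : g • x ∈ B) (y : V) : g • y ∈ B ↔ y ∈ B := by
  have h : g • B = B := by
    have := (isBlock_iff_smul_eq_smul_of_nonempty.1 hB) (g₁ := g) (g₂ := 1)
      ⟨g • x, Set.smul_mem_smul_set hx, by rwa [one_smul]⟩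
    rwa [one_smul] at this
  nth_rw 1 [← h]
  exact Set.smul_mem_smul_set_iff

theorem IsBlock.smul_mem_iff_notMem [Finite V] {B : Set V} (hB : IsBlock Γ B)
    (hV : Nat.card V = 2 * B.ncard) {x : V} (hx : x ∈ B) {g : Γ}
    (hg : g • x ∉ B) (y : V) : g • y ∈ B ↔ y ∉ B := by
  have hd : Disjoint (g • B) ((1 : Γ) • B) := hB fun h => hg (by
    rw [one_smul] at h
    rw [← h]; exact Set.smul_mem_smul_set hx)
  rw [one_smul] at hd
  have h : g • B = Bᶜ := by
    refine Set.eq_of_subset_of_ncard_le (Set.disjoint_left.1 hd) ?_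
    have h1 := Set.ncard_add_ncard_compl B
    rw [Set.ncard_smul_set]
    omega
  have h2 : g • Bᶜ = B := by rw [Set.smul_set_compl, h, compl_compl]
  nth_rw 1 [← h2]
  rw [Set.smul_mem_smul_set_iff, Set.mem_compl_iff]

/-- Coordinates in which `r₀`, `r₁`, `r₂` act as the generators of the group of the dual of the
Petrial of a toroidal map. -/
structure IsToroidalCoordinates (r₀ r₁ r₂ : Γ) (pt : Bool × ZMod b ≃ V) : Prop where
  smul₀ : ∀ s x, r₀ • pt (s, x) = pt (!s, x)
  smul₂ : ∀ s x, r₂ • pt (s, x) = pt (s, -x)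
  smul₁_false : ∀ x, r₁ • pt (false, x) = pt (false, x)
  smul₁_true : ∀ x, r₁ • pt (true, x) = pt (true, 1 - x)
  exists_shift : ∃ c : Γ, (∀ x, c • pt (false, x) = pt (false, x)) ∧
    ∀ x, c • pt (true, x) = pt (true, x + 1)

/-- If a power of c with exponent prime to b fixed y, then c, being a power of that power, would fix
y too. The relation c ^ b = 1 is implicit in the domain of f. -/
theorem injective_of_zmod_power (hb : b.Prime) {c : Γ} {f : ZMod b → Γ} (hf : ∀ n : ℤ, f n = c ^ n)
    {y : V} (hy : c • y ≠ y) : Function.Injective fun x => f x • y := by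
  have key : ∀ n : ℤ, c ^ n • y = y → (n : ZMod b) = 0 := by
    intro n hn
    by_contra h
    have hcop : IsCoprime n b := by
      rw [Int.isCoprime_iff_gcd_eq_one, Int.gcd_comm]
      rw [ZMod.intCast_zmod_eq_zero_iff_dvd, ← Int.natAbs_dvd_natAbs, Int.natAbs_natCast] at h
      exact (Nat.Prime.coprime_iff_not_dvd hb).2 h
    obtain ⟨i, j, hij⟩ := hcop
    apply hy
    have hcb : c ^ b = 1 := by
      rw [← zpow_natCast, ← hf, ← hf 0 |>.trans (zpow_zero c)]; simp
    have : c = (c ^ n) ^ i := by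
      conv_lhs => rw [← zpow_one c, ← hij, zpow_add, mul_comm j, zpow_mul c b, zpow_natCast, hcb,
        one_zpow, mul_one, mul_comm, zpow_mul]
    rw [this]
    exact (zpow_mem (K := stabilizer Γ y) hn i)
  intro x x' h
  obtain ⟨n, rfl⟩ := ZMod.intCast_surjective x
  obtain ⟨m, rfl⟩ := ZMod.intCast_surjective x'
  dsimp only at h
  rw [hf, hf, ← inv_smul_eq_iff, ← zpow_neg, ← mul_smul, ← zpow_add] at h
  have := key _ h
  push_cast at this
  linear_combination this

variable [FaithfulSMul Γ V] [IsPretransitive Γ V]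

omit [FaithfulSMul Γ V] in
theorem isPretransitive_stabilizer_block {B : Set V} (hB : IsBlock Γ B) :
    IsPretransitive (stabilizer Γ B) B := by
  refine ⟨fun x y => ?_⟩
  obtain ⟨g, hg⟩ := exists_smul_eq Γ x.1 y.1
  exact ⟨⟨g, mem_stabilizer_set.2 (IsBlock.smul_mem_iff hB x.2 (hg ▸ y.2))⟩, Subtype.ext hg⟩

omit [FaithfulSMul Γ V] in
-- Otherwise the setwise stabilizer of B acts faithfully and transitively on the b points of B. It
-- contains the stabilizer of u, which is dihedral, and this contradicts
-- `false_of_dihedral_stabilizer`.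
theorem exists_nontrivial_fixing_block (hb : b.Prime) (hb2 : b ≠ 2)
    {B : Set V} (hB : IsBlock Γ B) (hu : u ∈ B) (hBb : B.ncard = b)
    (h11 : r₁ * r₁ = 1) (h22 : r₂ * r₂ = 1) (h1 : r₁ ≠ 1) (h2 : r₂ ≠ 1) (h12 : r₁ ≠ r₂)
    (hD : ∀ g : Γ, g • u = u ↔ g ∈ closure {r₁, r₂}) :
    ∃ k : Γ, k ≠ 1 ∧ ∀ y ∈ B, k • y = y := by
  by_contra! H
  have hfix : ∀ g : Γ, g • u = u → g ∈ stabilizer Γ B := fun g hg =>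
    mem_stabilizer_set.2 (IsBlock.smul_mem_iff hB hu (by rwa [hg]))
  have h1u := (hD r₁).2 (subset_closure (by simp))
  have h2u := (hD r₂).2 (subset_closure (by simp))
  have : FaithfulSMul (stabilizer Γ B) B := ⟨by
    rintro ⟨g, hg⟩ ⟨h, hh⟩ hgh
    by_contra hne
    obtain ⟨y, hy, hy2⟩ := H (h⁻¹ * g) (fun e => hne (Subtype.ext (inv_mul_eq_one.1 e).symm))
    have := congrArg Subtype.val (hgh ⟨y, hy⟩)
    change g • y = h • y at this
    exact hy2 (by rw [mul_smul, this, inv_smul_smul])⟩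
  have := isPretransitive_stabilizer_block hB
  refine false_of_dihedral_stabilizer (G := stabilizer Γ B) (X := B) (x := ⟨u, hu⟩)
    (r := ⟨r₁, hfix _ h1u⟩) (s := ⟨r₂, hfix _ h2u⟩) hb hb2 hBb (Subtype.ext h11) (Subtype.ext h22)
    (fun h => h1 (congrArg Subtype.val h)) (fun h => h2 (congrArg Subtype.val h))
    (fun h => h12 (congrArg Subtype.val h)) ?_
  rintro ⟨g, hg⟩
  simp only [Subtype.ext_iff, SMul.smul_stabilizer_def, Subgroup.coe_mul, Subgroup.coe_zpow]
  rw [hD]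
  refine ⟨exists_zpow_of_mem_closure_involutions h11 h22, ?_⟩
  have m1 : r₁ ∈ closure {r₁, r₂} := subset_closure (by simp)
  have m2 : r₂ ∈ closure {r₁, r₂} := subset_closure (by simp)
  rintro ⟨n, rfl | rfl⟩
  · exact zpow_mem (mul_mem m1 m2) n
  · exact mul_mem (zpow_mem (mul_mem m1 m2) n) m1

/-- The pointwise stabilizer K of B is normal in the setwise stabilizer of C, which acts primitively
on the b points of C. As K acts nontrivially there, it is transitive on C, so b divides its order
and Cauchy's theorem applies. -/
theorem exists_prime_order_fixing_block [Finite V] (hb : b.Prime)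
    {B C : Set V} (hC : IsBlock Γ C) (hBC : B = Cᶜ) (hCb : C.ncard = b)
    (h : ∃ k : Γ, k ≠ 1 ∧ ∀ y ∈ B, k • y = y) :
    ∃ c : Γ, orderOf c = b ∧ ∀ y ∈ B, c • y = y := by
  have : Finite Γ := Finite.of_injective (toPermHom Γ V) toPerm_injective
  have hp : Fact b.Prime := ⟨hb⟩
  have hcard : Nat.card C = b := hCb
  have := isPretransitive_stabilizer_block hC
  have hprim : IsPreprimitive (stabilizer Γ C) C := IsPreprimitive.of_prime_card (by rwa [hcard])
  have hmem : ∀ g ∈ stabilizer Γ C, ∀ y ∈ B, g • y ∈ B := by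
    intro g hg y hy
    rw [hBC, Set.mem_compl_iff] at hy ⊢
    rwa [mem_stabilizer_set.1 hg]
  let K : Subgroup (stabilizer Γ C) :=
    { carrier := {m | ∀ y ∈ B, m.1 • y = y}
      one_mem' := fun y _ => one_smul _ y
      mul_mem' := fun {m n} hm hn y hy => by
        change (m.1 * n.1) • y = y
        rw [mul_smul, hn y hy, hm y hy]
      inv_mem' := fun {m} hm y hy => by
        change m.1⁻¹ • y = y
        rw [inv_smul_eq_iff, hm y hy] }
  have hK : K.Normal := ⟨fun n hn g y hy => by
    change (g.1 * n.1 * g.1⁻¹) • y = y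
    rw [mul_smul, mul_smul, hn _ (hmem _ (inv_mem g.2) y hy), smul_inv_smul]⟩
  obtain ⟨k, hk1, hk⟩ := h
  have hkC : k ∈ stabilizer Γ C := by
    have : k ∈ stabilizer Γ B := by
      rw [mem_stabilizer_set]
      intro y
      refine ⟨fun hy => ?_, fun hy => by rwa [hk y hy]⟩
      have := hk _ hy
      rw [smul_left_cancel_iff] at this
      rwa [← this]
    rwa [hBC, stabilizer_compl] at this
  have htrans : IsPretransitive K C := by
    refine IsQuasiPreprimitive.isPretransitive_of_normal (G := stabilizer Γ C) fun h => hk1 ?_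
    refine FaithfulSMul.eq_of_smul_eq_smul (α := V) fun y => ?_
    rw [one_smul]
    by_cases hy : y ∈ C
    · have : (⟨y, hy⟩ : C) ∈ fixedPoints K C := h ▸ Set.mem_univ _
      exact congrArg Subtype.val (this ⟨⟨k, hkC⟩, hk⟩)
    · exact hk y (by rwa [hBC])
  have hne : Nonempty C := (Nat.card_pos_iff.1 (hcard ▸ hb.pos)).1
  obtain ⟨y⟩ := hne
  have hdvd : b ∣ Nat.card K := by
    rw [← hcard, ← index_stabilizer_of_transitive K y]
    exact index_dvd_card _
  obtain ⟨⟨⟨c, hc⟩, hcK⟩, hco⟩ := exists_prime_orderOf_dvd_card' b hdvd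
  refine ⟨c, ?_, hcK⟩
  rwa [Subgroup.orderOf_mk, Subgroup.orderOf_mk] at hco

end Coordinates

end AbsPoly

namespace AbsPoly

/-! ### Transitivity of ⟨r₀, r₁⟩ or toroidal coordinates. -/

section Classification

open MulAction Subgroup
open scoped Pointwise

variable {Γ V : Type*} [Group Γ] [MulAction Γ V] [FaithfulSMul Γ V] [IsPretransitive Γ V]
  {b : ℕ} {u : V} {r₀ r₁ r₂ : Γ}

omit [FaithfulSMul Γ V] in
-- Otherwise all three generators preserve the block, and transitivity would make it the whole set.
theorem smul_notMem_block (hb : b.Prime) (hV : Nat.card V = 2 * b)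
    {B : Set V} (hB : IsBlock Γ B) (hu : u ∈ B) (hBb : B.ncard = b)
    (hgen : closure {r₀, r₁, r₂} = (⊤ : Subgroup Γ)) (h1 : r₁ • u = u) (h2 : r₂ • u = u) :
    r₀ • u ∉ B := by
  intro h0
  have hle : closure {r₀, r₁, r₂} ≤ stabilizer Γ B := by
    rw [closure_le]
    rintro g (rfl | rfl | rfl) <;>
      exact mem_stabilizer_set.2 (IsBlock.smul_mem_iff hB hu (by simpa only [h1, h2]))
  rw [hgen] at hle
  have huniv : B = Set.univ := by
    refine Set.eq_univ_of_forall fun y => ?_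
    obtain ⟨g, rfl⟩ := exists_smul_eq Γ u y
    exact (mem_stabilizer_set.1 (hle (mem_top g)) u).2 hu
  rw [huniv, Set.ncard_univ, hV] at hBb
  have := hb.pos
  omega

omit [IsPretransitive Γ V] in
-- An element of odd order fixing u is a rotation, so r₁ and r₂ invert it. It acts as a b-cycle
-- outside B, so some power of it takes r₀ • u to r₁ • r₀ • u; passing to that power normalizes c so
-- that r₁ will become x ↦ 1 - x in coordinates.
theorem exists_rotation_shift (hb : b.Prime) (hb2 : b ≠ 2)
    {B : Set V} (hB : ∀ y ∉ B, r₁ • y ∉ B) (hBb : Bᶜ.ncard = b) (h0 : r₀ • u ∉ B)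
    (h11 : r₁ * r₁ = 1) (h22 : r₂ * r₂ = 1) (h02 : r₀ * r₂ = r₂ * r₀)
    (hD : ∀ g : Γ, g • u = u ↔ g ∈ closure {r₁, r₂}) (hu : u ∈ B)
    (hc : ∃ c : Γ, orderOf c = b ∧ ∀ y ∈ B, c • y = y) :
    ∃ c : Γ, orderOf c = b ∧ (∀ y ∈ B, c • y = y) ∧ r₁ * c * r₁ = c⁻¹ ∧ r₂ * c * r₂ = c⁻¹ ∧
      r₁ • r₀ • u = c • r₀ • u ∧ c • r₀ • u ≠ r₀ • u ∧ ∃ m : ℤ, c = (r₁ * r₂) ^ m := by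
  have hp : Fact b.Prime := ⟨hb⟩
  have hr1 : r₁⁻¹ = r₁ := inv_eq_of_mul_eq_one_right h11
  have hr2 : r₂⁻¹ = r₂ := inv_eq_of_mul_eq_one_right h22
  have hfinC : Bᶜ.Finite := Set.finite_of_ncard_ne_zero (by rw [hBb]; exact hb.ne_zero)
  obtain ⟨c, hcb, hcB⟩ := hc
  have hcb1 : c ^ b = 1 := by rw [← hcb]; exact pow_orderOf_eq_one c
  have hc1 : c ≠ 1 := fun h => hb.one_lt.ne' (by rw [← hcb, h, orderOf_one])
  obtain ⟨m, hm | hm⟩ := exists_zpow_of_mem_closure_involutions h11 h22 ((hD c).1 (hcB u hu))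
  swap
  · have := zpow_mul_sq_of_involutions h11 h22 m
    rw [← hm] at this
    have := orderOf_dvd_of_pow_eq_one this
    rw [hcb, Nat.prime_dvd_prime_iff_eq hb Nat.prime_two] at this
    exact absurd this hb2
  have hinv1 : r₁ * c * r₁ = c⁻¹ := by
    rw [hm, mul_zpow_mul_of_involutions h11 h22, zpow_neg]
  have hinv2 : r₂ * c * r₂ = c⁻¹ := by
    have h21 : r₁ * r₂ = (r₂ * r₁)⁻¹ := by rw [mul_inv_rev, hr1, hr2]
    rw [hm, h21, inv_zpow', mul_zpow_mul_of_involutions h22 h11, zpow_neg]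
  have hv2 : r₂ • r₀ • u = r₀ • u := by
    rw [← mul_smul, ← h02, mul_smul, (hD r₂).2 (subset_closure (by simp))]
  obtain ⟨f, hf⟩ := exists_zmod_power hcb1
  have hcC : ∀ n : ℤ, ∀ y ∉ B, c ^ n • y ∉ B := by
    intro n y hy h
    apply hy
    have h3 : (c ^ n)⁻¹ • c ^ n • y = c ^ n • y :=
      zpow_mem (K := stabilizer Γ (c ^ n • y)) (hcB _ h) n |> inv_mem
    rw [inv_smul_smul] at h3
    rwa [h3]
  obtain ⟨y, hy⟩ : ∃ y, c • y ≠ y := by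
    by_contra! H
    exact hc1 (FaithfulSMul.eq_of_smul_eq_smul (α := V) fun y => by rw [H, one_smul])
  have hyB : y ∉ B := fun h => hy (hcB y h)
  have hsurj : ∀ z ∉ B, ∃ n : ℤ, c ^ n • y = z := by
    have hinj := injective_of_zmod_power hb hf hy
    have hsub : Set.range (fun x => f x • y) ⊆ Bᶜ := by
      rintro _ ⟨x, rfl⟩
      obtain ⟨n, rfl⟩ := ZMod.intCast_surjective x
      dsimp only
      rw [hf]
      exact hcC n y hyB
    have heq := Set.eq_of_subset_of_ncard_le hsub (by
      rw [hBb, ← Set.image_univ, Set.ncard_image_of_injective _ hinj, Set.ncard_univ,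
        Nat.card_zmod]) hfinC
    intro z hz
    have : z ∈ Set.range (fun x => f x • y) := heq ▸ hz
    obtain ⟨x, rfl⟩ := this
    obtain ⟨n, rfl⟩ := ZMod.intCast_surjective x
    exact ⟨n, by simp only [hf]⟩
  have hmove : ∀ z ∉ B, c • z ≠ z := by
    intro z hz h
    obtain ⟨n, rfl⟩ := hsurj z hz
    apply hy
    rw [← mul_smul, ← zpow_one_add, add_comm, zpow_add_one, mul_smul] at h
    exact smul_left_cancel _ h
  obtain ⟨n, hn⟩ : ∃ n : ℤ, r₁ • r₀ • u = c ^ n • r₀ • u := by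
    obtain ⟨i, hi⟩ := hsurj _ h0
    obtain ⟨j, hj⟩ := hsurj _ (hB _ h0)
    refine ⟨j - i, ?_⟩
    rw [← hj, ← hi, ← mul_smul, ← zpow_add, sub_add_cancel]
  -- Since r₂ commutes with r₀, it fixes r₀ • u. If r₁ did so too, then c, lying in ⟨r₁, r₂⟩, would
  -- fix a point outside B.
  have hne : c ^ n • r₀ • u ≠ r₀ • u := by
    intro h
    have hle : closure {r₁, r₂} ≤ stabilizer Γ (r₀ • u) := by
      rw [closure_le]
      rintro g (rfl | rfl)
      · exact hn.trans h
      · exact hv2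
    exact hmove _ h0 (hle ((hD c).1 (hcB u hu)))
  refine ⟨c ^ n, ?_, fun z hz => zpow_mem (K := stabilizer Γ z) (hcB z hz) n, ?_, ?_, hn, hne, ?_⟩
  · refine orderOf_eq_prime ?_ fun h => hne (by rw [h, one_smul])
    rw [← zpow_natCast, ← zpow_mul, mul_comm, zpow_mul, zpow_natCast, hcb1, one_zpow]
  · have := conj_zpow (i := n) (a := r₁) (b := c)
    rw [hr1, hinv1] at this
    rw [← this, inv_zpow]
  · have := conj_zpow (i := n) (a := r₂) (b := c)
    rw [hr2, hinv2] at this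
    rw [← this, inv_zpow]
  · exact ⟨m * n, by rw [hm, zpow_mul]⟩

/-- The conjugate lies in the unique subgroup of order b of ⟨a⟩, so it is a power of c. Conjugating
twice by the involution w squares the exponent to 1 modulo the prime b. -/
theorem conj_eq_or_eq_inv (hb : b.Prime) {a c w : Γ} (hcb : orderOf c = b)
    (hc : c ∈ zpowers a) (hw : w * w = 1) (hwc : w * c * w ∈ zpowers a) :
    w * c * w = c ∨ w * c * w = c⁻¹ := by
  have hw' : w⁻¹ = w := inv_eq_of_mul_eq_one_right hw
  have hcb1 : c ^ b = 1 := by rw [← hcb]; exact pow_orderOf_eq_one c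
  have hconj (n : ℤ) : w * c ^ n * w = (w * c * w) ^ n := by
    have := conj_zpow (i := n) (a := w) (b := c)
    rw [hw'] at this
    exact this.symm
  obtain ⟨n, hn⟩ := mem_zpowers_of_pow_eq_one hb.pos hc hwc hcb (by
    have := hconj b
    rw [zpow_natCast, zpow_natCast, hcb1, mul_one, hw] at this
    exact this.symm)
  dsimp only at hn
  have h2 : c ^ (n * n) = c := by
    rw [zpow_mul, hn, ← hconj, hn]
    simp only [← mul_assoc, hw, one_mul]
    rw [mul_assoc, hw, mul_one]
  have h3 : (b : ℤ) ∣ n * n - 1 := by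
    rw [← hcb, orderOf_dvd_iff_zpow_eq_one, zpow_sub, h2, zpow_one, mul_inv_cancel]
  have h4 : n * n - 1 = (n - 1) * (n + 1) := by ring
  rw [h4] at h3
  rw [← hn]
  rcases (Nat.prime_iff_prime_int.1 hb).dvd_or_dvd h3 with h | h
  · left
    rwa [← hcb, orderOf_dvd_iff_zpow_eq_one, zpow_sub, zpow_one, mul_inv_eq_one] at h
  · right
    rwa [← hcb, orderOf_dvd_iff_zpow_eq_one, zpow_add, zpow_one, mul_eq_one_iff_eq_inv] at h

/-- A group with two blocks of prime size on which string generators act is either transitive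
already under `r₀` and `r₁`, or admits toroidal coordinates. -/
theorem transitive_or_exists_toroidalCoordinates (hb : b.Prime) (hb2 : b ≠ 2)
    (hV : Nat.card V = 2 * b)
    (hblocks : ∃ ℬ : Set (Set V), IsBlockSystem Γ ℬ ∧ ℬ.ncard = 2 ∧ ∀ B ∈ ℬ, B.ncard = b)
    (h00 : r₀ * r₀ = 1) (h11 : r₁ * r₁ = 1) (h22 : r₂ * r₂ = 1) (h02 : r₀ * r₂ = r₂ * r₀)
    (h1 : r₁ ≠ 1) (h2 : r₂ ≠ 1) (h12 : r₁ ≠ r₂)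
    (hD : ∀ g : Γ, g • u = u ↔ g ∈ closure {r₁, r₂})
    (hgen : closure {r₀, r₁, r₂} = (⊤ : Subgroup Γ)) :
    (∀ y : V, ∃ g ∈ closure {r₀, r₁}, g • u = y) ∨
      ∃ pt : Bool × ZMod b ≃ V, pt (false, 0) = u ∧ IsToroidalCoordinates r₀ r₁ r₂ pt := by
  have hfin : Finite V := Nat.finite_of_card_ne_zero (by rw [hV]; have := hb.pos; omega)
  have hp : Fact b.Prime := ⟨hb⟩
  obtain ⟨B, hB, hu, hBb⟩ := exists_block_of_blockSystem u hblocks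
  have h1u : r₁ • u = u := (hD r₁).2 (subset_closure (by simp))
  have h2u : r₂ • u = u := (hD r₂).2 (subset_closure (by simp))
  have h0B := smul_notMem_block hb hV hB hu hBb hgen h1u h2u
  have m0 : ∀ y, r₀ • y ∈ B ↔ y ∉ B :=
    IsBlock.smul_mem_iff_notMem hB (by rw [hV, hBb]) hu h0B
  have m1 : ∀ y, r₁ • y ∈ B ↔ y ∈ B := IsBlock.smul_mem_iff hB hu (by rwa [h1u])
  have hBc : Bᶜ.ncard = b := by
    have := Set.ncard_add_ncard_compl B
    omega
  have hBcb : IsBlock Γ Bᶜ := by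
    have : Bᶜ = r₀ • B := by
      ext y
      rw [Set.mem_smul_set_iff_inv_smul_mem, inv_eq_of_mul_eq_one_right h00, m0, Set.mem_compl_iff]
    rw [this]
    exact hB.translate r₀
  obtain ⟨c, hcb, hcB, hc1, hc2, hcv, hcne, hcm⟩ := exists_rotation_shift hb hb2
    (fun y hy h => hy ((m1 y).1 h)) hBc h0B h11 h22 h02 hD hu
    (exists_prime_order_fixing_block hb hBcb (compl_compl B).symm hBc
      (exists_nontrivial_fixing_block hb hb2 hB hu hBb h11 h22 h1 h2 h12 hD))
  have s00 (y : V) : r₀ • r₀ • y = y := by rw [← mul_smul, h00, one_smul]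
  have hcb1 : c ^ b = 1 := by rw [← hcb]; exact pow_orderOf_eq_one c
  obtain ⟨f, hf⟩ := exists_zmod_power hcb1
  have hf1 : f 1 = c := by have := hf 1; rwa [zpow_one, Int.cast_one] at this
  have hf0 : f 0 = 1 := by have := hf 0; rwa [zpow_zero, Int.cast_zero] at this
  have hfadd (x y : ZMod b) : f (x + y) = f x * f y := by
    obtain ⟨n, rfl⟩ := ZMod.intCast_surjective x
    obtain ⟨m, rfl⟩ := ZMod.intCast_surjective y
    rw [← Int.cast_add, hf, hf, hf, zpow_add]
  have hfneg (r : Γ) (hr : r * r = 1) (hrc : r * c * r = c⁻¹) (x : ZMod b) :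
      r * f x = f (-x) * r := by
    obtain ⟨n, rfl⟩ := ZMod.intCast_surjective x
    have := conj_zpow (i := n) (a := r) (b := c)
    rw [inv_eq_of_mul_eq_one_right hr, hrc, inv_zpow'] at this
    rw [← Int.cast_neg, hf, hf, this, mul_assoc, hr, mul_one]
  have hfB (x : ZMod b) : ∀ y ∈ B, f x • y = y := by
    obtain ⟨n, rfl⟩ := ZMod.intCast_surjective x
    intro y hy
    rw [hf]
    exact zpow_mem (K := stabilizer Γ y) (hcB y hy) n
  have hfC (x : ZMod b) : ∀ y ∉ B, f x • y ∉ B := by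
    intro y hy h
    have h3 := hfB (-x) _ h
    rw [← mul_smul, ← hfadd, neg_add_cancel, hf0, one_smul] at h3
    exact hy (h3 ▸ h)
  -- The block outside B is parametrized by the cycle of c starting at r₀ • u; the parametrization
  -- of B is its image under r₀, which makes r₀ the exchange of the two blocks.
  let F : Bool × ZMod b → V := fun p => if p.1 then f p.2 • r₀ • u else r₀ • f p.2 • r₀ • u
  have hFt (x : ZMod b) : F (true, x) = f x • r₀ • u := rfl
  have hFf (x : ZMod b) : F (false, x) = r₀ • f x • r₀ • u := rfl
  have hFtB (x : ZMod b) : F (true, x) ∉ B := hfC x _ h0B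
  have hFfB (x : ZMod b) : F (false, x) ∈ B := (m0 _).2 (hFtB x)
  have hFinj : Function.Injective F := by
    have hinj := injective_of_zmod_power hb hf hcne
    rintro ⟨_ | _, x⟩ ⟨_ | _, y⟩ h
    · rw [hFf, hFf] at h
      rw [hinj (smul_left_cancel _ h)]
    · exact absurd (h ▸ hFfB x) (hFtB y)
    · exact absurd (h ▸ hFfB y) (hFtB x)
    · rw [hFt, hFt] at h
      rw [hinj h]
  have hFbij : Function.Bijective F := by
    rw [Nat.bijective_iff_injective_and_card]
    refine ⟨hFinj, ?_⟩
    rw [Nat.card_prod, Nat.card_zmod, hV, Nat.card_eq_fintype_card, Fintype.card_bool]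
  have a0 (s : Bool) (x : ZMod b) : r₀ • F (s, x) = F (!s, x) := by
    cases s
    · exact s00 _
    · rfl
  have hFu : F (false, 0) = u := by rw [hFf, hf0, one_smul, s00]
  have a2t (x : ZMod b) : r₂ • F (true, x) = F (true, -x) := by
    rw [hFt, hFt, ← mul_smul, hfneg r₂ h22 hc2, mul_smul, ← mul_smul r₂, ← h02, mul_smul, h2u]
  have a1t (x : ZMod b) : r₁ • F (true, x) = F (true, 1 - x) := by
    rw [hFt, hFt, ← mul_smul, hfneg r₁ h11 hc1, mul_smul, hcv, ← mul_smul, ← hf1, ← hfadd,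
      neg_add_eq_sub]
  have hw : (r₀ * r₁ * r₀) * (r₀ * r₁ * r₀) = 1 := by
    have : (r₀ * r₁ * r₀) * (r₀ * r₁ * r₀) = r₀ * (r₁ * (r₀ * r₀) * r₁) * r₀ := by
      simp only [mul_assoc]
    rw [this, h00, mul_one, h11, mul_one, h00]
  have hwB : ∀ y ∈ B, (r₀ * r₁ * r₀) • y ∈ B := fun y hy => by
    rw [mul_smul, mul_smul, m0, m1, m0, not_not]; exact hy
  -- As r₀r₁r₀ preserves B and c fixes B pointwise, the conjugate fixes u. Its order b is odd, so it
  -- is not a reflection.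
  have hwc : (r₀ * r₁ * r₀) * c * (r₀ * r₁ * r₀) ∈ zpowers (r₁ * r₂) := by
    have hord : orderOf ((r₀ * r₁ * r₀) * c * (r₀ * r₁ * r₀)) = b := by
      rw [← hcb]
      nth_rw 2 [← inv_eq_of_mul_eq_one_right hw]
      exact (MulAut.conj (r₀ * r₁ * r₀)).orderOf_eq c
    have hfix : ((r₀ * r₁ * r₀) * c * (r₀ * r₁ * r₀)) • u = u := by
      rw [mul_smul, mul_smul, hcB _ (hwB u hu), ← mul_smul, hw, one_smul]
    obtain ⟨m, hm | hm⟩ := exists_zpow_of_mem_closure_involutions h11 h22 ((hD _).1 hfix)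
    · exact ⟨m, hm.symm⟩
    · have := zpow_mul_sq_of_involutions h11 h22 m
      rw [← hm] at this
      have := orderOf_dvd_of_pow_eq_one this
      rw [hord, Nat.prime_dvd_prime_iff_eq hb Nat.prime_two] at this
      exact absurd this hb2
  have hcz : c ∈ zpowers (r₁ * r₂) := hcm.imp fun _ h => h.symm
  have hwu (g : Γ) : r₁ • r₀ • g • r₀ • u = r₀ • ((r₀ * r₁ * r₀) * g * (r₀ * r₁ * r₀)) • r₀ • u := by
    simp only [mul_smul, s00, h1u]
  -- The alternative decides how r₁ acts on B: trivially if r₀r₁r₀ commutes with c, and by x ↦ -x if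
  -- it inverts c.
  rcases conj_eq_or_eq_inv hb hcb hcz hw hwc with h | h
  · right
    have hcomm (x : ZMod b) : (r₀ * r₁ * r₀) * f x * (r₀ * r₁ * r₀) = f x := by
      obtain ⟨n, rfl⟩ := ZMod.intCast_surjective x
      have := conj_zpow (i := n) (a := r₀ * r₁ * r₀) (b := c)
      rw [inv_eq_of_mul_eq_one_right hw, h] at this
      rw [hf, ← this]
    refine ⟨Equiv.ofBijective F hFbij, hFu, a0, ?_, ?_, a1t, c, fun x => hcB _ (hFfB x), ?_⟩
    · rintro (_ | _) x
      · change r₂ • F (false, x) = F (false, -x)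
        rw [← Bool.not_true, ← a0, ← a0, ← a2t, ← mul_smul, ← mul_smul, h02]
      · exact a2t x
    · intro x
      change r₁ • F (false, x) = F (false, x)
      rw [hFf, hwu, hcomm]
    · intro x
      change c • F (true, x) = F (true, x + 1)
      rw [hFt, hFt, add_comm, hfadd, hf1, mul_smul]
  · left
    have hcomm (x : ZMod b) : (r₀ * r₁ * r₀) * f x * (r₀ * r₁ * r₀) = f (-x) := by
      rw [hfneg _ hw h, mul_assoc, hw, mul_one]
    have a1f (x : ZMod b) : r₁ • F (false, x) = F (false, -x) := by
      rw [hFf, hwu, hcomm, hFf]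
    have hm0 : r₀ ∈ closure {r₀, r₁} := subset_closure (by simp)
    have hm1 : r₁ ∈ closure {r₀, r₁} := subset_closure (by simp)
    -- Composing x ↦ -x on B with x ↦ 1 - x on the other block gives a unit shift of B, so ⟨r₀, r₁⟩
    -- is transitive.
    have hstep (x : ZMod b) : (r₀ * r₁ * r₀ * r₁) • F (false, x) = F (false, x + 1) := by
      rw [mul_smul, mul_smul, mul_smul, a1f, a0, Bool.not_false, a1t, a0, Bool.not_true]
      congr 2; ring
    have hpow (n : ℕ) : (r₀ * r₁ * r₀ * r₁) ^ n • u = F (false, n) := by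
      induction n with
      | zero => rw [pow_zero, one_smul, Nat.cast_zero, hFu]
      | succ n ih => rw [pow_succ', mul_smul, ih, hstep, Nat.cast_succ]
    have hmem (n : ℕ) : (r₀ * r₁ * r₀ * r₁) ^ n ∈ closure {r₀, r₁} :=
      pow_mem (mul_mem (mul_mem (mul_mem hm0 hm1) hm0) hm1) n
    intro y
    obtain ⟨⟨s, x⟩, rfl⟩ := hFbij.2 y
    obtain ⟨n, rfl⟩ := ZMod.natCast_zmod_surjective x
    cases s
    · exact ⟨_, hmem n, hpow n⟩
    · exact ⟨_, mul_mem hm0 (hmem n), by rw [mul_smul, hpow, a0, Bool.not_false]⟩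

end Classification

end AbsPoly

namespace AbsPoly

open RankedPoset MulAction

/-! ### Ranks and flags. -/

section Graded

variable (F : Type*) [RankedPoset F]

/-- The conditions on polyhedra that concern the ranks of the faces in a flag. -/
structure IsGraded : Prop where
  rank_mem : ∀ x : F, rank x ∈ Set.Icc (-1 : ℤ) 3
  existsUnique_least : ∃! x : F, rank x = -1
  existsUnique_greatest : ∃! x : F, rank x = 3
  existsUnique_mem_flag : ∀ Φ : Flag F, ∀ i ∈ Set.Icc (-1 : ℤ) 3, ∃! x : F, x ∈ Φ ∧ rank x = i

variable {F}

theorem IsPolyhedron.isGraded (hP : IsPolyhedron F) : IsGraded F :=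
  ⟨hP.rank_mem, hP.existsUnique_least, hP.existsUnique_greatest, hP.existsUnique_mem_flag⟩

theorem eq_of_le_of_rank_eq {x y : F} (h : x ≤ y) (hr : rank x = rank y) : x = y :=
  h.eq_of_not_lt fun hlt => (rank_strictMono hlt).ne hr

theorem eq_of_mem_flag {Φ : Flag F} {x y : F} (hx : x ∈ Φ) (hy : y ∈ Φ) (h : rank x = rank y) :
    x = y := by
  rcases Φ.le_or_le hx hy with h1 | h1
  · exact eq_of_le_of_rank_eq h1 h
  · exact (eq_of_le_of_rank_eq h1 h.symm).symm

theorem le_of_mem_flag {Φ : Flag F} {x y : F} (hx : x ∈ Φ) (hy : y ∈ Φ) (h : rank x ≤ rank y) :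
    x ≤ y := by
  rcases Φ.le_or_le hx hy with h1 | h1
  · exact h1
  · exact (eq_of_le_of_rank_eq h1 (le_antisymm (rank_strictMono.monotone h1) h)).ge

theorem lt_of_mem_flag {Φ : Flag F} {x y : F} (hx : x ∈ Φ) (hy : y ∈ Φ) (h : rank x < rank y) :
    x < y :=
  (le_of_mem_flag hx hy h.le).lt_of_ne fun e => h.ne (congrArg rank e)

theorem exists_flag_of_le_of_le {v e f : F} (h1 : v ≤ e) (h2 : e ≤ f) :
    ∃ Φ : Flag F, v ∈ Φ ∧ e ∈ Φ ∧ f ∈ Φ := by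
  have hc : IsChain (· ≤ ·) ({v, e, f} : Set F) := by
    have h3 := h1.trans h2
    rintro x (rfl | rfl | rfl) y (rfl | rfl | rfl) hxy <;> simp_all
  obtain ⟨Φ, hΦ⟩ := hc.exists_subset_flag
  exact ⟨Φ, hΦ (by simp), hΦ (by simp), hΦ (by simp)⟩

namespace IsGraded

variable (hG : IsGraded F)
include hG

theorem exists_mem_flag (Φ : Flag F) {i : ℤ} (h1 : -1 ≤ i) (h2 : i ≤ 3) :
    ∃ x ∈ Φ, rank x = i := (hG.existsUnique_mem_flag Φ i ⟨h1, h2⟩).exists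

theorem least_mem {x : F} (hx : rank x = -1) (Φ : Flag F) : x ∈ Φ := by
  obtain ⟨y, hy, hr⟩ := hG.exists_mem_flag Φ le_rfl (by norm_num)
  rwa [hG.existsUnique_least.unique hx hr]

theorem greatest_mem {x : F} (hx : rank x = 3) (Φ : Flag F) : x ∈ Φ := by
  obtain ⟨y, hy, hr⟩ := hG.exists_mem_flag Φ (by norm_num) le_rfl
  rwa [hG.existsUnique_greatest.unique hx hr]

theorem le_of_rank_eq_neg_one {x : F} (hx : rank x = -1) (y : F) : x ≤ y := by
  obtain ⟨Φ, hΦ⟩ := Flag.exists_mem y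
  exact le_of_mem_flag (hG.least_mem hx Φ) hΦ (by rw [hx]; exact (hG.rank_mem y).1)

theorem le_of_rank_eq_three {x : F} (hx : rank x = 3) (y : F) : y ≤ x := by
  obtain ⟨Φ, hΦ⟩ := Flag.exists_mem y
  exact le_of_mem_flag hΦ (hG.greatest_mem hx Φ) (by rw [hx]; exact (hG.rank_mem y).2)

theorem flag_ext {Φ Ψ : Flag F}
    (h : ∀ i : ℤ, 0 ≤ i → i ≤ 2 → ∃ x ∈ Φ, x ∈ Ψ ∧ rank x = i) : Φ = Ψ := by
  have hall : ∀ i : ℤ, -1 ≤ i → i ≤ 3 → ∃ x ∈ Φ, x ∈ Ψ ∧ rank x = i := by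
    intro i h1 h2
    rcases lt_or_ge i 0 with h0 | h0
    · obtain ⟨x, hx, -⟩ := hG.existsUnique_least
      exact ⟨x, hG.least_mem hx Φ, hG.least_mem hx Ψ, by omega⟩
    rcases lt_or_ge 2 i with h3 | h3
    · obtain ⟨x, hx, -⟩ := hG.existsUnique_greatest
      exact ⟨x, hG.greatest_mem hx Φ, hG.greatest_mem hx Ψ, by omega⟩
    · exact h i h0 h3
  ext x
  obtain ⟨y, hy1, hy2, hr⟩ := hall (rank x) (hG.rank_mem x).1 (hG.rank_mem x).2
  constructor
  · intro hx
    rwa [eq_of_mem_flag hx hy1 hr.symm]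
  · intro hx
    rwa [eq_of_mem_flag hx hy2 hr.symm]

theorem flag_eq {Φ Ψ : Flag F} {v e f : F} (hv : rank v = 0) (he : rank e = 1) (hf : rank f = 2)
    (h1 : v ∈ Φ) (h2 : e ∈ Φ) (h3 : f ∈ Φ) (h1' : v ∈ Ψ) (h2' : e ∈ Ψ) (h3' : f ∈ Ψ) : Φ = Ψ := by
  refine hG.flag_ext fun i h0 hi => ?_
  obtain rfl | rfl | rfl : i = 0 ∨ i = 1 ∨ i = 2 := by omega
  exacts [⟨v, h1, h1', hv⟩, ⟨e, h2, h2', he⟩, ⟨f, h3, h3', hf⟩]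

theorem mem_of_adjacentAt {i : ℤ} {Φ Ψ : Flag F} (h : AdjacentAt i Φ Ψ) : 0 ≤ i ∧ i ≤ 2 := by
  by_contra hi
  refine h.1 (hG.flag_ext fun j h0 h2 => ?_)
  obtain ⟨x, hx, hr⟩ := hG.exists_mem_flag Φ (i := j) (by omega) (by omega)
  exact ⟨x, hx, (h.2 x (by omega)).1 hx, hr⟩

theorem ne_of_adjacentAt {i : ℤ} {Φ Ψ : Flag F} (h : AdjacentAt i Φ Ψ) {x y : F} (hx : x ∈ Φ)
    (hy : y ∈ Ψ) (hxi : rank x = i) : x ≠ y := by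
  rintro rfl
  refine h.1 (hG.flag_ext fun j h0 h2 => ?_)
  obtain ⟨z, hz, hr⟩ := hG.exists_mem_flag Φ (i := j) (by omega) (by omega)
  by_cases hj : j = i
  · exact ⟨x, hx, hy, by omega⟩
  · exact ⟨z, hz, (h.2 z (by omega)).1 hz, hr⟩

/-- One inclusion suffices because each flag has exactly one face of each rank. -/
theorem adjacentAt_of_ne {i : ℤ} {Φ Ψ : Flag F} (h : ∀ x ∈ Φ, rank x ≠ i → x ∈ Ψ) {x : F}
    (hx : x ∈ Φ) (hx' : x ∉ Ψ) : AdjacentAt i Φ Ψ := by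
  refine ⟨fun e => hx' (e ▸ hx), fun y hy => ⟨fun h' => h y h' hy, fun h' => ?_⟩⟩
  obtain ⟨z, hz, hr⟩ := hG.exists_mem_flag Φ (i := rank y) (hG.rank_mem y).1 (hG.rank_mem y).2
  rwa [← eq_of_mem_flag (h z hz (hr ▸ hy)) h' hr]

end IsGraded

theorem AdjacentAt.symm {i : ℤ} {Φ Ψ : Flag F} (h : AdjacentAt i Φ Ψ) : AdjacentAt i Ψ Φ :=
  ⟨h.1.symm, fun x hx => (h.2 x hx).symm⟩

end Graded

/-! ### Regular polyhedra and their distinguished generators. -/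

section Polyhedron

variable {F : Type*} [RankedPoset F]

theorem mem_smul_flag {g : Aut F} {Φ : Flag F} {x : F} : x ∈ g • Φ ↔ g⁻¹ • x ∈ Φ := by
  constructor
  · rintro ⟨y, hy, rfl⟩
    change g⁻¹ • g • y ∈ Φ
    rwa [inv_smul_smul]
  · intro h
    exact ⟨_, h, smul_inv_smul g x⟩

theorem smul_mem_smul_flag {g : Aut F} {Φ : Flag F} {x : F} : g • x ∈ g • Φ ↔ x ∈ Φ := by
  rw [mem_smul_flag, inv_smul_smul]

theorem rank_smul (g : Aut F) (x : F) : rank (g • x) = rank x := g.2 x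

theorem smul_le_smul_iff_aut (g : Aut F) {x y : F} : g • x ≤ g • y ↔ x ≤ y := g.1.le_iff_le

theorem smul_lt_smul_iff_aut (g : Aut F) {x y : F} : g • x < g • y ↔ x < y := g.1.lt_iff_lt

theorem coe_smul_vertex (g : Aut F) (v : Vertex F) : (g • v).1 = g • v.1 := rfl

theorem AdjacentAt.smul {i : ℤ} {Φ Ψ : Flag F} (h : AdjacentAt i Φ Ψ) (g : Aut F) :
    AdjacentAt i (g • Φ) (g • Ψ) := by
  refine ⟨fun e => h.1 (smul_left_cancel g e), fun x hx => ?_⟩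
  rw [mem_smul_flag, mem_smul_flag]
  exact h.2 _ (by rwa [rank_smul])

namespace IsPolyhedron

variable (hP : IsPolyhedron F)
include hP

theorem eq_of_between {x y a z w : F} (hxy : rank x = rank y - 2) (ha : x < a ∧ a < y)
    (hz : x < z ∧ z < y) (hw : x < w ∧ w < y) (hza : z ≠ a) (hwa : w ≠ a) : z = w := by
  obtain ⟨p, q, hpq, hS⟩ := Set.ncard_eq_two.1 (hP.diamond x y (ha.1.trans ha.2) hxy)
  have m : ∀ t : F, x < t ∧ t < y → t = p ∨ t = q := fun t ht => by
    have : t ∈ ({p, q} : Set F) := hS ▸ ht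
    simpa using this
  rcases m a ha with rfl | rfl <;> rcases m z hz with rfl | rfl <;> rcases m w hw with rfl | rfl <;>
    simp_all

theorem exists_between_ne {x y a : F} (hxy : rank x = rank y - 2) (ha : x < a ∧ a < y) :
    ∃ z, (x < z ∧ z < y) ∧ z ≠ a := by
  have h2 := hP.diamond x y (ha.1.trans ha.2) hxy
  by_contra! H
  have : {z : F | x < z ∧ z < y} = {a} := Set.eq_singleton_iff_unique_mem.2 ⟨ha, H⟩
  rw [this, Set.ncard_singleton] at h2
  omega

/-- The diamond property supplies a second face of rank i between the neighbours of ranks i - 1 and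
i + 1; exchanging it for the old one leaves a chain. -/
theorem exists_adjacentAt (Φ : Flag F) {i : ℤ} (h0 : 0 ≤ i) (h2 : i ≤ 2) :
    ∃ Ψ : Flag F, AdjacentAt i Φ Ψ := by
  have hG := hP.isGraded
  obtain ⟨x, hx, hxr⟩ := hG.exists_mem_flag Φ (i := i - 1) (by omega) (by omega)
  obtain ⟨a, ha, har⟩ := hG.exists_mem_flag Φ (i := i) (by omega) (by omega)
  obtain ⟨y, hy, hyr⟩ := hG.exists_mem_flag Φ (i := i + 1) (by omega) (by omega)
  obtain ⟨z, ⟨hxz, hzy⟩, hza⟩ := hP.exists_between_ne (by omega)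
    ⟨lt_of_mem_flag hx ha (by omega), lt_of_mem_flag ha hy (by omega)⟩
  have hzr : rank z = i := by
    have h1 := rank_strictMono hxz
    have h2 := rank_strictMono hzy
    omega
  have hchain : IsChain (· ≤ ·) (insert z {w | w ∈ Φ ∧ rank w ≠ i}) := by
    refine IsChain.insert (fun p hp q hq hpq => Φ.chain_le hp.1 hq.1 hpq) fun w hw _ => ?_
    rcases lt_or_gt_of_ne hw.2 with h | h
    · exact Or.inr ((le_of_mem_flag hw.1 hx (by omega)).trans hxz.le)
    · exact Or.inl (hzy.le.trans (le_of_mem_flag hy hw.1 (by omega)))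
  obtain ⟨Ψ, hΨ⟩ := hchain.exists_subset_flag
  refine ⟨Ψ, hG.adjacentAt_of_ne (fun w hw hwr => hΨ (Or.inr ⟨hw, hwr⟩)) ha fun haΨ => hza ?_⟩
  exact eq_of_mem_flag (hΨ (Or.inl rfl)) haΨ (by omega)

theorem eq_of_adjacentAt {Φ Ψ Ψ' : Flag F} {i : ℤ} (h : AdjacentAt i Φ Ψ)
    (h' : AdjacentAt i Φ Ψ') : Ψ = Ψ' := by
  have hG := hP.isGraded
  obtain ⟨h0, h2⟩ := hG.mem_of_adjacentAt h
  obtain ⟨x, hx, hxr⟩ := hG.exists_mem_flag Φ (i := i - 1) (by omega) (by omega)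
  obtain ⟨a, ha, har⟩ := hG.exists_mem_flag Φ (i := i) (by omega) (by omega)
  obtain ⟨y, hy, hyr⟩ := hG.exists_mem_flag Φ (i := i + 1) (by omega) (by omega)
  obtain ⟨z, hz, hzr⟩ := hG.exists_mem_flag Ψ (i := i) (by omega) (by omega)
  obtain ⟨w, hw, hwr⟩ := hG.exists_mem_flag Ψ' (i := i) (by omega) (by omega)
  have m (t : F) (ht : rank t ≠ i) (htΦ : t ∈ Φ) : t ∈ Ψ ∧ t ∈ Ψ' :=
    ⟨(h.2 t ht).1 htΦ, (h'.2 t ht).1 htΦ⟩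
  have hx' := m x (by omega) hx
  have hy' := m y (by omega) hy
  have hzw : z = w := by
    refine hP.eq_of_between (x := x) (y := y) (a := a) (by omega)
      ⟨lt_of_mem_flag hx ha (by omega), lt_of_mem_flag ha hy (by omega)⟩
      ⟨lt_of_mem_flag hx'.1 hz (by omega), lt_of_mem_flag hz hy'.1 (by omega)⟩
      ⟨lt_of_mem_flag hx'.2 hw (by omega), lt_of_mem_flag hw hy'.2 (by omega)⟩
      (hG.ne_of_adjacentAt h ha hz har).symm (hG.ne_of_adjacentAt h' ha hw har).symm
  refine hG.flag_ext fun j h0 h2 => ?_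
  by_cases hj : j = i
  · exact ⟨z, hz, hzw ▸ hw, by omega⟩
  · obtain ⟨t, ht, htr⟩ := hG.exists_mem_flag Φ (i := j) (by omega) (by omega)
    exact ⟨t, (m t (by omega) ht).1, (m t (by omega) ht).2, htr⟩

/-- Since i-adjacent flags are unique, fixing one flag propagates along adjacencies to all flags, by
connectedness, and every face lies in a flag. -/
theorem aut_eq_one {g : Aut F} {Φ : Flag F} (h : g • Φ = Φ) : g = 1 := by
  have hall : ∀ Ψ : Flag F, g • Ψ = Ψ := by
    intro Ψ
    have hconn : Relation.ReflTransGen (fun A B : Flag F => ∃ i, AdjacentAt i A B) Φ Ψ :=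
      Relation.ReflTransGen.mono (fun _ _ h => h.1) _ _ (hP.strongly_connected Φ Ψ)
    induction hconn with
    | refl => exact h
    | tail _ hstep ih =>
      obtain ⟨i, hi⟩ := hstep
      have := hi.smul g
      rw [ih] at this
      exact hP.eq_of_adjacentAt this hi
  refine Subtype.ext (RelIso.ext fun x => ?_)
  obtain ⟨Ψ, hΨ⟩ := Flag.exists_mem x
  have h1 : g • x ∈ Ψ := by
    have := smul_mem_smul_flag (g := g).2 hΨ
    rwa [hall] at this
  exact eq_of_mem_flag h1 hΨ (rank_smul g x)

theorem aut_eq_of_smul_flag_eq {g h : Aut F} {Φ : Flag F} (e : g • Φ = h • Φ) : g = h := by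
  have : h⁻¹ * g = 1 := hP.aut_eq_one (Φ := Φ) (by rw [mul_smul, e, inv_smul_smul])
  exact (inv_mul_eq_one.1 this).symm

/-- Automorphisms that move the base flag to its `i`-adjacent flags generate the stabilizers of
the faces of the base flag. -/
theorem mem_closure_of_smul_eq {Φ : Flag F} {r : ℤ → Aut F}
    (hr : ∀ i, 0 ≤ i → i ≤ 2 → AdjacentAt i Φ (r i • Φ)) {x : F} (hx : x ∈ Φ) {g : Aut F}
    (hg : g • x = x) : g ∈ Subgroup.closure {h | ∃ i, 0 ≤ i ∧ i ≤ 2 ∧ i ≠ rank x ∧ h = r i} := by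
  have hG := hP.isGraded
  have key : ∀ Ψ : Flag F, Relation.ReflTransGen
      (fun A B : Flag F => (∃ i, AdjacentAt i A B) ∧ ∀ y : F, y ∈ Φ → y ∈ g • Φ → y ∈ B) Φ Ψ →
      x ∈ Ψ ∧ ∃ h ∈ Subgroup.closure {h | ∃ i, 0 ≤ i ∧ i ≤ 2 ∧ i ≠ rank x ∧ h = r i},
        h • Φ = Ψ := by
    intro Ψ h
    induction h with
    | refl => exact ⟨hx, 1, one_mem _, one_smul _ _⟩
    | @tail A B _ hstep ih =>
      obtain ⟨⟨i, hi⟩, hcommon⟩ := hstep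
      obtain ⟨hxA, h, hh, rfl⟩ := ih
      have hxB : x ∈ B := hcommon x hx (by rw [← hg]; exact smul_mem_smul_flag.2 hx)
      obtain ⟨h0, h2⟩ := hG.mem_of_adjacentAt hi
      -- Strong connectedness keeps x in every flag of the path, so no step changes the face of the
      -- rank of x.
      have hix : i ≠ rank x := fun e => hG.ne_of_adjacentAt hi hxA hxB e.symm rfl
      -- The new generator goes on the right: h carries the i-adjacent flag of Φ to that of h • Φ.
      refine ⟨hxB, h * r i, mul_mem hh (Subgroup.subset_closure ⟨i, h0, h2, hix, rfl⟩), ?_⟩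
      rw [mul_smul]
      exact hP.eq_of_adjacentAt ((hr i h0 h2).smul h) hi
  obtain ⟨-, h, hh, he⟩ := key _ (hP.strongly_connected Φ (g • Φ))
  rwa [← hP.aut_eq_of_smul_flag_eq he]

omit hP in
theorem smul_eq_of_adjacentAt {Φ : Flag F} {g : Aut F} {i : ℤ} (h : AdjacentAt i Φ (g • Φ)) {x : F}
    (hx : x ∈ Φ) (hxi : rank x ≠ i) : g • x = x :=
  eq_of_mem_flag (smul_mem_smul_flag.2 hx) ((h.2 x hxi).1 hx) (rank_smul g x)

theorem mul_self_eq_one_of_adjacentAt {Φ : Flag F} {g : Aut F} {i : ℤ}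
    (h : AdjacentAt i Φ (g • Φ)) : g * g = 1 := by
  refine hP.aut_eq_one (Φ := Φ) ?_
  rw [mul_smul]
  exact hP.eq_of_adjacentAt (h.smul g) h.symm

omit hP in
theorem ne_one_of_adjacentAt {Φ : Flag F} {g : Aut F} {i : ℤ}
    (h : AdjacentAt i Φ (g • Φ)) : g ≠ 1 := by
  rintro rfl
  exact h.1 (one_smul _ _).symm

theorem smul_ne_of_adjacentAt {Φ : Flag F} {g : Aut F} {i : ℤ} (h : AdjacentAt i Φ (g • Φ)) {x : F}
    (hx : x ∈ Φ) (hxi : rank x = i) : g • x ≠ x :=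
  (hP.isGraded.ne_of_adjacentAt h hx (smul_mem_smul_flag.2 hx) hxi).symm

/-- Both fix the edge e. By the diamond property g, which fixes the facet f, also fixes the other
facet h • f on e; likewise h fixes the other end g • v of e. So both products carry Φ to the flag
with faces g • v, e and h • f. -/
theorem mul_comm_of_adjacentAt {Φ : Flag F} {g h : Aut F} (hg : AdjacentAt 0 Φ (g • Φ))
    (hh : AdjacentAt 2 Φ (h • Φ)) : g * h = h * g := by
  have hG := hP.isGraded
  obtain ⟨v, hv, hvr⟩ := hG.exists_mem_flag Φ (i := 0) (by omega) (by omega)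
  obtain ⟨e, he, her⟩ := hG.exists_mem_flag Φ (i := 1) (by omega) (by omega)
  obtain ⟨f, hf, hfr⟩ := hG.exists_mem_flag Φ (i := 2) (by omega) (by omega)
  obtain ⟨x, hx, hxr⟩ := hG.exists_mem_flag Φ (i := -1) (by omega) (by omega)
  obtain ⟨y, hy, hyr⟩ := hG.exists_mem_flag Φ (i := 3) (by omega) (by omega)
  have ge := smul_eq_of_adjacentAt hg he (by omega)
  have gf := smul_eq_of_adjacentAt hg hf (by omega)
  have gy := smul_eq_of_adjacentAt hg hy (by omega)
  have he' := smul_eq_of_adjacentAt hh he (by omega)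
  have hv' := smul_eq_of_adjacentAt hh hv (by omega)
  have hx' := smul_eq_of_adjacentAt hh hx (by omega)
  have btw : ∀ k : Aut F, ∀ {a c d : F}, k • a = a → k • d = d → a < c ∧ c < d →
      a < k • c ∧ k • c < d := by
    intro k a c d h1 h2 h3
    have h4 := smul_lt_smul_iff_aut k (x := a) (y := c)
    have h5 := smul_lt_smul_iff_aut k (x := c) (y := d)
    rw [h1] at h4
    rw [h2] at h5
    exact ⟨h4.2 h3.1, h5.2 h3.2⟩
  have hef : e < f ∧ f < y := ⟨lt_of_mem_flag he hf (by omega), lt_of_mem_flag hf hy (by omega)⟩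
  have hxv : x < v ∧ v < e := ⟨lt_of_mem_flag hx hv (by omega), lt_of_mem_flag hv he (by omega)⟩
  have hhf := hP.smul_ne_of_adjacentAt hh hf hfr
  have hgv := hP.smul_ne_of_adjacentAt hg hv hvr
  have b1 := btw h he' (smul_eq_of_adjacentAt hh hy (by omega)) hef
  have b2 := btw g (smul_eq_of_adjacentAt hg hx (by omega)) ge hxv
  have k1 : g • h • f = h • f := by
    refine hP.eq_of_between (by omega) hef (btw g ge gy b1) b1 (fun H => hhf ?_) hhf
    exact smul_left_cancel g (H.trans gf.symm)
  have k2 : h • g • v = g • v := by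
    refine hP.eq_of_between (by omega) hxv (btw h hx' he' b2) b2 (fun H => hgv ?_) hgv
    exact smul_left_cancel h (H.trans hv'.symm)
  refine hP.aut_eq_of_smul_flag_eq (Φ := Φ) ?_
  have m (k : Aut F) {z w : F} (hz : z ∈ Φ) (hk : k • z = w) : w ∈ k • Φ :=
    hk ▸ smul_mem_smul_flag.2 hz
  refine hG.flag_eq (v := g • v) (e := e) (f := h • f) (by rw [rank_smul, hvr]) her
    (by rw [rank_smul, hfr]) (m _ hv ?_) (m _ he ?_) (m _ hf ?_) (m _ hv ?_) (m _ he ?_) (m _ hf ?_)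
  · rw [mul_smul, hv']
  · rw [mul_smul, he', ge]
  · rw [mul_smul, k1]
  · rw [mul_smul, k2]
  · rw [mul_smul, ge, he']
  · rw [mul_smul, gf]

end IsPolyhedron

/-- A base vertex, edge and facet of a regular polyhedron and the corresponding distinguished
generators of its automorphism group. -/
structure IsBase (v e f : F) (r₀ r₁ r₂ : Aut F) : Prop where
  rank_vertex : rank v = 0
  rank_edge : rank e = 1
  rank_facet : rank f = 2
  vertex_le_edge : v ≤ e
  edge_le_facet : e ≤ f
  smul₀_edge : r₀ • e = e
  smul₀_facet : r₀ • f = f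
  smul₁_vertex : r₁ • v = v
  smul₁_facet : r₁ • f = f
  smul₂_vertex : r₂ • v = v
  smul₂_edge : r₂ • e = e
  sq₀ : r₀ * r₀ = 1
  sq₁ : r₁ * r₁ = 1
  sq₂ : r₂ * r₂ = 1
  comm : r₀ * r₂ = r₂ * r₀
  ne_one₁ : r₁ ≠ 1
  ne_one₂ : r₂ ≠ 1
  ne : r₁ ≠ r₂
  stabilizer_vertex : ∀ g : Aut F, g • v = v → g ∈ Subgroup.closure {r₁, r₂}
  stabilizer_facet : ∀ g : Aut F, g • f = f → g ∈ Subgroup.closure {r₀, r₁}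
  closure_eq_top : Subgroup.closure {r₀, r₁, r₂} = ⊤
  vertex_of_edge : ∀ w : F, rank w = 0 → w ≤ e → w = v ∨ w = r₀ • v
  facet_of_edge : ∀ w : F, rank w = 2 → e ≤ w → w = f ∨ w = r₂ • f
  fix_vertex_edge : ∀ g : Aut F, g • v = v → g • e = e → g = 1 ∨ g = r₂
  exists_vertex : ∀ w : F, rank w = 0 → ∃ g : Aut F, g • v = w
  exists_edge : ∀ w : F, rank w = 1 → ∃ g : Aut F, g • e = w
  exists_facet : ∀ w : F, rank w = 2 → ∃ g : Aut F, g • f = w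
  exists_vertex_of_facet : ∀ w : F, rank w = 0 → w ≤ f → ∃ g : Aut F, g • v = w ∧ g • f = f

theorem IsPolyhedron.exists_isBase (hP : IsPolyhedron F) (hreg : IsRegular F) :
    ∃ (v e f : F) (r₀ r₁ r₂ : Aut F), IsBase v e f r₀ r₁ r₂ := by
  have hG := hP.isGraded
  have : IsPretransitive (Aut F) (Flag F) := hreg
  obtain ⟨Φ⟩ : Nonempty (Flag F) := inferInstance
  have hr : ∀ i : ℤ, ∃ g : Aut F, 0 ≤ i → i ≤ 2 → AdjacentAt i Φ (g • Φ) := by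
    intro i
    by_cases h : 0 ≤ i ∧ i ≤ 2
    · obtain ⟨Ψ, hΨ⟩ := hP.exists_adjacentAt Φ h.1 h.2
      obtain ⟨g, rfl⟩ := exists_smul_eq (Aut F) Φ Ψ
      exact ⟨g, fun _ _ => hΨ⟩
    · exact ⟨1, fun h0 h2 => absurd ⟨h0, h2⟩ h⟩
  choose r hr using hr
  have a0 := hr 0 le_rfl (by norm_num)
  have a1 := hr 1 (by norm_num) (by norm_num)
  have a2 := hr 2 (by norm_num) le_rfl
  obtain ⟨v, hv, hvr⟩ := hG.exists_mem_flag Φ (i := 0) (by omega) (by omega)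
  obtain ⟨e, he, her⟩ := hG.exists_mem_flag Φ (i := 1) (by omega) (by omega)
  obtain ⟨f, hf, hfr⟩ := hG.exists_mem_flag Φ (i := 2) (by omega) (by omega)
  obtain ⟨x, hx, hxr⟩ := hG.exists_mem_flag Φ (i := -1) (by omega) (by omega)
  obtain ⟨y, hy, hyr⟩ := hG.exists_mem_flag Φ (i := 3) (by omega) (by omega)
  have fx {i : ℤ} (h : AdjacentAt i Φ (r i • Φ)) {z : F} (hz : z ∈ Φ) (hzi : rank z ≠ i) :
      r i • z = z := IsPolyhedron.smul_eq_of_adjacentAt h hz hzi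
  have htrans {z w : F} (hz : z ∈ Φ) (hw : rank w = rank z) : ∃ g : Aut F, g • z = w := by
    obtain ⟨Ψ, hΨ⟩ := Flag.exists_mem w
    obtain ⟨g, rfl⟩ := exists_smul_eq (Aut F) Φ Ψ
    exact ⟨g, eq_of_mem_flag (smul_mem_smul_flag.2 hz) hΨ (by rw [rank_smul, hw])⟩
  have hset {z : F} (s : Set (Aut F)) (hs : ∀ i, 0 ≤ i → i ≤ 2 → i ≠ rank z → r i ∈ s)
      (hz : z ∈ Φ) (g : Aut F) (hg : g • z = z) : g ∈ Subgroup.closure s := by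
    refine Subgroup.closure_mono ?_ (hP.mem_closure_of_smul_eq hr hz hg)
    rintro h ⟨i, h0, h2, hi, rfl⟩
    exact hs i h0 h2 hi
  have hfacets : ∀ w : F, rank w = 2 → e ≤ w → w = f ∨ w = r 2 • f := by
    intro w hw hew
    by_contra! H
    have hlt {w : F} (hw : rank w = 2) (hew : e ≤ w) : e < w ∧ w < y :=
      ⟨hew.lt_of_ne (by rintro rfl; omega), (hG.le_of_rank_eq_three hyr w).lt_of_ne
        (by rintro rfl; omega)⟩
    have hef := le_of_mem_flag he hf (by omega)
    refine H.2 (hP.eq_of_between (by omega) (hlt hfr hef) (hlt hw hew)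
      (hlt (by rw [rank_smul, hfr]) ?_) H.1 (hP.smul_ne_of_adjacentAt a2 hf hfr))
    nth_rw 1 [← fx a2 he (by omega)]
    rwa [smul_le_smul_iff_aut]
  refine ⟨v, e, f, r 0, r 1, r 2, hvr, her, hfr, le_of_mem_flag hv he (by omega),
    le_of_mem_flag he hf (by omega), fx a0 he (by omega), fx a0 hf (by omega),
    fx a1 hv (by omega), fx a1 hf (by omega), fx a2 hv (by omega), fx a2 he (by omega),
    hP.mul_self_eq_one_of_adjacentAt a0, hP.mul_self_eq_one_of_adjacentAt a1,
    hP.mul_self_eq_one_of_adjacentAt a2, hP.mul_comm_of_adjacentAt a0 a2,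
    IsPolyhedron.ne_one_of_adjacentAt a1, IsPolyhedron.ne_one_of_adjacentAt a2, ?_,
    hset _ ?_ hv, hset _ ?_ hf, ?_, ?_, hfacets, ?_, ?_, ?_, ?_, ?_⟩
  · intro h
    exact hP.smul_ne_of_adjacentAt a1 he her (h ▸ fx a2 he (by omega))
  · intro i h0 h2 hi
    obtain rfl | rfl : i = 1 ∨ i = 2 := by omega
    all_goals simp
  · intro i h0 h2 hi
    obtain rfl | rfl : i = 0 ∨ i = 1 := by omega
    all_goals simp
  · refine eq_top_iff.2 fun g _ => hset _ ?_ hx g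
      (hG.existsUnique_least.unique (by rw [rank_smul, hxr]) hxr)
    intro i h0 h2 hi
    obtain rfl | rfl | rfl : i = 0 ∨ i = 1 ∨ i = 2 := by omega
    all_goals simp
  · intro w hw hwe
    by_contra! H
    have hlt {w : F} (hw : rank w = 0) (hwe : w ≤ e) : x < w ∧ w < e :=
      ⟨(hG.le_of_rank_eq_neg_one hxr w).lt_of_ne (by rintro rfl; omega),
        hwe.lt_of_ne (by rintro rfl; omega)⟩
    have hve := le_of_mem_flag hv he (by omega)
    refine H.2 (hP.eq_of_between (by omega) (hlt hvr hve) (hlt hw hwe)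
      (hlt (by rw [rank_smul, hvr]) ?_) H.1 (hP.smul_ne_of_adjacentAt a0 hv hvr))
    rw [← fx a0 he (by omega)]
    rwa [smul_le_smul_iff_aut]
  · intro g hgv hge
    have m (k : Aut F) {z w : F} (hz : z ∈ Φ) (hk : k • z = w) : w ∈ k • Φ :=
      hk ▸ smul_mem_smul_flag.2 hz
    rcases hfacets (g • f) (by rw [rank_smul, hfr]) (by
      nth_rw 1 [← hge]
      rw [smul_le_smul_iff_aut]
      exact le_of_mem_flag he hf (by omega)) with h | h
    · left
      exact hP.aut_eq_one (hG.flag_eq hvr her hfr (m g hv hgv) (m g he hge) (m g hf h) hv he hf)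
    · right
      exact hP.aut_eq_of_smul_flag_eq (hG.flag_eq hvr her (by rw [rank_smul, hfr]) (m g hv hgv)
        (m g he hge) (m g hf h) (m _ hv (fx a2 hv (by omega))) (m _ he (fx a2 he (by omega)))
        (m _ hf rfl))
  · exact fun w hw => htrans hv (by omega)
  · exact fun w hw => htrans he (by omega)
  · exact fun w hw => htrans hf (by omega)
  · intro w hw hwf
    obtain ⟨Ψ, hwΨ, hfΨ⟩ := Flag.exists_mem_mem hwf
    obtain ⟨g, rfl⟩ := exists_smul_eq (Aut F) Φ Ψ
    exact ⟨g, eq_of_mem_flag (smul_mem_smul_flag.2 hv) hwΨ (by rw [rank_smul]; omega),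
      eq_of_mem_flag (smul_mem_smul_flag.2 hf) hfΨ (by rw [rank_smul])⟩

end Polyhedron

end AbsPoly

/-! ### The common combinatorial model. -/

namespace AbsPoly

open RankedPoset MulAction

/-- The faces of the dual of the Petrial of a toroidal map: its facets, edges and vertices are the
nodes, the horizontal and vertical edges, and the zigzags of the torus. -/
inductive Shape (b : ℕ) : Type
  | least : Shape b
  | vertex (s : Bool) (m : ZMod b) : Shape b
  | hor (i j : ZMod b) : Shape b
  | vert (i j : ZMod b) : Shape b
  | node (i j : ZMod b) : Shape b
  | greatest : Shape b

namespace Shape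

variable {b : ℕ}

/-- The rank of a face. -/
def rank : Shape b → ℤ
  | least => -1
  | vertex _ _ => 0
  | hor _ _ => 1
  | vert _ _ => 1
  | node _ _ => 2
  | greatest => 3

/-- The diagonal or antidiagonal through a node. -/
def diag (s : Bool) (i j : ZMod b) : ZMod b := cond s (i + j) (i - j)

/-- The incidence relation. -/
def Le : Shape b → Shape b → Prop
  | least, _ => True
  | _, greatest => True
  | vertex s m, hor i j => m = diag s i j
  | vertex s m, vert i j => m = cond s (i + j) (i - j - 1)
  | vertex s m, node i j => diag s i j = m ∨ diag s i j = m + 1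
  | hor i j, node i' j' => j' = j ∧ (i' = i ∨ i' = i + 1)
  | vert i j, node i' j' => i' = i ∧ (j' = j ∨ j' = j + 1)
  -- Besides equal ranks this covers decreasing ranks, where different constructors make it false.
  | x, y => x = y

end Shape

/-- A parametrization of the faces of a ranked poset by the faces of the dual of the Petrial of a
toroidal map. -/
structure IsModel {F : Type*} [RankedPoset F] {b : ℕ} (face : Shape b → F) : Prop where
  surjective : Function.Surjective face
  injective : Function.Injective face
  rank_face : ∀ m, rank (face m) = m.rank
  least_le : ∀ x, face .least ≤ x
  le_greatest : ∀ x, x ≤ face .greatest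
  vertex_hor : ∀ s m i j, face (.vertex s m) ≤ face (.hor i j) ↔ m = Shape.diag s i j
  vertex_vert : ∀ s m i j, face (.vertex s m) ≤ face (.vert i j) ↔ m = cond s (i + j) (i - j - 1)
  vertex_node : ∀ s m i j, face (.vertex s m) ≤ face (.node i j) ↔
    Shape.diag s i j = m ∨ Shape.diag s i j = m + 1
  hor_node : ∀ i j i' j', face (.hor i j) ≤ face (.node i' j') ↔ j' = j ∧ (i' = i ∨ i' = i + 1)
  vert_node : ∀ i j i' j', face (.vert i j) ≤ face (.node i' j') ↔ i' = i ∧ (j' = j ∨ j' = j + 1)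

namespace IsModel

variable {F : Type*} [RankedPoset F] {b : ℕ} {face : Shape b → F}

/-- The fields of `IsModel` cover the increasing pairs of ranks; equal ranks reduce to injectivity,
and decreasing ranks are excluded by strict monotonicity of the rank. -/
theorem le_iff (h : IsModel face) (m n : Shape b) : face m ≤ face n ↔ m.Le n := by
  have hsame : m.rank = n.rank → (face m ≤ face n ↔ m = n) := fun hr =>
    ⟨fun hle => h.injective (eq_of_le_of_rank_eq hle (by rw [h.rank_face, h.rank_face, hr])),
      fun e => e ▸ le_rfl⟩
  have hgt : n.rank < m.rank → ¬ face m ≤ face n := fun hr hle => by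
    have := rank_strictMono.monotone hle
    rw [h.rank_face, h.rank_face] at this
    omega
  cases m <;> cases n <;>
    first
    | exact iff_of_true (h.least_le _) trivial
    | exact iff_of_true (h.le_greatest _) trivial
    | exact h.vertex_hor _ _ _ _
    | exact h.vertex_vert _ _ _ _
    | exact h.vertex_node _ _ _ _
    | exact h.hor_node _ _ _ _
    | exact h.vert_node _ _ _ _
    | exact hsame rfl
    | exact iff_of_false (hgt (by norm_num [Shape.rank])) (by simp [Shape.Le])

theorem isomorphic {G : Type*} [RankedPoset G] {face' : Shape b → G} (h : IsModel face)
    (h' : IsModel face') : Isomorphic F G := by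
  let e := Equiv.ofBijective face ⟨h.injective, h.surjective⟩
  let e' := Equiv.ofBijective face' ⟨h'.injective, h'.surjective⟩
  refine ⟨⟨e.symm.trans e', fun {x y} => ?_⟩, fun x => ?_⟩
  · obtain ⟨m, rfl⟩ := e.surjective x
    obtain ⟨n, rfl⟩ := e.surjective y
    simp only [Equiv.trans_apply, Equiv.symm_apply_apply]
    exact (h'.le_iff m n).trans (h.le_iff m n).symm
  · obtain ⟨m, rfl⟩ := e.surjective x
    change rank (e' (e.symm (e m))) = _
    rw [Equiv.symm_apply_apply]
    exact (h'.rank_face m).trans (h.rank_face m).symm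

theorem exists_node (h : IsModel face) {x : F} (hx : rank x = 2) : ∃ i j, face (.node i j) = x := by
  obtain ⟨m, rfl⟩ := h.surjective x
  rw [h.rank_face] at hx
  cases m <;> simp [Shape.rank] at hx
  exact ⟨_, _, rfl⟩

theorem exists_vertex (h : IsModel face) {x : F} (hx : rank x = 0) :
    ∃ s m, face (.vertex s m) = x := by
  obtain ⟨m, rfl⟩ := h.surjective x
  rw [h.rank_face] at hx
  cases m <;> simp [Shape.rank] at hx
  exact ⟨_, _, rfl⟩

theorem exists_edge (h : IsModel face) {x : F} (hx : rank x = 1) :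
    (∃ i j, face (.hor i j) = x) ∨ ∃ i j, face (.vert i j) = x := by
  obtain ⟨m, rfl⟩ := h.surjective x
  rw [h.rank_face] at hx
  cases m <;> simp [Shape.rank] at hx
  exacts [Or.inl ⟨_, _, rfl⟩, Or.inr ⟨_, _, rfl⟩]

/-- A node lies on two zigzags in each of the two directions; a zigzag contains one horizontal and
one vertical edge for each value of the first coordinate. -/
theorem hasSchlafliType [Fact (1 < b)] (h : IsModel face) : HasSchlafliType F 4 (2 * b) := by
  have : NeZero b := ⟨by have := Fact.out (p := 1 < b); omega⟩
  constructor
  · rintro ⟨f, hf⟩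
    obtain ⟨i, j, rfl⟩ := h.exists_node hf
    let φ : Bool × Bool → Vertex F := fun p =>
      ⟨face (.vertex p.1 (Shape.diag p.1 i j - cond p.2 1 0)), h.rank_face _⟩
    have hφ : Function.Injective φ := by
      rintro ⟨s, t⟩ ⟨s', t'⟩ he
      have he := h.injective (congrArg Subtype.val he)
      simp only [Shape.vertex.injEq] at he
      obtain ⟨rfl, he⟩ := he
      rw [sub_right_inj] at he
      cases t <;> cases t' <;> simp at he ⊢
    have hr : {v : Vertex F | v.1 ≤ face (.node i j)} = Set.range φ := by
      ext ⟨v, hv⟩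
      obtain ⟨s, m, rfl⟩ := h.exists_vertex hv
      constructor
      · intro hle
        rcases (h.vertex_node s m i j).1 hle with e | e
        · exact ⟨(s, false), Subtype.ext (congrArg face (by simp [e]))⟩
        · exact ⟨(s, true), Subtype.ext (congrArg face (by simp [e]))⟩
      · rintro ⟨⟨s', t⟩, he⟩
        have he := h.injective (congrArg Subtype.val he)
        simp only [Shape.vertex.injEq] at he
        obtain ⟨rfl, rfl⟩ := he
        refine (h.vertex_node _ _ i j).2 ?_
        cases t <;> simp
    rw [hr, ← Set.image_univ, hφ.encard_image, Set.encard_univ]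
    simp
  · rintro ⟨v, hv⟩
    obtain ⟨s, m, rfl⟩ := h.exists_vertex hv
    let φ : Bool × ZMod b → Edge F := fun p => cond p.1
      ⟨face (.hor p.2 (cond s (m - p.2) (p.2 - m))), h.rank_face _⟩
      ⟨face (.vert p.2 (cond s (m - p.2) (p.2 - m - 1))), h.rank_face _⟩
    have hφ : Function.Injective φ := by
      rintro ⟨_ | _, x⟩ ⟨_ | _, y⟩ he <;>
        have he := h.injective (congrArg Subtype.val he) <;> simp_all
    have hr : {e : Edge F | face (.vertex s m) ≤ e.1} = Set.range φ := by
      ext ⟨e, he⟩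
      constructor
      · intro hle
        rcases h.exists_edge he with ⟨i, j, rfl⟩ | ⟨i, j, rfl⟩
        · refine ⟨(true, i), Subtype.ext (congrArg face ?_)⟩
          have := (h.vertex_hor _ _ _ _).1 hle
          cases s <;> simp [this, Shape.diag]
        · refine ⟨(false, i), Subtype.ext (congrArg face ?_)⟩
          have := (h.vertex_vert _ _ _ _).1 hle
          cases s
          · simp only [this, cond_false, Shape.vert.injEq, true_and]
            ring
          · simp [this]
      · rintro ⟨⟨_ | _, x⟩, hx⟩
        · have hx := congrArg Subtype.val hx
          simp only [φ, cond_false] at hx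
          subst hx
          refine (h.vertex_vert _ _ _ _).2 ?_
          cases s
          · simp only [cond_false]
            ring
          · simp
        · have hx := congrArg Subtype.val hx
          simp only [φ, cond_true] at hx
          subst hx
          refine (h.vertex_hor _ _ _ _).2 ?_
          cases s <;> simp [Shape.diag]
    rw [hr, ← Set.image_univ, hφ.encard_image, Set.encard_univ]
    simp

end IsModel

end AbsPoly

namespace AbsPoly

open RankedPoset MulAction

/-! ### From toroidal coordinates to the model. -/

section ToroidalModel

variable {F : Type*} [RankedPoset F] {b : ℕ} {v e f : F} {r₀ r₁ r₂ : Aut F}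
  {pt : Bool × ZMod b ≃ Vertex F}

theorem aut_eq_of_smul_pt_eq (hfaith : IsVertexFaithful F) {g h : Aut F}
    (hf : ∀ x, g • pt (false, x) = h • pt (false, x))
    (ht : ∀ x, g • pt (true, x) = h • pt (true, x)) : g = h := by
  have : h⁻¹ * g = 1 := hfaith _ fun w => by
    obtain ⟨⟨_ | _, x⟩, rfl⟩ := pt.surjective w
    · rw [mul_smul, hf, inv_smul_smul]
    · rw [mul_smul, ht, inv_smul_smul]
  exact (inv_mul_eq_one.1 this).symm

/-- The shift c moves only the second block and r₀cr₀ only the first, so their powers shift the two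
blocks independently. -/
theorem IsToroidalCoordinates.exists_translation [NeZero b] (hT : IsToroidalCoordinates r₀ r₁ r₂ pt) :
    ∃ t : ZMod b → ZMod b → Aut F, (∀ k l x, t k l • pt (false, x) = pt (false, x + k)) ∧
      ∀ k l x, t k l • pt (true, x) = pt (true, x + l) := by
  obtain ⟨c, hcf, hct⟩ := hT.exists_shift
  have pf (n : ℕ) (x : ZMod b) : c ^ n • pt (false, x) = pt (false, x) := by
    induction n with
    | zero => simp
    | succ n ih => rw [pow_succ, mul_smul, hcf, ih]
  have ptr (n : ℕ) (x : ZMod b) : c ^ n • pt (true, x) = pt (true, x + n) := by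
    induction n with
    | zero => simp
    | succ n ih => rw [pow_succ', mul_smul, ih, hct, Nat.cast_succ, add_assoc]
  refine ⟨fun k l => r₀ * c ^ k.val * r₀ * c ^ l.val, fun k l x => ?_, fun k l x => ?_⟩
  · rw [mul_smul, pf, mul_smul, mul_smul, hT.smul₀, Bool.not_false, ptr, hT.smul₀, Bool.not_true,
      ZMod.natCast_zmod_val]
  · rw [mul_smul, ptr, mul_smul, mul_smul, hT.smul₀, Bool.not_true, pf, hT.smul₀, Bool.not_false,
      ZMod.natCast_zmod_val]

/-- The three generators have this form, with slopes ±1 chosen separately on the two blocks, and the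
form survives composition. -/
theorem IsToroidalCoordinates.exists_affine (hT : IsToroidalCoordinates r₀ r₁ r₂ pt)
    (hB : IsBase v e f r₀ r₁ r₂) (g : Aut F) :
    ∃ (s : Bool) (k l ε ε' : ZMod b), (ε = 1 ∨ ε = -1) ∧ (ε' = 1 ∨ ε' = -1) ∧
      (∀ x, g • pt (false, x) = pt (s, ε * x + k)) ∧
      ∀ x, g • pt (true, x) = pt (!s, ε' * x + l) := by
  have hstep : ∀ r ∈ ({r₀, r₁, r₂} : Set (Aut F)), ∀ h : Aut F,
      (∃ (s : Bool) (k l ε ε' : ZMod b), (ε = 1 ∨ ε = -1) ∧ (ε' = 1 ∨ ε' = -1) ∧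
      (∀ x, h • pt (false, x) = pt (s, ε * x + k)) ∧
      ∀ x, h • pt (true, x) = pt (!s, ε' * x + l)) → 
      (∃ (s : Bool) (k l ε ε' : ZMod b), (ε = 1 ∨ ε = -1) ∧ (ε' = 1 ∨ ε' = -1) ∧
      (∀ x, (r * h) • pt (false, x) = pt (s, ε * x + k)) ∧
      ∀ x, (r * h) • pt (true, x) = pt (!s, ε' * x + l)) := by
    have hn {ε : ZMod b} (hε : ε = 1 ∨ ε = -1) : -ε = 1 ∨ -ε = -1 := by
      rcases hε with rfl | rfl <;> simp
    rintro r hr h ⟨s, k, l, ε, ε', hε, hε', h1, h2⟩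
    rcases hr with rfl | rfl | rfl
    · refine ⟨!s, k, l, ε, ε', hε, hε', fun x => ?_, fun x => ?_⟩
      · rw [mul_smul, h1, hT.smul₀]
      · rw [mul_smul, h2, hT.smul₀]
    · cases s
      · refine ⟨false, k, 1 - l, ε, -ε', hε, hn hε', fun x => ?_, fun x => ?_⟩
        · rw [mul_smul, h1, hT.smul₁_false]
        · rw [mul_smul, h2, Bool.not_false, hT.smul₁_true]
          congr 2; ring
      · refine ⟨true, 1 - k, l, -ε, ε', hn hε, hε', fun x => ?_, fun x => ?_⟩
        · rw [mul_smul, h1, hT.smul₁_true]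
          congr 2; ring
        · rw [mul_smul, h2, Bool.not_true, hT.smul₁_false]
    · refine ⟨s, -k, -l, -ε, -ε', hn hε, hn hε', fun x => ?_, fun x => ?_⟩
      · rw [mul_smul, h1, hT.smul₂]
        congr 2; ring
      · rw [mul_smul, h2, hT.smul₂]
        congr 2; ring
  have hinv : ∀ r ∈ ({r₀, r₁, r₂} : Set (Aut F)), r⁻¹ = r := by
    rintro r (rfl | rfl | rfl)
    exacts [inv_eq_of_mul_eq_one_right hB.sq₀, inv_eq_of_mul_eq_one_right hB.sq₁,
      inv_eq_of_mul_eq_one_right hB.sq₂]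
  have hg : g ∈ Subgroup.closure {r₀, r₁, r₂} := by rw [hB.closure_eq_top]; trivial
  induction hg using Subgroup.closure_induction_left with
  | one => exact ⟨false, 0, 0, 1, 1, Or.inl rfl, Or.inl rfl, by simp, by simp⟩
  | mul_left r hr h _ ih => exact hstep r hr h ih
  | inv_mul_cancel r hr h _ ih =>
    rw [hinv r hr]
    exact hstep r hr h ih

variable (hfaith : IsVertexFaithful F) (hT : IsToroidalCoordinates r₀ r₁ r₂ pt)
  (hB : IsBase v e f r₀ r₁ r₂) (hpt : (pt (false, 0)).1 = v)
include hT hB hpt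

theorem IsToroidalCoordinates.vertex_le_base_edge (s : Bool) (m : ZMod b) :
    (pt (s, m)).1 ≤ e ↔ m = 0 := by
  have h0 : r₀ • v = (pt (true, 0)).1 := by
    rw [← hpt, ← coe_smul_vertex, hT.smul₀, Bool.not_false]
  constructor
  · intro h
    rcases hB.vertex_of_edge _ (pt (s, m)).2 h with h | h
    · rw [← hpt] at h
      exact congrArg Prod.snd (pt.injective (Subtype.ext h))
    · rw [h0] at h
      exact congrArg Prod.snd (pt.injective (Subtype.ext h))
  · rintro rfl
    cases s
    · rw [hpt]; exact hB.vertex_le_edge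
    · rw [← h0]
      rw [← hB.smul₀_edge]
      exact (smul_le_smul_iff_aut r₀).2 hB.vertex_le_edge

/-- The vertices of f form the orbit of the base vertex under ⟨r₀, r₁⟩, and positions 0 and 1 of
both blocks are closed under x ↦ 1 - x and the exchange of blocks. -/
theorem IsToroidalCoordinates.vertex_le_base_facet (s : Bool) (m : ZMod b) :
    (pt (s, m)).1 ≤ f ↔ m = 0 ∨ m = 1 := by
  have hgo : ∀ g : Aut F, g • f = f → ∀ w : Vertex F, w.1 ≤ f → (g • w).1 ≤ f := by
    intro g hg w hw
    rw [coe_smul_vertex, ← hg]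
    exact (smul_le_smul_iff_aut g).2 hw
  constructor
  · intro h
    obtain ⟨g, hgv, hgf⟩ := hB.exists_vertex_of_facet _ (pt (s, m)).2 h
    have hstep : ∀ r ∈ ({r₀, r₁} : Set (Aut F)), ∀ g : Aut F,
        (∃ s m, (m = 0 ∨ m = 1) ∧ g • pt (false, 0) = pt (s, m)) →
        ∃ s m, (m = 0 ∨ m = 1) ∧ (r * g) • pt (false, 0) = pt (s, m) := by
      rintro r hr g ⟨s, m, hm, h⟩
      rcases hr with rfl | rfl
      · exact ⟨!s, m, hm, by rw [mul_smul, h, hT.smul₀]⟩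
      · cases s
        · exact ⟨false, m, hm, by rw [mul_smul, h, hT.smul₁_false]⟩
        · refine ⟨true, 1 - m, ?_, by rw [mul_smul, h, hT.smul₁_true]⟩
          rcases hm with rfl | rfl <;> simp
    have hinv : ∀ r ∈ ({r₀, r₁} : Set (Aut F)), r⁻¹ = r := by
      rintro r (rfl | rfl)
      exacts [inv_eq_of_mul_eq_one_right hB.sq₀, inv_eq_of_mul_eq_one_right hB.sq₁]
    have key : ∃ s m, (m = 0 ∨ m = 1) ∧ g • pt (false, 0) = pt (s, m) := by
      have hg := hB.stabilizer_facet g hgf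
      clear hgv hgf
      induction hg using Subgroup.closure_induction_left with
      | one => exact ⟨false, 0, Or.inl rfl, one_smul _ _⟩
      | mul_left r hr h _ ih => exact hstep r hr h ih
      | inv_mul_cancel r hr h _ ih =>
        rw [hinv r hr]
        exact hstep r hr h ih
    obtain ⟨s', m', hm', h'⟩ := key
    have : pt (s', m') = pt (s, m) := by
      rw [← h']
      apply Subtype.ext
      rw [coe_smul_vertex, hpt, hgv]
    have hmm : m' = m := congrArg Prod.snd (pt.injective this)
    exact hmm ▸ hm'
  · have h1 : (pt (false, 0)).1 ≤ f := hpt ▸ hB.vertex_le_edge.trans hB.edge_le_facet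
    have h2 : (pt (true, 0)).1 ≤ f := by
      have := hgo r₀ hB.smul₀_facet _ h1
      rwa [hT.smul₀] at this
    have h3 : (pt (true, 1)).1 ≤ f := by
      have := hgo r₁ hB.smul₁_facet _ h2
      rwa [hT.smul₁_true, sub_zero] at this
    have h4 : (pt (false, 1)).1 ≤ f := by
      have := hgo r₀ hB.smul₀_facet _ h3
      rwa [hT.smul₀] at this
    rintro (rfl | rfl) <;> cases s <;> assumption

include hfaith

/-- A regular polyhedron with toroidal coordinates has the same faces and incidences as the dual of
the Petrial of a toroidal map. -/
theorem IsToroidalCoordinates.exists_isModel (hG : IsGraded F) (hb : b.Prime) (hb2 : b ≠ 2) :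
    ∃ face : Shape b → F, IsModel face := by
  have hp : Fact b.Prime := ⟨hb⟩
  have hb3 : Fact (2 < b) := ⟨lt_of_le_of_ne hb.two_le hb2.symm⟩
  have h2 : (2 : ZMod b) ≠ 0 := fun h => ZMod.neg_one_ne_one (n := b) (by linear_combination -h)
  have htwo {x y : ZMod b} (h : 2 * x = 2 * y) : x = y := mul_left_cancel₀ h2 h
  obtain ⟨t, htf, htt⟩ := hT.exists_translation
  have hext {g h : Aut F} := aut_eq_of_smul_pt_eq (pt := pt) hfaith (g := g) (h := h)
  have htadd (k l k' l') : t k l * t k' l' = t (k + k') (l + l') := by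
    refine hext (fun x => ?_) fun x => ?_
    · rw [mul_smul, htf, htf, htf]; congr 2; ring
    · rw [mul_smul, htt, htt, htt]; congr 2; ring
  have ht0 : t 0 0 = 1 := hext (fun x => by rw [htf, add_zero, one_smul])
    fun x => by rw [htt, add_zero, one_smul]
  have htinv (k l) : (t k l)⁻¹ = t (-k) (-l) :=
    inv_eq_of_mul_eq_one_right (by rw [htadd, add_neg_cancel, add_neg_cancel, ht0])
  have hle (g : Aut F) (x y : F) : x ≤ g • y ↔ g⁻¹ • x ≤ y := by
    rw [← smul_le_smul_iff_aut g (x := g⁻¹ • x), smul_inv_smul]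
  have hlet (k l) (x y : F) : x ≤ t k l • y ↔ t (-k) (-l) • x ≤ y := by rw [hle, htinv]
  have hvt (s : Bool) (m k l : ZMod b) : t k l • (pt (s, m)).1 = (pt (s, m + cond s l k)).1 := by
    rw [← coe_smul_vertex]
    cases s
    · rw [htf]; rfl
    · rw [htt]; rfl
  -- The translation recentres x ↦ 1 - x to x ↦ -x, so τ negates one block and fixes the other
  -- pointwise.
  obtain ⟨τ, hτ⟩ : ∃ τ, τ = t 0 (-1) * r₁ := ⟨_, rfl⟩
  have τf (x) : τ • pt (false, x) = pt (false, x) := by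
    rw [hτ, mul_smul, hT.smul₁_false, htf, add_zero]
  have τt (x) : τ • pt (true, x) = pt (true, -x) := by
    rw [hτ, mul_smul, hT.smul₁_true, htt]; congr 2; ring
  have hττ : τ⁻¹ = τ := inv_eq_of_mul_eq_one_right
    (hext (fun x => by rw [mul_smul, τf, τf, one_smul])
      fun x => by rw [mul_smul, τt, τt, neg_neg, one_smul])
  have hτt (k l) : τ * t k l = t k (-l) * τ := hext
    (fun x => by rw [mul_smul, mul_smul, htf, τf, τf, htf])
    fun x => by rw [mul_smul, mul_smul, htt, τt, τt, htt]; congr 2; ring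
  have hr₀t (k l) : r₀ * t k l = t l k * r₀ := hext
    (fun x => by rw [mul_smul, mul_smul, htf, hT.smul₀, hT.smul₀, Bool.not_false, htt])
    fun x => by rw [mul_smul, mul_smul, htt, hT.smul₀, hT.smul₀, Bool.not_true, htf]
  have hτr : τ * r₂ = r₀ * τ * r₀ := hext
    (fun x => by
      rw [mul_smul, mul_smul, mul_smul, hT.smul₂, τf, hT.smul₀, Bool.not_false, τt, hT.smul₀]; rfl)
    fun x => by
      rw [mul_smul, mul_smul, mul_smul, hT.smul₂, τt, hT.smul₀, Bool.not_true, τf, hT.smul₀,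
        neg_neg]; rfl
  have τfacet : τ • f = t 0 (-1) • f := by rw [hτ, mul_smul, hB.smul₁_facet]
  have τr₂facet : (τ * r₂) • f = t (-1) 0 • f := by
    rw [hτr, mul_smul, hB.smul₀_facet, mul_smul, τfacet, ← mul_smul, hr₀t, mul_smul, hB.smul₀_facet]
  have r₂facet : r₂ • f = t (-1) (-1) • f := by
    have : r₂ = τ * (τ * r₂) := by
      rw [← mul_assoc]; nth_rw 1 [← hττ]; rw [inv_mul_cancel, one_mul]
    rw [this, mul_smul, τr₂facet, ← mul_smul, hτt, mul_smul, τfacet, ← mul_smul, htadd]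
    congr 2 <;> ring
  -- Up to r₀, which fixes both e and f, an automorphism is a translation times one of four sign
  -- patterns. All four move f by translations, and on e they produce only e and τ • e.
  have hdecomp (g : Aut F) : ∃ k l, ∃ w : Aut F, (w = 1 ∨ w = τ ∨ w = τ * r₂ ∨ w = r₂) ∧
      (g = t k l * w ∨ g * r₀ = t k l * w) := by
    have main (g : Aut F) (k l ε ε' : ZMod b) (hε : ε = 1 ∨ ε = -1) (hε' : ε' = 1 ∨ ε' = -1)
        (h1 : ∀ x, g • pt (false, x) = pt (false, ε * x + k))
        (h2 : ∀ x, g • pt (true, x) = pt (true, ε' * x + l)) :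
        ∃ w : Aut F, (w = 1 ∨ w = τ ∨ w = τ * r₂ ∨ w = r₂) ∧ g = t k l * w := by
      rcases hε with rfl | rfl <;> rcases hε' with rfl | rfl
      · exact ⟨1, by simp, hext (fun x => by rw [h1, mul_one, htf, one_mul])
          fun x => by rw [h2, mul_one, htt, one_mul]⟩
      · exact ⟨τ, by simp, hext (fun x => by rw [h1, mul_smul, τf, htf, one_mul])
          fun x => by rw [h2, mul_smul, τt, htt, neg_one_mul]⟩
      · exact ⟨τ * r₂, by simp, hext
          (fun x => by rw [h1, mul_smul, mul_smul, hT.smul₂, τf, htf, neg_one_mul])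
          fun x => by rw [h2, mul_smul, mul_smul, hT.smul₂, τt, htt, one_mul, neg_neg]⟩
      · exact ⟨r₂, by simp, hext (fun x => by rw [h1, mul_smul, hT.smul₂, htf, neg_one_mul])
          fun x => by rw [h2, mul_smul, hT.smul₂, htt, neg_one_mul]⟩
    obtain ⟨s, k, l, ε, ε', hε, hε', h1, h2⟩ := hT.exists_affine hB g
    cases s
    · obtain ⟨w, hw, hg⟩ := main g k l ε ε' hε hε' h1 h2
      exact ⟨k, l, w, hw, Or.inl hg⟩
    · obtain ⟨w, hw, hg⟩ := main (g * r₀) l k ε' ε hε' hε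
        (fun x => by rw [mul_smul, hT.smul₀]; exact h2 x)
        (fun x => by rw [mul_smul, hT.smul₀]; exact h1 x)
      exact ⟨l, k, w, hw, Or.inr hg⟩
  have hdf (g : Aut F) : ∃ k l, g • f = t k l • f := by
    obtain ⟨k, l, w, hw, hg⟩ := hdecomp g
    have hgf : g • f = t k l • w • f := by
      rcases hg with rfl | hg
      · rw [mul_smul]
      · rw [← mul_smul, ← hg, mul_smul, hB.smul₀_facet]
    rw [hgf]
    rcases hw with rfl | rfl | rfl | rfl
    · exact ⟨k, l, by rw [one_smul]⟩
    · exact ⟨_, _, by rw [τfacet, ← mul_smul, htadd]⟩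
    · exact ⟨_, _, by rw [τr₂facet, ← mul_smul, htadd]⟩
    · exact ⟨_, _, by rw [r₂facet, ← mul_smul, htadd]⟩
  have hde (g : Aut F) : ∃ k l, g • e = t k l • e ∨ g • e = t k l • τ • e := by
    obtain ⟨k, l, w, hw, hg⟩ := hdecomp g
    have hge : g • e = t k l • w • e := by
      rcases hg with rfl | hg
      · rw [mul_smul]
      · rw [← mul_smul, ← hg, mul_smul, hB.smul₀_edge]
    refine ⟨k, l, ?_⟩
    rw [hge]
    rcases hw with rfl | rfl | rfl | rfl
    · left; rw [one_smul]
    · right; rfl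
    · right; rw [mul_smul, hB.smul₂_edge]
    · left; rw [hB.smul₂_edge]
  have i_ve (s m k l) : (pt (s, m)).1 ≤ t k l • e ↔ m = cond s l k := by
    rw [hlet, hvt, hT.vertex_le_base_edge hB hpt]
    cases s <;> simp only [cond_true, cond_false, add_neg_eq_zero]
  have i_vτe (s m k l) : (pt (s, m)).1 ≤ t k l • τ • e ↔ m = cond s l k := by
    rw [hlet, hvt, hle, hττ]
    cases s
    · rw [← coe_smul_vertex, τf, hT.vertex_le_base_edge hB hpt]
      simp only [cond_false, add_neg_eq_zero]
    · rw [← coe_smul_vertex, τt, hT.vertex_le_base_edge hB hpt]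
      simp only [cond_true, neg_eq_zero, add_neg_eq_zero]
  have i_vf (s m k l) : (pt (s, m)).1 ≤ t k l • f ↔ m = cond s l k ∨ m = cond s l k + 1 := by
    rw [hlet, hvt, hT.vertex_le_base_facet hB hpt]
    cases s <;>
      simp only [cond_true, cond_false, add_neg_eq_iff_eq_add, zero_add, add_comm (1 : ZMod b)]
  -- A pair {k, k + 1} determines k because 2 ≠ 0 modulo b.
  have hfinj (k l k' l') (h : t k l • f = t k' l' • f) : k = k' ∧ l = l' := by
    have key (s : Bool) : cond s l k = cond s l' k' := by
      have h1 := (i_vf s (cond s l k) k l).2 (Or.inl rfl)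
      have h3 := (i_vf s (cond s l k + 1) k l).2 (Or.inr rfl)
      rw [h, i_vf] at h1 h3
      rcases h1 with h1 | h1
      · exact h1
      rcases h3 with h3 | h3
      · exact absurd (by linear_combination h3 - h1) h2
      · exact add_right_cancel h3
    exact ⟨key false, key true⟩
  -- The two facets on e are f and r₂ • f, and the latter is a translate of f.
  have i_ef (k l) : e ≤ t k l • f ↔ k = 0 ∧ l = 0 ∨ k = -1 ∧ l = -1 := by
    constructor
    · intro h
      rcases hB.facet_of_edge _ (by rw [rank_smul, hB.rank_facet]) h with h | h
      · left
        exact hfinj _ _ _ _ (by rw [h, ht0, one_smul])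
      · right
        exact hfinj _ _ _ _ (by rw [h, r₂facet])
    · rintro (⟨rfl, rfl⟩ | ⟨rfl, rfl⟩)
      · rw [ht0, one_smul]
        exact hB.edge_le_facet
      · rw [← r₂facet]
        nth_rw 1 [← hB.smul₂_edge]
        exact (smul_le_smul_iff_aut _).2 hB.edge_le_facet
  have i_tef (k l k' l') : t k l • e ≤ t k' l' • f ↔
      k' = k ∧ l' = l ∨ k' + 1 = k ∧ l' + 1 = l := by
    rw [← inv_inv (t k l), ← hle, htinv, ← mul_smul, htadd, i_ef]
    simp only [eq_neg_iff_add_eq_zero]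
    have (x y : ZMod b) : -x + y + 1 = -x + (y + 1) := add_assoc _ _ _
    simp only [this, neg_add_eq_zero]
    rw [eq_comm (a := k), eq_comm (a := l), eq_comm (a := k), eq_comm (a := l)]
  have i_τef (k l k' l') : t k l • τ • e ≤ t k' l' • f ↔
      k' = k ∧ l' + 1 = l ∨ k' + 1 = k ∧ l' = l := by
    have h1 : t k l • τ • e = τ • t k (-l) • e := by
      rw [← mul_smul, ← mul_smul, hτt, neg_neg]
    rw [h1, ← inv_inv τ, ← hle, hττ, ← mul_smul, hτt, mul_smul, τfacet, ← mul_smul, htadd, i_tef]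
    have e1 : -l' + -1 = -l ↔ l' + 1 = l := by
      rw [← neg_add, neg_inj]
    have e2 : -l' + -1 + 1 = -l ↔ l' = l := by
      rw [neg_add_cancel_right, neg_inj]
    rw [e1, e2, add_zero]
  -- The edges e and τ • e have the same end points, so vertices cannot separate them. But only 1
  -- and r₂ fix both v and e, and τ fixes v and differs from both in its action, since 1 ≠ -1.
  have heτ : τ • e ≠ e := by
    intro h
    rcases hB.fix_vertex_edge τ (by rw [← hpt, ← coe_smul_vertex, τf]) h with h | h
    · have h1 := τt 1
      rw [h, one_smul] at h1
      exact ZMod.neg_one_ne_one (congrArg Prod.snd (pt.injective h1)).symm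
    · have h1 := τf 1
      rw [h, hT.smul₂] at h1
      exact ZMod.neg_one_ne_one (congrArg Prod.snd (pt.injective h1))
  have hste (k l k' l') (h : t k l • e = t k' l' • τ • e) : False := by
    have h1 := (i_ve false k k l).2 rfl
    have h3 := (i_ve true l k l).2 rfl
    rw [h, i_vτe] at h1 h3
    simp only [cond_true, cond_false] at h1 h3
    subst h1 h3
    exact heτ (smul_left_cancel _ h).symm
  obtain ⟨bot, hbot, -⟩ := hG.existsUnique_least
  obtain ⟨top, htop, -⟩ := hG.existsUnique_greatest
  let face : Shape b → F := fun m => match m with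
    | .least => bot
    | .greatest => top
    | .vertex s m => (pt (s, m)).1
    -- The translation parameters are the diagonal and antidiagonal coordinates. The offsets by 1
    -- here and below are fixed by the vertex incidences: `t k l • f` has positions k, k + 1 and l,
    -- l + 1, whereas a node has the values `diag` and `diag - 1`.
    | .hor i j => t (i - j) (i + j) • e
    | .vert i j => t (i - j - 1) (i + j) • τ • e
    | .node i j => t (i - j - 1) (i + j - 1) • f
  have hrank (m : Shape b) : rank (face m) = m.rank := by
    cases m
    · exact hbot
    · exact (pt _).2
    · exact (rank_smul _ _).trans hB.rank_edge
    · exact (rank_smul _ _).trans ((rank_smul _ _).trans hB.rank_edge)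
    · exact (rank_smul _ _).trans hB.rank_facet
    · exact htop
  have hsd {i j i' j' : ZMod b} (h1 : i - j = i' - j') (h3 : i + j = i' + j') :
      i = i' ∧ j = j' := by
    exact ⟨htwo (by linear_combination h1 + h3), htwo (by linear_combination h3 - h1)⟩
  have hhalf : ∃ y : ZMod b, 2 * y = 1 := ⟨2⁻¹, mul_inv_cancel₀ h2⟩
  -- Here y is one half, used to solve for i and j from i - j and i + j.
  obtain ⟨y, hy⟩ := hhalf
  refine ⟨face, ⟨?_, ?_, hrank, fun x => hG.le_of_rank_eq_neg_one hbot x,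
    fun x => hG.le_of_rank_eq_three htop x, ?_, ?_, ?_, ?_, ?_⟩⟩
  · intro x
    obtain ⟨hr1, hr3⟩ := hG.rank_mem x
    obtain h | h | h | h | h :
        rank x = -1 ∨ rank x = 0 ∨ rank x = 1 ∨ rank x = 2 ∨ rank x = 3 := by omega
    · exact ⟨.least, hG.existsUnique_least.unique hbot h⟩
    · obtain ⟨⟨s, m⟩, hm⟩ := pt.surjective ⟨x, h⟩
      exact ⟨.vertex s m, congrArg Subtype.val hm⟩
    · obtain ⟨g, rfl⟩ := hB.exists_edge x h
      obtain ⟨k, l, hkl | hkl⟩ := hde g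
      · refine ⟨.hor (y * (k + l)) (y * (l - k)), ?_⟩
        rw [hkl]
        change t _ _ • e = _
        congr 2
        · linear_combination k * hy
        · linear_combination l * hy
      · refine ⟨.vert (y * (k + l + 1)) (y * (l - k - 1)), ?_⟩
        rw [hkl]
        change t _ _ • τ • e = _
        congr 2
        · linear_combination (k + 1) * hy
        · linear_combination l * hy
    · obtain ⟨g, rfl⟩ := hB.exists_facet x h
      obtain ⟨k, l, hkl⟩ := hdf g
      refine ⟨.node (y * (k + l + 2)) (y * (l - k)), ?_⟩
      rw [hkl]
      change t _ _ • f = _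
      congr 2
      · linear_combination (k + 1) * hy
      · linear_combination (l + 1) * hy
    · exact ⟨.greatest, hG.existsUnique_greatest.unique htop h⟩
  · intro m n h
    have hmn : m.rank = n.rank := by rw [← hrank, ← hrank, h]
    cases m <;> cases n <;> simp only [Shape.rank] at hmn <;> try omega
    · rfl
    · rename_i s m s' m'
      have := pt.injective (Subtype.ext h)
      simp only [Prod.mk.injEq] at this
      rw [this.1, this.2]
    · rename_i i j i' j'
      have h1 := (i_ve false (i - j) (i - j) (i + j)).2 rfl
      have h3 := (i_ve true (i + j) (i - j) (i + j)).2 rfl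
      change t _ _ • e = t _ _ • e at h
      rw [h, i_ve] at h1 h3
      obtain ⟨rfl, rfl⟩ := hsd h1 h3
      rfl
    · exact (hste _ _ _ _ h).elim
    · exact (hste _ _ _ _ h.symm).elim
    · rename_i i j i' j'
      have h1 := (i_vτe false (i - j - 1) (i - j - 1) (i + j)).2 rfl
      have h3 := (i_vτe true (i + j) (i - j - 1) (i + j)).2 rfl
      change t _ _ • τ • e = t _ _ • τ • e at h
      rw [h, i_vτe] at h1 h3
      obtain ⟨rfl, rfl⟩ := hsd (sub_left_injective h1) h3
      rfl
    · rename_i i j i' j'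
      obtain ⟨h1, h3⟩ := hfinj _ _ _ _ h
      obtain ⟨rfl, rfl⟩ := hsd (sub_left_injective h1) (sub_left_injective h3)
      rfl
    · rfl
  · intro s m i j
    rw [Shape.diag]
    exact i_ve _ _ _ _
  · intro s m i j
    exact i_vτe _ _ _ _
  · intro s m i j
    refine (i_vf _ _ _ _).trans ?_
    cases s <;> simp only [Shape.diag, cond_true, cond_false, sub_add_cancel]
    · rw [eq_sub_iff_add_eq, eq_comm, or_comm, eq_comm (a := m)]
    · rw [eq_sub_iff_add_eq, eq_comm, or_comm, eq_comm (a := m)]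
  · intro i j i' j'
    refine (i_tef _ _ _ _).trans ?_
    constructor
    · rintro (⟨h1, h3⟩ | ⟨h1, h3⟩)
      · obtain ⟨h4, h5⟩ := hsd (i := i') (j := j') (i' := i + 1) (j' := j)
          (by linear_combination h1) (by linear_combination h3)
        exact ⟨h5, Or.inr h4⟩
      · obtain ⟨h4, h5⟩ := hsd (i := i') (j := j') (i' := i) (j' := j)
          (by linear_combination h1) (by linear_combination h3)
        exact ⟨h5, Or.inl h4⟩
    · rintro ⟨rfl, rfl | rfl⟩
      · right; constructor <;> ring
      · left; constructor <;> ring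
  · intro i j i' j'
    refine (i_τef _ _ _ _).trans ?_
    constructor
    · rintro (⟨h1, h3⟩ | ⟨h1, h3⟩)
      · obtain ⟨h4, h5⟩ := hsd (i := i') (j := j') (i' := i) (j' := j)
          (by linear_combination h1) (by linear_combination h3)
        exact ⟨h4, Or.inl h5⟩
      · obtain ⟨h4, h5⟩ := hsd (i := i') (j := j') (i' := i) (j' := j + 1)
          (by linear_combination h1) (by linear_combination h3)
        exact ⟨h4, Or.inr h5⟩
    · rintro ⟨rfl, rfl | rfl⟩
      · left; constructor <;> ring
      · right; constructor <;> ring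

end ToroidalModel

end AbsPoly

namespace AbsPoly

open RankedPoset CircleCell

/-! ### Faces and flags of the toroidal map. -/

section Torus

variable {b : ℕ}

/-- A cell of the torus as a face of its face poset. -/
def cell (x y : CircleCell b) : TorusMap b :=
  WithBot.some (WithTop.some (x, y))

theorem rank_cell (x y : CircleCell b) : rank (cell x y) = x.dim + y.dim := rfl

theorem rank_bot_withImproper {X : Type*} [CellPoset X] : rank (⊥ : WithImproper X) = -1 := rfl

theorem rank_top_withImproper {X : Type*} [CellPoset X] : rank (⊤ : WithImproper X) = 3 := rfl

theorem cell_le_cell {x y x' y' : CircleCell b} :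
    cell x y ≤ cell x' y' ↔ x.Le x' ∧ y.Le y' := by
  unfold cell
  rw [WithBot.coe_le_coe, WithTop.coe_le_coe]
  exact Iff.rfl

theorem cell_inj {x y x' y' : CircleCell b} : cell x y = cell x' y' ↔ x = x' ∧ y = y' := by
  unfold cell
  rw [WithBot.coe_inj, WithTop.coe_inj, Prod.mk.injEq]

theorem torusMap_cases (x : TorusMap b) : x = ⊥ ∨ x = ⊤ ∨ ∃ c d, x = cell c d := by
  induction x using WithBot.recBotCoe with
  | bot => exact Or.inl rfl
  | coe x =>
    induction x using WithTop.recTopCoe with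
    | top => exact Or.inr (Or.inl rfl)
    | coe x => exact Or.inr (Or.inr ⟨x.1, x.2, rfl⟩)

theorem exists_of_rank_eq_zero {x : TorusMap b} (hx : rank x = 0) :
    ∃ i j, x = cell (node i) (node j) := by
  rcases torusMap_cases x with rfl | rfl | ⟨_ | _, _ | _, rfl⟩ <;>
    simp [rank_bot_withImproper, rank_top_withImproper, rank_cell, CircleCell.dim] at hx
  exact ⟨_, _, rfl⟩

theorem exists_of_rank_eq_one {x : TorusMap b} (hx : rank x = 1) :
    (∃ i j, x = cell (side i) (node j)) ∨ ∃ i j, x = cell (node i) (side j) := by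
  rcases torusMap_cases x with rfl | rfl | ⟨_ | _, _ | _, rfl⟩ <;>
    simp [rank_bot_withImproper, rank_top_withImproper, rank_cell, CircleCell.dim] at hx
  exacts [Or.inr ⟨_, _, rfl⟩, Or.inl ⟨_, _, rfl⟩]

theorem exists_of_rank_eq_two {x : TorusMap b} (hx : rank x = 2) :
    ∃ i j, x = cell (side i) (side j) := by
  rcases torusMap_cases x with rfl | rfl | ⟨_ | _, _ | _, rfl⟩ <;>
    simp [rank_bot_withImproper, rank_top_withImproper, rank_cell, CircleCell.dim] at hx
  exact ⟨_, _, rfl⟩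

theorem rank_mem_withImproper {X : Type*} [CellPoset X] (x : WithImproper X) :
    rank x ∈ Set.Icc (-1 : ℤ) 3 := by
  induction x using WithBot.recBotCoe with
  | bot => rw [rank_bot_withImproper]; simp
  | coe x =>
    induction x using WithTop.recTopCoe with
    | top => change rank (⊤ : WithImproper X) ∈ _; rw [rank_top_withImproper]; simp
    | coe x =>
      have := CellPoset.dim_mem x
      change CellPoset.dim x ∈ _
      simp only [Set.mem_Icc] at this ⊢
      omega

theorem eq_bot_of_rank {X : Type*} [CellPoset X] {x : WithImproper X} (hx : rank x = -1) :
    x = ⊥ := by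
  by_contra h
  have := rank_strictMono (bot_lt_iff_ne_bot.2 h)
  rw [hx, rank_bot_withImproper] at this
  omega

theorem eq_top_of_rank {X : Type*} [CellPoset X] {x : WithImproper X} (hx : rank x = 3) :
    x = ⊤ := by
  by_contra h
  have := rank_strictMono (lt_top_iff_ne_top.2 h)
  rw [hx, rank_top_withImproper] at this
  omega

theorem exists_vertex_le (x : TorusMap b) (hx : 0 ≤ rank x) : ∃ y ≤ x, rank y = 0 := by
  have h0 : rank (cell (node (0 : ZMod b)) (node 0)) = 0 := rfl
  rcases torusMap_cases x with rfl | rfl | ⟨i | i, j | j, rfl⟩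
  · rw [rank_bot_withImproper] at hx; omega
  · exact ⟨_, le_top, h0⟩
  all_goals exact ⟨cell (node i) (node j), cell_le_cell.2 (by simp [Le]), rfl⟩

theorem exists_facet_ge (x : TorusMap b) (hx : rank x ≤ 2) : ∃ y, x ≤ y ∧ rank y = 2 := by
  have h0 : rank (cell (side (0 : ZMod b)) (side 0)) = 2 := rfl
  rcases torusMap_cases x with rfl | rfl | ⟨i | i, j | j, rfl⟩
  · exact ⟨_, bot_le, h0⟩
  · rw [rank_top_withImproper] at hx; omega
  all_goals exact ⟨cell (side i) (side j), cell_le_cell.2 (by simp [Le]), rfl⟩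

theorem exists_edge_between {x y : TorusMap b} (hx : rank x = 0) (hy : rank y = 2) (h : x ≤ y) :
    ∃ z, x ≤ z ∧ z ≤ y ∧ rank z = 1 := by
  obtain ⟨i, j, rfl⟩ := exists_of_rank_eq_zero hx
  obtain ⟨k, l, rfl⟩ := exists_of_rank_eq_two hy
  rw [cell_le_cell] at h
  exact ⟨cell (side k) (node j), cell_le_cell.2 ⟨h.1, by simp [Le]⟩,
    cell_le_cell.2 ⟨by simp [Le], h.2⟩, rfl⟩

/-- A vertex below the lowest face of nonnegative rank in the chain is comparable to the whole
chain, so it belongs to it by maximality. -/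
theorem exists_mem_flag_rank_zero (Φ : Flag (TorusMap b)) : ∃ x ∈ Φ, rank x = 0 := by
  classical
  have hex : ∃ n : ℕ, ∃ y ∈ Φ, rank y = n := ⟨3, ⊤, Φ.top_mem, rfl⟩
  obtain ⟨y, hy, hyr⟩ := Nat.find_spec hex
  have hmin : ∀ z ∈ Φ, 0 ≤ rank z → rank y ≤ rank z := fun z hz h0 => by
    have := Nat.find_min' hex ⟨z, hz, (Int.toNat_of_nonneg h0).symm⟩
    omega
  obtain ⟨x, hxy, hxr⟩ := exists_vertex_le y (by omega)
  refine ⟨x, Flag.mem_iff_forall_le_or_ge.2 fun z hz => ?_, hxr⟩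
  have hzr := (rank_mem_withImproper z).1
  rcases eq_or_lt_of_le hzr with h | h
  · exact Or.inr (eq_bot_of_rank h.symm ▸ bot_le)
  · exact Or.inl (hxy.trans (le_of_mem_flag hy hz (hmin z hz (by omega))))

theorem exists_mem_flag_rank_two (Φ : Flag (TorusMap b)) : ∃ x ∈ Φ, rank x = 2 := by
  classical
  -- Counting down from 2 makes the least n select the highest face of rank at most 2.
  have hex : ∃ n : ℕ, ∃ y ∈ Φ, rank y = 2 - n := ⟨3, ⊥, Φ.bot_mem, rfl⟩
  obtain ⟨y, hy, hyr⟩ := Nat.find_spec hex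
  have hmax : ∀ z ∈ Φ, rank z ≤ 2 → rank z ≤ rank y := fun z hz h0 => by
    have := Nat.find_min' hex ⟨z, hz, show rank z = 2 - ((2 - rank z).toNat : ℤ) by omega⟩
    omega
  obtain ⟨x, hxy, hxr⟩ := exists_facet_ge y (by omega)
  refine ⟨x, Flag.mem_iff_forall_le_or_ge.2 fun z hz => ?_, hxr⟩
  have hzr := (rank_mem_withImproper z).2
  rcases eq_or_lt_of_le hzr with h | h
  · exact Or.inl (eq_top_of_rank h ▸ le_top)
  · exact Or.inr ((le_of_mem_flag hz hy (hmax z hz (by omega))).trans hxy)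

theorem exists_mem_flag_rank_one (Φ : Flag (TorusMap b)) : ∃ x ∈ Φ, rank x = 1 := by
  by_contra! H
  obtain ⟨v, hv, hvr⟩ := exists_mem_flag_rank_zero Φ
  obtain ⟨f, hf, hfr⟩ := exists_mem_flag_rank_two Φ
  obtain ⟨e, hve, hef, her⟩ := exists_edge_between hvr hfr (le_of_mem_flag hv hf (by omega))
  refine H e (Flag.mem_iff_forall_le_or_ge.2 fun z hz => ?_) her
  have := H z hz
  rcases lt_or_gt_of_ne this with h | h
  · exact Or.inr ((le_of_mem_flag hz hv (by omega)).trans hve)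
  · exact Or.inl (hef.trans (le_of_mem_flag hf hz (by omega)))

theorem isGraded_torusMap (b : ℕ) : IsGraded (TorusMap b) where
  rank_mem := rank_mem_withImproper
  existsUnique_least := ⟨⊥, rfl, fun _ h => eq_bot_of_rank h⟩
  existsUnique_greatest := ⟨⊤, rfl, fun _ h => eq_top_of_rank h⟩
  existsUnique_mem_flag Φ i hi := by
    have hex : ∃ x ∈ Φ, rank x = i := by
      obtain ⟨h1, h2⟩ := hi
      obtain rfl | rfl | rfl | rfl | rfl : i = -1 ∨ i = 0 ∨ i = 1 ∨ i = 2 ∨ i = 3 := by omega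
      exacts [⟨⊥, Φ.bot_mem, rfl⟩, exists_mem_flag_rank_zero Φ, exists_mem_flag_rank_one Φ,
        exists_mem_flag_rank_two Φ, ⟨⊤, Φ.top_mem, rfl⟩]
    obtain ⟨x, hx, hr⟩ := hex
    exact ⟨x, ⟨hx, hr⟩, fun y hy => eq_of_mem_flag hy.1 hx (hy.2.trans hr.symm)⟩

/-! ### Flags of the torus in coordinates. -/

/-- Coordinates of a flag of the torus: the position of its square, the corner of the square that
is its vertex, and the direction of its edge. -/
@[ext]
structure FlagCoord (b : ℕ) where
  i : ZMod b
  j : ZMod b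
  s : Bool
  t : Bool
  horizontal : Bool

/-- The displacement of a corner of a square. -/
def bit (b : ℕ) (s : Bool) : ZMod b := cond s 1 0

namespace FlagCoord

/-- The vertex of a flag. -/
def vertex (q : FlagCoord b) : TorusMap b := cell (node (q.i + bit b q.s)) (node (q.j + bit b q.t))

/-- The edge of a flag. -/
def edge (q : FlagCoord b) : TorusMap b :=
  cond q.horizontal (cell (side q.i) (node (q.j + bit b q.t)))
    (cell (node (q.i + bit b q.s)) (side q.j))

/-- The facet of a flag. -/
def facet (q : FlagCoord b) : TorusMap b := cell (side q.i) (side q.j)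

theorem node_le_side (i : ZMod b) (s : Bool) : (node (i + bit b s)).Le (side i) := by
  cases s <;> simp [Le, bit]

theorem vertex_le_edge (q : FlagCoord b) : q.vertex ≤ q.edge := by
  obtain ⟨i, j, s, t, _ | _⟩ := q
  · exact cell_le_cell.2 ⟨rfl, node_le_side j t⟩
  · exact cell_le_cell.2 ⟨node_le_side i s, rfl⟩

theorem edge_le_facet (q : FlagCoord b) : q.edge ≤ q.facet := by
  obtain ⟨i, j, s, t, _ | _⟩ := q
  · exact cell_le_cell.2 ⟨node_le_side i s, rfl⟩
  · exact cell_le_cell.2 ⟨rfl, node_le_side j t⟩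

theorem rank_vertex (q : FlagCoord b) : rank q.vertex = 0 := rfl

theorem rank_edge (q : FlagCoord b) : rank q.edge = 1 := by
  obtain ⟨i, j, s, t, _ | _⟩ := q <;> rfl

theorem rank_facet (q : FlagCoord b) : rank q.facet = 2 := rfl

/-- The flag with given coordinates. -/
noncomputable def flag (q : FlagCoord b) : Flag (TorusMap b) :=
  (exists_flag_of_le_of_le q.vertex_le_edge q.edge_le_facet).choose

theorem vertex_mem (q : FlagCoord b) : q.vertex ∈ q.flag :=
  (exists_flag_of_le_of_le q.vertex_le_edge q.edge_le_facet).choose_spec.1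

theorem edge_mem (q : FlagCoord b) : q.edge ∈ q.flag :=
  (exists_flag_of_le_of_le q.vertex_le_edge q.edge_le_facet).choose_spec.2.1

theorem facet_mem (q : FlagCoord b) : q.facet ∈ q.flag :=
  (exists_flag_of_le_of_le q.vertex_le_edge q.edge_le_facet).choose_spec.2.2

theorem vertex_mem_iff {q q' : FlagCoord b} : q.vertex ∈ q'.flag ↔ q.vertex = q'.vertex :=
  ⟨fun h => eq_of_mem_flag h q'.vertex_mem rfl, fun h => h ▸ q'.vertex_mem⟩

theorem edge_mem_iff {q q' : FlagCoord b} : q.edge ∈ q'.flag ↔ q.edge = q'.edge :=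
  ⟨fun h => eq_of_mem_flag h q'.edge_mem (by rw [rank_edge, rank_edge]), fun h => h ▸ q'.edge_mem⟩

theorem facet_mem_iff {q q' : FlagCoord b} : q.facet ∈ q'.flag ↔ q.facet = q'.facet :=
  ⟨fun h => eq_of_mem_flag h q'.facet_mem rfl, fun h => h ▸ q'.facet_mem⟩

theorem exists_bit {i k : ZMod b} (h : (node k).Le (side i)) : ∃ s, k = i + bit b s := by
  rcases h with h | h
  · exact ⟨false, by simp [h, bit]⟩
  · exact ⟨true, by simp [h, bit]⟩

theorem exists_eq_flag (Φ : Flag (TorusMap b)) : ∃ q : FlagCoord b, Φ = q.flag := by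
  obtain ⟨v, hv, hvr⟩ := exists_mem_flag_rank_zero Φ
  obtain ⟨e, he, her⟩ := exists_mem_flag_rank_one Φ
  obtain ⟨f, hf, hfr⟩ := exists_mem_flag_rank_two Φ
  have hve := le_of_mem_flag hv he (by omega)
  have hef := le_of_mem_flag he hf (by omega)
  have key : ∃ q : FlagCoord b, v = q.vertex ∧ e = q.edge ∧ f = q.facet := by
    obtain ⟨x, y, rfl⟩ := exists_of_rank_eq_zero hvr
    obtain ⟨i, j, rfl⟩ := exists_of_rank_eq_two hfr
    rcases exists_of_rank_eq_one her with ⟨k, l, rfl⟩ | ⟨k, l, rfl⟩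
    · obtain ⟨h1, h2⟩ := cell_le_cell.1 hve
      obtain ⟨h3, h4⟩ := cell_le_cell.1 hef
      obtain rfl : k = i := h3
      obtain rfl : y = l := h2
      obtain ⟨s, rfl⟩ := exists_bit h1
      obtain ⟨t, rfl⟩ := exists_bit h4
      exact ⟨⟨k, j, s, t, true⟩, rfl, rfl, rfl⟩
    · obtain ⟨h1, h2⟩ := cell_le_cell.1 hve
      obtain ⟨h3, h4⟩ := cell_le_cell.1 hef
      obtain rfl : l = j := h4
      obtain rfl : x = k := h1
      obtain ⟨s, rfl⟩ := exists_bit h3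
      obtain ⟨t, rfl⟩ := exists_bit h2
      exact ⟨⟨i, l, s, t, false⟩, rfl, rfl, rfl⟩
  obtain ⟨q, rfl, rfl, rfl⟩ := key
  exact ⟨q, (isGraded_torusMap b).flag_eq hvr her hfr hv he hf q.vertex_mem q.edge_mem q.facet_mem⟩

theorem vertex_eq_iff {q q' : FlagCoord b} : q.vertex = q'.vertex ↔
    q.i + bit b q.s = q'.i + bit b q'.s ∧ q.j + bit b q.t = q'.j + bit b q'.t := by
  simp only [vertex, cell_inj, node.injEq]

theorem facet_eq_iff {q q' : FlagCoord b} : q.facet = q'.facet ↔ q.i = q'.i ∧ q.j = q'.j := by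
  simp only [facet, cell_inj, side.injEq]

theorem edge_eq_iff {q q' : FlagCoord b} : q.edge = q'.edge ↔
    q.horizontal = q'.horizontal ∧ cond q.horizontal
      (q.i = q'.i ∧ q.j + bit b q.t = q'.j + bit b q'.t)
      (q.i + bit b q.s = q'.i + bit b q'.s ∧ q.j = q'.j) := by
  obtain ⟨i, j, s, t, _ | _⟩ := q <;> obtain ⟨i', j', s', t', _ | _⟩ := q' <;>
    simp [edge, cell_inj]

/-- Change the vertex of a flag. -/
def flip₀ (q : FlagCoord b) : FlagCoord b :=
  cond q.horizontal ⟨q.i, q.j, !q.s, q.t, q.horizontal⟩ ⟨q.i, q.j, q.s, !q.t, q.horizontal⟩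

/-- Change the edge of a flag. -/
def flip₁ (q : FlagCoord b) : FlagCoord b := ⟨q.i, q.j, q.s, q.t, !q.horizontal⟩

/-- Change the facet of a flag. -/
def flip₂ (q : FlagCoord b) : FlagCoord b :=
  -- The square moves across the edge and the corner label flips, so that the vertex keeps its
  -- absolute position.
  cond q.horizontal ⟨q.i, q.j + bit b q.t - bit b (!q.t), q.s, !q.t, q.horizontal⟩
    ⟨q.i + bit b q.s - bit b (!q.s), q.j, !q.s, q.t, q.horizontal⟩

variable [Fact (1 < b)]

theorem bit_inj {s t : Bool} : bit b s = bit b t ↔ s = t := by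
  cases s <;> cases t <;> simp [bit]

theorem flag_injective : Function.Injective (flag (b := b)) := by
  intro q q' h
  have h1 := vertex_eq_iff.1 (vertex_mem_iff.1 (h ▸ q.vertex_mem))
  have h2 := edge_eq_iff.1 (edge_mem_iff.1 (h ▸ q.edge_mem))
  have h3 := facet_eq_iff.1 (facet_mem_iff.1 (h ▸ q.facet_mem))
  rw [h3.1, h3.2, add_right_inj, add_right_inj, bit_inj, bit_inj] at h1
  exact FlagCoord.ext h3.1 h3.2 h1.1 h1.2 h2.1

theorem adjacentAt_zero {q q' : FlagCoord b} (h : AdjacentAt 0 q.flag q'.flag) :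
    q' = q.flip₀ := by
  have h1 : q.vertex ≠ q'.vertex :=
    (isGraded_torusMap b).ne_of_adjacentAt h q.vertex_mem q'.vertex_mem rfl
  have h2 := edge_eq_iff.1 (edge_mem_iff.1 ((h.2 _ (by rw [rank_edge]; norm_num)).1 q.edge_mem))
  have h3 := facet_eq_iff.1 (facet_mem_iff.1 ((h.2 _ (by rw [rank_facet]; norm_num)).1 q.facet_mem))
  rw [Ne, vertex_eq_iff] at h1
  obtain ⟨i, j, s, t, d⟩ := q
  obtain ⟨i', j', s', t', d'⟩ := q'
  dsimp only at h1 h2 h3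
  obtain ⟨rfl, rfl⟩ := h3
  obtain ⟨rfl, h2⟩ := h2
  simp only [add_right_inj, bit_inj] at h1 h2
  cases d <;> cases s <;> cases t <;> cases s' <;> cases t' <;> simp [flip₀] at h1 h2 ⊢

theorem adjacentAt_two {q q' : FlagCoord b} (h : AdjacentAt 2 q.flag q'.flag) :
    q' = q.flip₂ := by
  have h1 : q.facet ≠ q'.facet :=
    (isGraded_torusMap b).ne_of_adjacentAt h q.facet_mem q'.facet_mem rfl
  have h2 := edge_eq_iff.1 (edge_mem_iff.1 ((h.2 _ (by rw [rank_edge]; norm_num)).1 q.edge_mem))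
  have h3 := vertex_eq_iff.1
    (vertex_mem_iff.1 ((h.2 _ (by rw [rank_vertex]; norm_num)).1 q.vertex_mem))
  rw [Ne, facet_eq_iff] at h1
  obtain ⟨i, j, s, t, d⟩ := q
  obtain ⟨i', j', s', t', d'⟩ := q'
  dsimp only at h1 h2 h3
  obtain ⟨rfl, h2⟩ := h2
  cases d
  · simp only [cond_false] at h2
    obtain ⟨h4, rfl⟩ := h2
    have ht := h3.2
    rw [add_right_inj, bit_inj] at ht
    subst ht
    have hs : s' = !s := by
      rw [Bool.eq_not]
      rintro rfl
      exact h1 ⟨add_right_cancel h4, rfl⟩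
    subst hs
    simp only [flip₂, cond_false, FlagCoord.mk.injEq, and_true]
    rw [h4, add_sub_cancel_right]
  · simp only [cond_true] at h2
    obtain ⟨rfl, h4⟩ := h2
    have hs := h3.1
    rw [add_right_inj, bit_inj] at hs
    subst hs
    have ht : t' = !t := by
      rw [Bool.eq_not]
      rintro rfl
      exact h1 ⟨rfl, add_right_cancel h4⟩
    subst ht
    simp only [flip₂, cond_true, FlagCoord.mk.injEq, and_true, true_and]
    rw [h4, add_sub_cancel_right]

omit [Fact (1 < b)] in
theorem mem_flag_of_ne {q q' : FlagCoord b} {x : TorusMap b} (hx : x ∈ q.flag) (i : ℤ)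
    (hxi : rank x ≠ i)
    (h0 : i ≠ 0 → q.vertex = q'.vertex) (h1 : i ≠ 1 → q.edge = q'.edge)
    (h2 : i ≠ 2 → q.facet = q'.facet) : x ∈ q'.flag := by
  obtain ⟨h3, h4⟩ := rank_mem_withImproper x
  obtain h | h | h | h | h : rank x = -1 ∨ rank x = 0 ∨ rank x = 1 ∨ rank x = 2 ∨ rank x = 3 := by
    omega
  · rw [eq_bot_of_rank h]; exact Flag.bot_mem _
  · rw [eq_of_mem_flag hx q.vertex_mem h, h0 (by omega)]; exact q'.vertex_mem
  · rw [eq_of_mem_flag hx q.edge_mem (h.trans q.rank_edge.symm), h1 (by omega)]; exact q'.edge_mem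
  · rw [eq_of_mem_flag hx q.facet_mem h, h2 (by omega)]; exact q'.facet_mem
  · rw [eq_top_of_rank h]; exact Flag.top_mem _

theorem adjacentAt_flip₀ (q : FlagCoord b) : AdjacentAt 0 q.flag q.flip₀.flag := by
  refine (isGraded_torusMap b).adjacentAt_of_ne (fun x hx hxr => mem_flag_of_ne hx 0 hxr (by simp)
    (fun _ => ?_) fun _ => ?_) q.vertex_mem ?_
  · obtain ⟨i, j, s, t, _ | _⟩ := q <;> simp [edge_eq_iff, flip₀]
  · obtain ⟨i, j, s, t, _ | _⟩ := q <;> simp [facet_eq_iff, flip₀]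
  · rw [vertex_mem_iff, vertex_eq_iff]
    obtain ⟨i, j, s, t, _ | _⟩ := q <;> simp [flip₀, bit_inj]

omit [Fact (1 < b)] in
theorem adjacentAt_flip₁ (q : FlagCoord b) : AdjacentAt 1 q.flag q.flip₁.flag := by
  refine (isGraded_torusMap b).adjacentAt_of_ne (fun x hx hxr => mem_flag_of_ne hx 1 hxr
    (fun _ => ?_) (by simp) fun _ => ?_) q.edge_mem ?_
  · simp [vertex_eq_iff, flip₁]
  · simp [facet_eq_iff, flip₁]
  · simp [edge_mem_iff, edge_eq_iff, flip₁]

theorem adjacentAt_flip₂ (q : FlagCoord b) : AdjacentAt 2 q.flag q.flip₂.flag := by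
  refine (isGraded_torusMap b).adjacentAt_of_ne (fun x hx hxr => mem_flag_of_ne hx 2 hxr
    (fun _ => ?_) (fun _ => ?_) (by simp)) q.facet_mem ?_
  · obtain ⟨i, j, s, t, _ | _⟩ := q <;> simp [vertex_eq_iff, flip₂]
  · obtain ⟨i, j, s, t, _ | _⟩ := q <;> simp [edge_eq_iff, flip₂]
  · rw [facet_mem_iff, facet_eq_iff]
    obtain ⟨i, j, s, t, _ | _⟩ := q <;> cases s <;> cases t <;>
      simp [flip₂, bit, eq_sub_iff_add_eq]

/-- The direction and the position of the Petrie polygon that contains a flag. -/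
def zigzag (q : FlagCoord b) : Bool × ZMod b :=
  -- The polygon turns at the corner of the flag inside its square: at the corners with equal labels
  -- it runs along an antidiagonal, at the other two along a diagonal. The number is `diag` of the
  -- horizontal edge at that corner.
  if q.s = q.t then (true, q.i + q.j + bit b q.s) else (false, q.i - q.j - bit b q.t)

omit [Fact (1 < b)] in
theorem zigzag_flip (q : FlagCoord b) : q.flip₀.flip₂.zigzag = q.zigzag := by
  obtain ⟨i, j, s, t, _ | _⟩ := q <;> cases s <;> cases t <;>
    simp [flip₀, flip₂, zigzag, bit] <;> ring

theorem zigzag_eq_of_petrieStep {q q' : FlagCoord b} (h : PetrieStep _ q.flag q'.flag) :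
    q.zigzag = q'.zigzag := by
  rcases h with h | ⟨Θ, h, h'⟩
  · have h1 := vertex_eq_iff.1
      (vertex_mem_iff.1 ((h.2 _ (by rw [rank_vertex]; norm_num)).1 q.vertex_mem))
    have h3 := facet_eq_iff.1
      (facet_mem_iff.1 ((h.2 _ (by rw [rank_facet]; norm_num)).1 q.facet_mem))
    rw [h3.1, h3.2, add_right_inj, add_right_inj, bit_inj, bit_inj] at h1
    rw [zigzag, zigzag, h1.1, h1.2, h3.1, h3.2]
  · obtain ⟨p, rfl⟩ := exists_eq_flag Θ
    rw [adjacentAt_two h', adjacentAt_zero h, zigzag_flip]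

end FlagCoord

/-! ### Petrie polygons of the torus. -/

open FlagCoord

variable [Fact (1 < b)]

/-- The direction and the position of a Petrie polygon. -/
noncomputable def PetriePolygon.zigzag (C : PetriePolygon (TorusMap b)) : Bool × ZMod b :=
  Quot.lift (fun Φ => (exists_eq_flag Φ).choose.zigzag) (fun Φ Ψ h => zigzag_eq_of_petrieStep (by
    rwa [← (exists_eq_flag Φ).choose_spec, ← (exists_eq_flag Ψ).choose_spec])) C

theorem PetriePolygon.zigzag_mk (q : FlagCoord b) :
    PetriePolygon.zigzag (Quot.mk _ q.flag) = q.zigzag :=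
  congrArg FlagCoord.zigzag (flag_injective (exists_eq_flag q.flag).choose_spec.symm)

/-- The Petrie polygon with given direction and position. -/
noncomputable def zigzagPolygon (s : Bool) (m : ZMod b) : PetriePolygon (TorusMap b) :=
  Quot.mk _ (FlagCoord.mk m 0 (!s) false true).flag

theorem zigzag_zigzagPolygon (s : Bool) (m : ZMod b) : (zigzagPolygon s m).zigzag = (s, m) := by
  rw [zigzagPolygon, PetriePolygon.zigzag_mk]
  cases s <;> simp [FlagCoord.zigzag, bit]

/-- Crossing a vertical and a horizontal edge in turn moves the square one step along its diagonal
or antidiagonal within the same polygon. Repeating this brings the square to row 0, where only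
direction and position are left. -/
theorem mk_flag_eq (q : FlagCoord b) : (Quot.mk _ q.flag : PetriePolygon (TorusMap b)) =
    zigzagPolygon q.zigzag.1 q.zigzag.2 := by
  have h1 (q : FlagCoord b) : (Quot.mk _ q.flag : PetriePolygon (TorusMap b)) =
      Quot.mk _ q.flip₁.flag := Quot.sound (Or.inl q.adjacentAt_flip₁)
  have h2 (q : FlagCoord b) : (Quot.mk _ q.flag : PetriePolygon (TorusMap b)) =
      Quot.mk _ q.flip₀.flip₂.flag :=
    Quot.sound (Or.inr ⟨_, q.adjacentAt_flip₀, q.flip₀.adjacentAt_flip₂⟩)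
  let M : ZMod b → ZMod b → Bool → Bool → PetriePolygon (TorusMap b) := fun i j s t =>
    Quot.mk _ (FlagCoord.mk i j s t true).flag
  have hM (q : FlagCoord b) : (Quot.mk _ q.flag : PetriePolygon (TorusMap b)) =
      M q.i q.j q.s q.t := by
    obtain ⟨i, j, s, t, _ | _⟩ := q
    · exact h1 _
    · rfl
  have hMt (i j s t) : M i j s t = M i (j + bit b t - bit b (!t)) (!s) (!t) :=
    (h2 ⟨i, j, s, t, true⟩).trans (hM _)
  have hMs (i j s t) : M i j s t = M (i + bit b s - bit b (!s)) j (!s) (!t) :=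
    (hM ⟨i, j, s, t, false⟩).symm.trans ((h2 _).trans (hM _))
  have hd (i j) : M (i + 1) (j + 1) true false = M i j true false := by
    rw [hMt, hMs]; simp [bit]
  have ha (i j) : M i (j + 1) false false = M (i + 1) j false false := by
    rw [hMt, hMs]; simp [bit]
  have hdn (n : ℕ) (i) : M (i + n) n true false = M i 0 true false := by
    induction n with
    | zero => simp
    | succ n ih => rw [← ih, ← hd (i + n) n]; push_cast; rw [add_assoc]
  have han (n : ℕ) (i) : M i n false false = M (i + n) 0 false false := by
    induction n generalizing i with
    | zero => simp
    | succ n ih => push_cast; rw [ha, ih]; congr 1; ring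
  have : NeZero b := ⟨by have := Fact.out (p := 1 < b); omega⟩
  have hD (i j) : M i j true false = zigzagPolygon false (i - j) := by
    obtain ⟨n, rfl⟩ := ZMod.natCast_zmod_surjective j
    have := hdn n (i - n)
    rwa [sub_add_cancel] at this
  have hA (i j) : M i j false false = zigzagPolygon true (i + j) := by
    obtain ⟨n, rfl⟩ := ZMod.natCast_zmod_surjective j
    exact han n i
  rw [hM]
  obtain ⟨i, j, s, t, d⟩ := q
  dsimp only [FlagCoord.zigzag]
  cases s <;> cases t
  · rw [hA]; simp [bit]; rfl
  · rw [hMt, Bool.not_true, Bool.not_false, hD]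
    simp only [bit, cond_true, cond_false, Bool.false_eq_true, if_false]
    congr 1; ring
  · rw [hD]; simp [bit]; rfl
  · rw [hMt, Bool.not_true, hA]
    simp only [bit, cond_true, cond_false, if_true]
    congr 1; ring

theorem exists_zigzagPolygon (C : PetriePolygon (TorusMap b)) : ∃ s m, C = zigzagPolygon s m := by
  induction C using Quot.ind with
  | mk Φ =>
    obtain ⟨q, rfl⟩ := exists_eq_flag Φ
    exact ⟨_, _, mk_flag_eq q⟩

theorem hasEdge_iff {s : Bool} {m : ZMod b} {e : Edge (TorusMap b)} :
    (zigzagPolygon s m).HasEdge e ↔ ∃ q : FlagCoord b, q.edge = e.1 ∧ q.zigzag = (s, m) := by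
  constructor
  · rintro ⟨Φ, he, hΦ⟩
    obtain ⟨q, rfl⟩ := exists_eq_flag Φ
    refine ⟨q, eq_of_mem_flag q.edge_mem he (q.rank_edge.trans e.2.symm), ?_⟩
    rw [← PetriePolygon.zigzag_mk, hΦ, zigzag_zigzagPolygon]
  · rintro ⟨q, he, hq⟩
    exact ⟨q.flag, he ▸ q.edge_mem, by rw [mk_flag_eq, hq]⟩

/-- The horizontal edges of the torus. -/
def horEdge (i j : ZMod b) : Edge (TorusMap b) := ⟨cell (side i) (node j), rfl⟩

/-- The vertical edges of the torus. -/
def vertEdge (i j : ZMod b) : Edge (TorusMap b) := ⟨cell (node i) (side j), rfl⟩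

/-- The vertices of the torus. -/
def nodeVertex (i j : ZMod b) : Vertex (TorusMap b) := ⟨cell (node i) (node j), rfl⟩

theorem hasEdge_horEdge {s : Bool} {m i j : ZMod b} :
    (zigzagPolygon s m).HasEdge (horEdge i j) ↔ m = Shape.diag s i j := by
  rw [hasEdge_iff]
  constructor
  · rintro ⟨⟨i', j', s', t', _ | _⟩, h1, h2⟩
    · simp [FlagCoord.edge, horEdge, cell_inj] at h1
    · simp only [FlagCoord.edge, horEdge, cell_inj, cond_true, side.injEq, node.injEq] at h1
      obtain ⟨rfl, rfl⟩ := h1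
      cases s' <;> cases t' <;> simp [FlagCoord.zigzag, bit] at h2 <;> obtain ⟨rfl, rfl⟩ := h2 <;>
        simp [Shape.diag, bit] <;> ring
  · rintro rfl
    refine ⟨⟨i, j, !s, false, true⟩, by simp [FlagCoord.edge, horEdge, bit], ?_⟩
    cases s <;> simp [FlagCoord.zigzag, Shape.diag, bit]

theorem hasEdge_vertEdge {s : Bool} {m i j : ZMod b} :
    (zigzagPolygon s m).HasEdge (vertEdge i j) ↔ m = cond s (i + j) (i - j - 1) := by
  rw [hasEdge_iff]
  constructor
  · rintro ⟨⟨i', j', s', t', _ | _⟩, h1, h2⟩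
    · simp only [FlagCoord.edge, vertEdge, cell_inj, cond_false, side.injEq, node.injEq] at h1
      obtain ⟨rfl, rfl⟩ := h1
      cases s' <;> cases t' <;> simp [FlagCoord.zigzag, bit] at h2 <;> obtain ⟨rfl, rfl⟩ := h2 <;>
        simp [bit] <;> ring
    · simp [FlagCoord.edge, vertEdge, cell_inj] at h1
  · rintro rfl
    refine ⟨⟨i, j, false, !s, false⟩, by simp [FlagCoord.edge, vertEdge, bit], ?_⟩
    cases s <;> simp [FlagCoord.zigzag, bit]

end Torus

end AbsPoly

namespace AbsPoly

open RankedPoset CircleCell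

/-! ### The dual of the Petrial in the model. -/

section PetrialTorus

variable {b : ℕ} [Fact (1 < b)]

/-- A cell of the Petrial as a face of the dual of the Petrial. -/
def dualFace (c : PetrialCell (TorusMap b)) : (Petrial (TorusMap b))ᵒᵈ :=
  OrderDual.toDual (WithBot.some (WithTop.some c))

omit [Fact (1 < b)] in
theorem dualFace_le {c d : PetrialCell (TorusMap b)} : dualFace c ≤ dualFace d ↔ d.Le c := by
  unfold dualFace
  rw [OrderDual.toDual_le_toDual, WithBot.coe_le_coe, WithTop.coe_le_coe]
  exact Iff.rfl

omit [Fact (1 < b)] in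
theorem dualFace_inj {c d : PetrialCell (TorusMap b)} : dualFace c = dualFace d ↔ c = d := by
  unfold dualFace
  rw [OrderDual.toDual_inj, WithBot.coe_inj, WithTop.coe_inj]

/-- The faces of the dual of the Petrial of a toroidal map. -/
noncomputable def torusFace : Shape b → (Petrial (TorusMap b))ᵒᵈ
  | .least => OrderDual.toDual ⊤
  | .vertex s m => dualFace (.polygon (zigzagPolygon s m))
  | .hor i j => dualFace (.edge (horEdge i j))
  | .vert i j => dualFace (.edge (vertEdge i j))
  | .node i j => dualFace (.vertex (nodeVertex i j))
  | .greatest => OrderDual.toDual ⊥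

omit [Fact (1 < b)] in
theorem exists_horEdge_or_vertEdge (e : Edge (TorusMap b)) :
    (∃ i j, e = horEdge i j) ∨ ∃ i j, e = vertEdge i j := by
  rcases exists_of_rank_eq_one e.2 with ⟨i, j, h⟩ | ⟨i, j, h⟩
  · exact Or.inl ⟨i, j, Subtype.ext h⟩
  · exact Or.inr ⟨i, j, Subtype.ext h⟩

omit [Fact (1 < b)] in
theorem nodeVertex_le_horEdge {i j i' j' : ZMod b} :
    (nodeVertex i' j').1 ≤ (horEdge i j).1 ↔ j' = j ∧ (i' = i ∨ i' = i + 1) :=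
  cell_le_cell.trans and_comm

omit [Fact (1 < b)] in
theorem nodeVertex_le_vertEdge {i j i' j' : ZMod b} :
    (nodeVertex i' j').1 ≤ (vertEdge i j).1 ↔ i' = i ∧ (j' = j ∨ j' = j + 1) :=
  cell_le_cell

omit [Fact (1 < b)] in
theorem rank_torusFace (m : Shape b) : rank (torusFace m) = m.rank := by
  cases m <;> rfl

theorem torusFace_surjective : Function.Surjective (torusFace (b := b)) := by
  intro x
  obtain ⟨x, rfl⟩ := OrderDual.toDual.surjective x
  induction x using WithBot.recBotCoe with
  | bot => exact ⟨.greatest, rfl⟩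
  | coe x =>
    induction x using WithTop.recTopCoe with
    | top => exact ⟨.least, rfl⟩
    | coe x =>
      cases x with
      | vertex v =>
        obtain ⟨i, j, h⟩ := exists_of_rank_eq_zero v.2
        obtain rfl : v = nodeVertex i j := Subtype.ext h
        exact ⟨.node i j, rfl⟩
      | edge e =>
        rcases exists_horEdge_or_vertEdge e with ⟨i, j, rfl⟩ | ⟨i, j, rfl⟩
        exacts [⟨.hor i j, rfl⟩, ⟨.vert i j, rfl⟩]
      | polygon C =>
        obtain ⟨s, m, rfl⟩ := exists_zigzagPolygon C
        exact ⟨.vertex s m, rfl⟩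

theorem torusFace_injective : Function.Injective (torusFace (b := b)) := by
  intro m n h
  have hmn : m.rank = n.rank := by rw [← rank_torusFace, ← rank_torusFace, h]
  cases m <;> cases n <;> simp only [Shape.rank] at hmn <;> try omega
  · rfl
  · have h := congrArg PetriePolygon.zigzag (PetrialCell.polygon.inj (dualFace_inj.1 h))
    rw [zigzag_zigzagPolygon, zigzag_zigzagPolygon, Prod.mk.injEq] at h
    rw [h.1, h.2]
  · have h := congrArg Subtype.val (PetrialCell.edge.inj (dualFace_inj.1 h))
    simp only [horEdge, cell_inj, side.injEq, node.injEq] at h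
    rw [h.1, h.2]
  · have h := congrArg Subtype.val (PetrialCell.edge.inj (dualFace_inj.1 h))
    simp [horEdge, vertEdge, cell_inj] at h
  · have h := congrArg Subtype.val (PetrialCell.edge.inj (dualFace_inj.1 h))
    simp [horEdge, vertEdge, cell_inj] at h
  · have h := congrArg Subtype.val (PetrialCell.edge.inj (dualFace_inj.1 h))
    simp only [vertEdge, cell_inj, side.injEq, node.injEq] at h
    rw [h.1, h.2]
  · have h := congrArg Subtype.val (PetrialCell.vertex.inj (dualFace_inj.1 h))
    simp only [nodeVertex, cell_inj, node.injEq] at h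
    rw [h.1, h.2]
  · rfl

/-- The dual of the Petrial of the toroidal map has the expected faces and incidences. -/
theorem isModel_torusFace : IsModel (torusFace (b := b)) where
  surjective := torusFace_surjective
  injective := torusFace_injective
  rank_face := rank_torusFace
  least_le x := by
    obtain ⟨x, rfl⟩ := OrderDual.toDual.surjective x
    exact OrderDual.toDual_le_toDual.2 le_top
  le_greatest x := by
    obtain ⟨x, rfl⟩ := OrderDual.toDual.surjective x
    exact OrderDual.toDual_le_toDual.2 bot_le
  vertex_hor _ _ _ _ := dualFace_le.trans hasEdge_horEdge
  vertex_vert _ _ _ _ := dualFace_le.trans hasEdge_vertEdge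
  vertex_node s m i j := by
    refine dualFace_le.trans ?_
    change (∃ e : Edge (TorusMap b), (nodeVertex i j).1 ≤ e.1 ∧ (zigzagPolygon s m).HasEdge e) ↔ _
    constructor
    · rintro ⟨e, h1, h2⟩
      rcases exists_horEdge_or_vertEdge e with ⟨i', j', rfl⟩ | ⟨i', j', rfl⟩
      · rw [nodeVertex_le_horEdge] at h1
        rw [hasEdge_horEdge] at h2
        obtain ⟨rfl, rfl | rfl⟩ := h1
        · exact Or.inl h2.symm
        · right
          subst h2
          cases s <;> simp only [Shape.diag, cond_true, cond_false] <;> ring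
      · rw [nodeVertex_le_vertEdge] at h1
        rw [hasEdge_vertEdge] at h2
        subst h2
        obtain ⟨rfl, rfl | rfl⟩ := h1 <;> cases s <;>
          simp only [Shape.diag, cond_true, cond_false]
        · right; ring
        · left; trivial
        · left; ring
        · right; ring
    -- Horizontal edges suffice: a node on a zigzag is the left or the right end of one of them.
    · rintro (h | h)
      · exact ⟨horEdge i j, nodeVertex_le_horEdge.2 ⟨rfl, Or.inl rfl⟩, hasEdge_horEdge.2 h.symm⟩
      · refine ⟨horEdge (i - 1) j, nodeVertex_le_horEdge.2 ⟨rfl, Or.inr (by ring)⟩,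
          hasEdge_horEdge.2 ?_⟩
        rw [← sub_eq_iff_eq_add] at h
        rw [← h]
        cases s <;> simp only [Shape.diag, cond_true, cond_false] <;> ring
  hor_node _ _ _ _ := dualFace_le.trans nodeVertex_le_horEdge
  vert_node _ _ _ _ := dualFace_le.trans nodeVertex_le_vertEdge

end PetrialTorus

/-! ### Conclusion. -/

section Main

open MulAction

variable {F : Type*} [RankedPoset F] {v e f : F} {r₀ r₁ r₂ : Aut F}

/-- The group ⟨r₀, r₁⟩ fixes f, so f contains the whole orbit of the base vertex; all facets are
images of f. -/
theorem IsBase.isFlat (hB : IsBase v e f r₀ r₁ r₂)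
    (h : ∀ y : Vertex F, ∃ g ∈ Subgroup.closure {r₀, r₁}, g • (⟨v, hB.rank_vertex⟩ : Vertex F) = y) :
    IsFlat F := by
  rintro ⟨x, hx⟩ y
  obtain ⟨k, rfl⟩ := hB.exists_facet x hx
  obtain ⟨g, hg, hgy⟩ := h (k⁻¹ • y)
  have hle : Subgroup.closure {r₀, r₁} ≤ stabilizer (Aut F) f := by
    rw [Subgroup.closure_le]
    rintro r (rfl | rfl)
    exacts [hB.smul₀_facet, hB.smul₁_facet]
  have h1 : (k⁻¹ • y).1 ≤ f := by
    have hgf : g • v ≤ g • f :=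
      (smul_le_smul_iff_aut g).2 (hB.vertex_le_edge.trans hB.edge_le_facet)
    rw [show g • f = f from hle hg] at hgf
    rw [← hgy]
    exact hgf
  rw [coe_smul_vertex, ← smul_le_smul_iff_aut k, smul_inv_smul] at h1
  exact h1

/-- Non-flat, vertex-faithful regular polyhedra whose vertices form two blocks of the same odd prime
size `b` have the faces and incidences of the dual of the Petrial of a toroidal map. -/
theorem IsPolyhedron.exists_isModel {b : ℕ} (hb : b.Prime) (hb2 : b ≠ 2) (hP : IsPolyhedron F)
    (hreg : IsRegular F) (hflat : ¬ IsFlat F) (hfaith : IsVertexFaithful F)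
    (hcard : Nat.card (Vertex F) = 2 * b)
    (hblocks : ∃ ℬ : Set (Set (Vertex F)),
      IsBlockSystem (Aut F) ℬ ∧ ℬ.ncard = 2 ∧ ∀ B ∈ ℬ, B.ncard = b) :
    ∃ face : Shape b → F, IsModel face := by
  obtain ⟨v, e, f, r₀, r₁, r₂, hB⟩ := hP.exists_isBase hreg
  have : FaithfulSMul (Aut F) (Vertex F) := ⟨fun {g h} hgh => by
    have := hfaith (h⁻¹ * g) fun w => by rw [mul_smul, hgh, inv_smul_smul]
    exact (inv_mul_eq_one.1 this).symm⟩
  let u : Vertex F := ⟨v, hB.rank_vertex⟩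
  have : IsPretransitive (Aut F) (Vertex F) := .of_orbit (x₀ := u) fun w => by
    obtain ⟨g, hg⟩ := hB.exists_vertex w.1 w.2
    exact ⟨g, Subtype.ext hg⟩
  have hD : ∀ g : Aut F, g • u = u ↔ g ∈ Subgroup.closure {r₁, r₂} := by
    refine fun g => ⟨fun hg => hB.stabilizer_vertex g (congrArg Subtype.val hg), fun hg => ?_⟩
    have hle : Subgroup.closure {r₁, r₂} ≤ stabilizer (Aut F) u := by
      rw [Subgroup.closure_le]
      rintro r (rfl | rfl)
      exacts [Subtype.ext hB.smul₁_vertex, Subtype.ext hB.smul₂_vertex]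
    exact hle hg
  rcases transitive_or_exists_toroidalCoordinates hb hb2 hcard hblocks hB.sq₀ hB.sq₁ hB.sq₂ hB.comm
    hB.ne_one₁ hB.ne_one₂ hB.ne hD hB.closure_eq_top with h | ⟨pt, hpt, hT⟩
  · exact absurd (hB.isFlat h) hflat
  · exact hT.exists_isModel hfaith hB (congrArg Subtype.val hpt) hP.isGraded hb hb2

end Main

end AbsPoly

theorem mainTheorem9 (b : ℕ) (hb : b.Prime) (hb7 : 7 ≤ b)
    (P : Type*) [AbsPoly.RankedPoset P]
    (hP : AbsPoly.IsPolyhedron P) (hreg : AbsPoly.IsRegular P)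
    (hflat : ¬ AbsPoly.IsFlat P) (hfaith : AbsPoly.IsVertexFaithful P)
    (hcard : Nat.card (AbsPoly.Vertex P) = 2 * b)
    (hblocks : ∃ ℬ : Set (Set (AbsPoly.Vertex P)),
      MulAction.IsBlockSystem (AbsPoly.Aut P) ℬ ∧ ℬ.ncard = 2 ∧ ∀ B ∈ ℬ, B.ncard = b) :
    (∃ p : ℕ∞, AbsPoly.HasSchlafliType P p (2 * b)) ∧
      AbsPoly.Isomorphic P (AbsPoly.Petrial (AbsPoly.TorusMap b))ᵒᵈ := by
  have : Fact (1 < b) := ⟨hb.one_lt⟩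
  obtain ⟨face, h⟩ := hP.exists_isModel hb (by omega) hreg hflat hfaith hcard hblocks
  exact ⟨⟨4, h.hasSchlafliType⟩, h.isomorphic AbsPoly.isModel_torusFace⟩
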